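/- Use coordinates $(x_1,x_2,y_1,y_2,z_1,z_2)$ on $\mathbb{R}^6$. **Definitions.** Let $D$ be a smooth corank-2 distribution on a 6-manifold $M$. - $D$ is *fat* if at every point the quadratic form $\psi\mapsto (d\psi|_D)\wedge(d\psi|_D)\in\Lambda^4D^*$ on the annihilator $D^\perp\subset T^*M$ is definite. - Vector fields $Z_1,Z_2$ near $p$ are *Reeb directions* of $D$ if near $p$ one can write $D=\ker\lambda_1\cap\ker\lambda_2$ with smooth 1-forms such that $TM=D\oplus\langle Z_1,Z_2\rangle$, $\lambda_i(Z_j)=\delta_{ij}$, $\iota_{Z_i}d\lambda_j|_D=0$ for all $i,j$, and $[Z_1,Z_2]=0$. - The germ of $D$ at $p$ *supports a complex contact structure* (is a *complex-contact germ*) if there are smooth complex coordinates $\Phi$ from a neighbourhood of $p$ to an open subset of $\mathbb{C}^3$ and a holomorphic 1-form $\alpha$ near $\Phi(p)$ with $\alpha\wedge d\alpha\neq0$ such that $D=\{v:\alpha(d\Phi(v))=0\}$ near $p$. - Let $X$ be a set of germs of distributions at $p$ and $A\subseteq X$. A *smooth family in $X$ through $a$* is a family $(D_s)$ of germs in $X$,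 with $s$ near $0\in\mathbb{R}^m$ and $D_0=a$, defined near $p$ (uniformly in $s$) by two pointwise independent 1-forms depending jointly smoothly on $s$ and the point. $A$ has *codimension at least $n$ in $X$* if for every $a\in A$ there is a function $G$ from germs to $\mathbb{R}^n$ that vanishes on $A$, such that $s\mapsto G(D_s)$ is smooth near $0$ for every smooth family in $X$ through $a$, and has surjective differential at $s=0$ for some $n$-parameter smooth family in $X$ through $a$. $A$ has *infinite codimension in $X$* if this holds for every $n\in\mathbb{N}$. **Theorem.** For smooth $\kappa:\mathbb{R}\to\mathbb{R}$ let $\mathcal{H}_\kappa=\ker\alpha^1_\kappa\cap\ker\alpha^2$ on $\mathbb{R}^6$, where $$\alpha^1_\kappa=dz_1-y_1dx_1-y_2dx_2-\Big(\tfrac{x_2^3}{3}+x_2+2x_1+\kappa(y_1)\Big)dy_1,\qquad \alpha^2=dz_2-y_2dx_1-y_1dx_2 .$$ 1. For every smooth $\kappa$, the germ of $\mathcal{H}_\kappa$ at $0$ (i) is a fat corank-2 distribution germ, (ii) has Reeb directions $\partial_{z_1},\partial_{z_2}$, and (iii) no germ diffeomorphic to it supports a complex contact structure. The family of germs is infinite-dimensional: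 if $\mathcal{H}_\kappa$ and $\mathcal{H}_{\kappa'}$ have the same germ at $0$, then $\kappa$ and $\kappa'$ have the same germ at $0$. 2. Let $M$ be a smooth manifold of dimension $6$ and $p\in M$. For every smooth chart $e$ around $p$ with $e(p)=0$ and every smooth $\kappa$, the germ at $p$ that corresponds to $\mathcal{H}_\kappa$ under $e$ is a fat $(4,6)$-germ with Reeb directions and is not a complex-contact germ. The set of complex-contact germs at $p$ is a nonempty subset of the set of fat $(4,6)$-germs at $p$ with Reeb directions, and it has infinite codimension in it. -/

import Mathlib

open Set Filter Topology
open scoped ContDiff Manifold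

namespace FatReeb

/-- Real six-space, with coordinates `(x₁, x₂, y₁, y₂, z₁, z₂)` at the indices `0, …, 5`. -/
abbrev E6 : Type := EuclideanSpace ℝ (Fin 6)

/-- Complex three-space. -/
abbrev C3 : Type := EuclideanSpace ℂ (Fin 3)

/-! ### Forms, smooth germs and local diffeomorphisms in vector spaces -/

/-- `f` is smooth on a whole neighbourhood of `p`, i.e. it defines a smooth germ at `p`. -/
def SmoothNear {V W : Type*} [NormedAddCommGroup V] [NormedSpace ℝ V] [NormedAddCommGroup W]
    [NormedSpace ℝ W] (f : V → W) (p : V) : Prop :=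
  ∀ᶠ x in 𝓝 p, ContDiffAt ℝ ∞ f x

/-- `Φ` is a diffeomorphism from a neighbourhood of `p` onto a neighbourhood of `Φ p`
(formulated by the inverse function theorem). -/
def IsLocalDiffeoNear {V W : Type*} [NormedAddCommGroup V] [NormedSpace ℝ V]
    [NormedAddCommGroup W] [NormedSpace ℝ W] (Φ : V → W) (p : V) : Prop :=
  SmoothNear Φ p ∧ Function.Bijective (fderiv ℝ Φ p)

/-- The exterior derivative `dθ(u, v)` at `x` of a one-form `θ` on a vector space. -/
noncomputable def extD {𝕜 V : Type*} [NontriviallyNormedField 𝕜] [NormedAddCommGroup V]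
    [NormedSpace 𝕜 V] (θ : V → V →L[𝕜] 𝕜) (x u v : V) : 𝕜 :=
  fderiv 𝕜 θ x u v - fderiv 𝕜 θ x v u

/-- The value `(η ∧ η)(v₀, v₁, v₂, v₃)` for a two-form `η`. -/
def wedgeSq {V : Type*} (η : V → V → ℝ) (v : Fin 4 → V) : ℝ :=
  2 * (η (v 0) (v 1) * η (v 2) (v 3) - η (v 0) (v 2) * η (v 1) (v 3)
    + η (v 0) (v 3) * η (v 1) (v 2))

/-! ### Germs of corank-two distributions on six-space -/

/-- Near `p`, the field of subspaces `D` is the smooth corank-two distribution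
`ker θ₀ ∩ ker θ₁` for smooth one-forms `θ₀, θ₁` that are independent at `p` (hence near `p`). -/
def IsDefinedBy (D : E6 → Submodule ℝ E6) (θ : Fin 2 → E6 → E6 →L[ℝ] ℝ) (p : E6) : Prop :=
  (∀ i, SmoothNear (θ i) p) ∧ LinearIndependent ℝ (fun i => θ i p) ∧
    ∀ᶠ x in 𝓝 p, ∀ v, v ∈ D x ↔ ∀ i, θ i x v = 0

/-- The germ of `D` at `p` is a fat (elliptic) corank-two distribution germ: near `p` the quadratic
form `(a, b) ↦ (d(a θ₀ + b θ₁)|_D)²` on the annihilator of `D`, with values in the line `Λ⁴D*`, is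
definite. An identification of `Λ⁴D*` with `ℝ` is given by evaluation on a frame of `D`. The
coefficients `a, b` may be taken constant, since the restriction to `D` of the exterior derivative
of a section of the annihilator is tensorial. -/
def IsFat (D : E6 → Submodule ℝ E6) (p : E6) : Prop :=
  ∃ θ : Fin 2 → E6 → E6 →L[ℝ] ℝ, IsDefinedBy D θ p ∧
    ∀ᶠ x in 𝓝 p, ∃ v : Fin 4 → E6, (∀ i, v i ∈ D x) ∧
      ∀ a b : ℝ, (a, b) ≠ (0, 0) →
        0 < wedgeSq (fun u w => a * extD (θ 0) x u w + b * extD (θ 1) x u w) v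

/-- Near `p`, the vector fields `Z 0, Z 1` are Reeb directions of the corank-two distribution
`D`. -/
def AreReebDirections (D : E6 → Submodule ℝ E6) (Z : Fin 2 → E6 → E6) (p : E6) : Prop :=
  (∀ i, SmoothNear (Z i) p) ∧
  ∃ θ : Fin 2 → E6 → E6 →L[ℝ] ℝ, IsDefinedBy D θ p ∧
    ∀ᶠ x in 𝓝 p,
      IsCompl (D x) (Submodule.span ℝ (range fun i => Z i x)) ∧
      (∀ i j, θ i x (Z j x) = if i = j then 1 else 0) ∧
      (∀ i j, ∀ v ∈ D x, extD (θ j) x (Z i x) v = 0) ∧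
      VectorField.lieBracket ℝ (Z 0) (Z 1) x = 0

/-- `α` is a holomorphic one-form near `q ∈ ℂ³` with `α ∧ dα ≠ 0` at `q` (hence near `q`). -/
def IsHolomorphicContactForm (α : C3 → C3 →L[ℂ] ℂ) (q : C3) : Prop :=
  AnalyticAt ℂ α q ∧ ∃ u v w : C3,
    α q u * extD α q v w + α q v * extD α q w u + α q w * extD α q u v ≠ 0

/-- The germ of `D` at `p` supports a complex contact structure: some smooth complex coordinate
chart `Φ` near `p` carries `D` to the kernel of a holomorphic contact form. -/
def SupportsComplexContact (D : E6 → Submodule ℝ E6) (p : E6) : Prop :=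
  ∃ Φ : E6 → C3, IsLocalDiffeoNear Φ p ∧
    ∃ α : C3 → C3 →L[ℂ] ℂ, IsHolomorphicContactForm α (Φ p) ∧
      ∀ᶠ x in 𝓝 p, ∀ v, v ∈ D x ↔ α (Φ x) (fderiv ℝ Φ x v) = 0

/-- The germ of `D` at `p` and the germ of `D'` at `q` are diffeomorphic. -/
def DiffeomorphicGerms (D : E6 → Submodule ℝ E6) (p : E6) (D' : E6 → Submodule ℝ E6) (q : E6) :
    Prop :=
  ∃ Φ : E6 → E6, IsLocalDiffeoNear Φ p ∧ Φ p = q ∧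
    ∀ᶠ x in 𝓝 p, D' (Φ x) = (D x).map (fderiv ℝ Φ x : E6 →ₗ[ℝ] E6)

/-! ### The family `H_κ` -/

/-- The differential of the `i`-th coordinate. -/
noncomputable def dcoord (i : Fin 6) : E6 →L[ℝ] ℝ := EuclideanSpace.proj i

/-- `α¹_κ = dz₁ - y₁ dx₁ - y₂ dx₂ - (x₂³/3 + x₂ + 2 x₁ + κ(y₁)) dy₁`. -/
noncomputable def alpha1 (κ : ℝ → ℝ) (p : E6) : E6 →L[ℝ] ℝ :=
  dcoord 4 - p 2 • dcoord 0 - p 3 • dcoord 1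
    - ((p 1) ^ 3 / 3 + p 1 + 2 * p 0 + κ (p 2)) • dcoord 2

/-- `α² = dz₂ - y₂ dx₁ - y₁ dx₂`. -/
noncomputable def alpha2 (p : E6) : E6 →L[ℝ] ℝ :=
  dcoord 5 - p 3 • dcoord 0 - p 2 • dcoord 1

/-- `H_κ = ker α¹_κ ∩ ker α²`. -/
noncomputable def H (κ : ℝ → ℝ) (p : E6) : Submodule ℝ E6 :=
  (alpha1 κ p : E6 →ₗ[ℝ] ℝ).ker ⊓ (alpha2 p : E6 →ₗ[ℝ] ℝ).ker

/-- The constant vector fields `∂_{z₁}, ∂_{z₂}`. -/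
noncomputable def dz : Fin 2 → E6 → E6 :=
  ![fun _ => EuclideanSpace.single 4 1, fun _ => EuclideanSpace.single 5 1]

/-! ### Germs of distributions on six-manifolds -/

section Manifold

variable (M : Type*) [TopologicalSpace M] [ChartedSpace E6 M]

/-- Fields of tangent subspaces on `M` (smoothness is imposed separately, near a point). -/
abbrev Distribution : Type _ := ∀ x : M, Submodule ℝ (TangentSpace 𝓘(ℝ, E6) x)

variable {M}

/-- The distribution `D` read in the chart `e`, i.e. its image under the differential of `e`. -/
noncomputable def inChart (e : OpenPartialHomeomorph M E6) (D : Distribution M) (y : E6) :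
    Submodule ℝ E6 :=
  (D (e.symm y)).map (mfderiv 𝓘(ℝ, E6) 𝓘(ℝ, E6) e (e.symm y)).toLinearMap

/-- `e` is a smooth chart of `M` around `p`. -/
def IsChartAt (e : OpenPartialHomeomorph M E6) (p : M) : Prop :=
  e ∈ IsManifold.maximalAtlas 𝓘(ℝ, E6) ∞ M ∧ p ∈ e.source

/-- The distributions whose germ at `p` is a fat `(4,6)`-germ admitting Reeb directions. -/
def fatReebGerms (p : M) : Set (Distribution M) :=
  {D | ∃ e : OpenPartialHomeomorph M E6, IsChartAt e p ∧ IsFat (inChart e D) (e p) ∧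
    ∃ Z : Fin 2 → E6 → E6, AreReebDirections (inChart e D) Z (e p)}

/-- The distributions whose germ at `p` underlies a complex contact structure. -/
def complexContactGerms (p : M) : Set (Distribution M) :=
  {D | ∃ e : OpenPartialHomeomorph M E6, IsChartAt e p ∧
    SupportsComplexContact (inChart e D) (e p)}

/-- `D` is a smooth family of corank-two distribution germs at `p` with parameter `s ∈ ℝᵐ`
near `0`: in a chart, `D s = ker θ₀(s, ·) ∩ ker θ₁(s, ·)` near `p` for all small `s`, with one-forms
that are jointly smooth in the parameter and the point, and independent. -/
def IsSmoothFamily {m : ℕ} (D : EuclideanSpace ℝ (Fin m) → Distribution M) (p : M) : Prop :=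
  ∃ e : OpenPartialHomeomorph M E6, IsChartAt e p ∧
    ∃ θ : Fin 2 → EuclideanSpace ℝ (Fin m) × E6 → E6 →L[ℝ] ℝ,
      (∀ i, SmoothNear (θ i) (0, e p)) ∧ LinearIndependent ℝ (fun i => θ i (0, e p)) ∧
      ∀ᶠ z in 𝓝 ((0 : EuclideanSpace ℝ (Fin m)), e p),
        ∀ v, v ∈ inChart e (D z.1) z.2 ↔ ∀ i, θ i z v = 0

/-- `D` is a smooth `m`-parameter family of germs at `p` that passes through the germ of `a` at
parameter `0` and stays in `X`. -/
def IsFamilyThrough (X : Set (Distribution M)) (p : M) (a : Distribution M) {m : ℕ}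
    (D : EuclideanSpace ℝ (Fin m) → Distribution M) : Prop :=
  IsSmoothFamily D p ∧ (∀ᶠ x in 𝓝 p, D 0 x = a x) ∧ ∀ᶠ s in 𝓝 0, D s ∈ X

/-- For classes `A, X` of germs at `p`: `A` has codimension at least `n` in `X`. Around each of its
members, `A` lies in the common zero set of `n` functions `G = (G₁, …, Gₙ)` on the space of germs,
which are smooth along smooth families in `X` and whose differentials are independent: `G` restricts
to a submersion onto `ℝⁿ` along some `n`-parameter family in `X`. -/
def HasCodimGE (A X : Set (Distribution M)) (p : M) (n : ℕ) : Prop :=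
  ∀ a ∈ A ∩ X, ∃ G : Distribution M → EuclideanSpace ℝ (Fin n),
    (∀ D D' : Distribution M, (∀ᶠ x in 𝓝 p, D x = D' x) → G D = G D') ∧
    (∀ D ∈ A ∩ X, G D = 0) ∧
    (∀ (m : ℕ) (D : EuclideanSpace ℝ (Fin m) → Distribution M),
      IsFamilyThrough X p a D → SmoothNear (fun s => G (D s)) 0) ∧
    ∃ D : EuclideanSpace ℝ (Fin n) → Distribution M, IsFamilyThrough X p a D ∧
      Function.Surjective (fderiv ℝ (fun s => G (D s)) 0)

/-- `A` has infinite codimension in `X`. -/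
def HasInfiniteCodim (A X : Set (Distribution M)) (p : M) : Prop :=
  ∀ n : ℕ, HasCodimGE A X p n

end Manifold

end FatReeb

/-! Where a corank-two distribution is a graph, it is the kernel of one complex form θ = dz − ∑ f_i
dx_i with z = x₄ + i x₅, and every complex form with this kernel is Z θ + Z' θ̄. If the distribution
underlies a complex contact structure, let Θ be the pulled-back contact form. After replacing Θ by
its conjugate if necessary, Θ = Z (θ + μ θ̄) with |μ| ≤ 1 at the base point. Two consequences of the
fact that dα has type (2,0) are used.

First, the distribution has complex dimension two, so the Pfaffian of dΘ on it vanishes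
(`IsContactJet.pf_eq_zero`). This is a quadratic equation for μ with coefficients in the curvature
of the graph. For an elliptic pencil it has exactly one root in the closed unit disc
(`IsElliptic.eq_beltrami`), so μ is a function of the one-jet of f.

Second, a complex horizontal vector ξ in the kernel of dΘ on the distribution has type (0,1), so
contracting dΘ with ξ gives zero on the whole tangent space (`IsContactJet.sum_eq_zero`). Pairing ξ
with the vertical vector ∂_z̄ − μ ∂_z, which Θ kills, removes the derivatives of Z. What remains is
the expression `obstruction` in f, μ and their first derivatives, and it must vanish
(`obstruction_eq_zero`).

For H_κ the function κ does not enter the curvature, because κ(y₁) dy₁ is closed. The equation for μ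
is 4μ = i (x₂² + 1)(1 − μ²), and at points with x₂ ≠ 0 the obstruction forces μ = ±1, which never
solves that equation. Such points accumulate at the origin. The germ of κ itself is read off from
the coefficients of the graph.

For the codimension, a complex-contact germ is put in the form dw = v du by the holomorphic Darboux
theorem (`exists_darboux`). In this chart the obstruction, suitably normalized, is a smooth function
`torsion` on regular germs. Its first n derivatives at the origin along a line form an invariant of
germs (`germInvariant`) that vanishes on complex-contact germs. The deformation dw = v du − Φ_s(ū)
dv̄ has torsion Φ_s''(ū), and Φ_s is chosen so that the invariant of the s-th member is s
(`germInvariant_model`). All its members are fat with Reeb directions ∂_{z₁}, ∂_{z₂}, so the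
invariant is a submersion along a family in the required class.

The Darboux theorem needs a holomorphic flow box. It comes from the implicit function theorem in the
Banach space of continuous functions on [0, 1]. -/

namespace FatReeb

/-! ### Holomorphic scalar differential equations and their dependence on data -/

section Composition

variable {K E F : Type*} [TopologicalSpace K] [CompactSpace K] [NormedAddCommGroup E]
  [NormedSpace ℂ E] [NormedAddCommGroup F] [NormedSpace ℂ F]

/-- A continuous multilinear map acts pointwise on continuous functions. -/
noncomputable def pointwiseMultilinear {n : ℕ}
    (p : ContinuousMultilinearMap ℂ (fun _ : Fin n => E) F) :
    ContinuousMultilinearMap ℂ (fun _ : Fin n => C(K, E)) C(K, F) :=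
  MultilinearMap.mkContinuous
    { toFun := fun γ => ⟨fun k => p fun i => γ i k, by fun_prop⟩
      map_update_add' := by
        intro _ m i x y
        ext k
        have (z : C(K, E)) : (fun j => Function.update m i z j k)
            = Function.update (fun j => m j k) i (z k) := by
          ext j; by_cases h : j = i
          · subst h; simp
          · simp [h]
        simp [this]
      map_update_smul' := by
        intro _ m i c x
        ext k
        have (z : C(K, E)) : (fun j => Function.update m i z j k)
            = Function.update (fun j => m j k) i (z k) := by
          ext j; by_cases h : j = i
          · subst h; simp
          · simp [h]
        simp [this] }
    ‖p‖ (by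
      intro γ
      refine (ContinuousMap.norm_le _ (by positivity)).2 fun k => ?_
      refine (p.le_opNorm _).trans ?_
      gcongr with i
      exact (γ i).norm_coe_le_norm k)

lemma norm_pointwiseMultilinear_le {n : ℕ}
    (p : ContinuousMultilinearMap ℂ (fun _ : Fin n => E) F) :
    ‖(pointwiseMultilinear p : ContinuousMultilinearMap ℂ (fun _ : Fin n => C(K, E)) C(K, F))‖
      ≤ ‖p‖ :=
  MultilinearMap.mkContinuous_norm_le _ (norm_nonneg _) _

/-- Composition with an analytic map is analytic on continuous functions with small values. -/
lemma exists_analyticAt_composition [CompleteSpace F] {B : E → F} (hB : AnalyticAt ℂ B 0) :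
    ∃ Ω : C(K, E) → C(K, F), AnalyticAt ℂ Ω 0 ∧ ∀ᶠ γ in 𝓝 0, ∀ k, Ω γ k = B (γ k) := by
  obtain ⟨p, r, hp⟩ := hB
  -- The composition operator has the same Taylor coefficients, acting pointwise. This does not
  -- increase their norms, so the radius of convergence does not shrink.
  let P : FormalMultilinearSeries ℂ C(K, E) C(K, F) := fun n => pointwiseMultilinear (p n)
  have hle : p.radius ≤ P.radius :=
    FormalMultilinearSeries.radius_le_of_le fun n => norm_pointwiseMultilinear_le (p n)
  have hpos : 0 < P.radius := (hp.r_pos.trans_le hp.r_le).trans_le hle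
  have hP := P.hasFPowerSeriesOnBall hpos
  refine ⟨P.sum, hP.analyticAt, ?_⟩
  have hr : 0 < min r P.radius := lt_min hp.r_pos hpos
  filter_upwards [Metric.eball_mem_nhds (0 : C(K, E)) hr] with γ hγ k
  have h1 := hP.hasSum (y := γ) (Metric.eball_subset_eball (min_le_right _ _) hγ)
  have hk : γ k ∈ Metric.eball (0 : E) r := by
    rw [Metric.mem_eball, edist_zero_right] at hγ ⊢
    refine lt_of_le_of_lt ?_ (hγ.trans_le (min_le_left _ _))
    exact ENNReal.coe_le_coe.2 (γ.norm_coe_le_norm k)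
  have h2 := hp.hasSum hk
  have h3 := h1.mapL (ContinuousMap.evalCLM ℂ k)
  rw [zero_add] at h2 h3
  exact h3.unique h2

end Composition

/-- The primitive vanishing at `0` of a continuous function on the unit interval. -/
noncomputable def primitive : C(unitInterval, ℂ) →L[ℂ] C(unitInterval, ℂ) :=
  LinearMap.mkContinuous
    { toFun := fun f => ⟨fun σ => ∫ r in (0 : ℝ)..σ, Set.IccExtend zero_le_one f r, by
        have : Continuous fun s : ℝ => ∫ r in (0 : ℝ)..s, Set.IccExtend zero_le_one f r :=
          intervalIntegral.continuous_primitive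
            (fun a b => (f.continuous.Icc_extend' (h := zero_le_one)).intervalIntegrable a b) 0
        exact this.comp continuous_subtype_val⟩
      map_add' := by
        intro f g
        ext σ
        rw [ContinuousMap.add_apply]
        exact intervalIntegral.integral_add
          ((f.continuous.Icc_extend' (h := zero_le_one)).intervalIntegrable _ _)
          ((g.continuous.Icc_extend' (h := zero_le_one)).intervalIntegrable _ _)
      map_smul' := by
        intro c f
        ext σ
        exact intervalIntegral.integral_smul c _ }
    1 (by
      intro f
      refine (ContinuousMap.norm_le _ (by positivity)).2 fun σ => ?_
      have h := intervalIntegral.norm_integral_le_of_norm_le_const (a := 0) (b := (σ : ℝ))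
        (f := Set.IccExtend zero_le_one f) (C := ‖f‖) fun x _ => f.norm_coe_le_norm _
      refine h.trans ?_
      rw [mul_comm]
      gcongr
      rw [sub_zero, abs_of_nonneg σ.2.1]
      exact σ.2.2)

lemma primitive_apply (f : C(unitInterval, ℂ)) (σ : unitInterval) :
    primitive f σ = ∫ r in (0 : ℝ)..σ, Set.IccExtend zero_le_one f r := rfl

lemma primitive_apply_eq {f : C(unitInterval, ℂ)} {g : ℝ → ℂ}
    (h : ∀ r : unitInterval, f r = g r) (σ : unitInterval) :
    primitive f σ = ∫ r in (0 : ℝ)..σ, g r := by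
  rw [primitive_apply]
  refine intervalIntegral.integral_congr fun r hr => ?_
  rw [Set.uIcc_of_le σ.2.1] at hr
  have hr' : r ∈ Set.Icc (0 : ℝ) 1 := ⟨hr.1, hr.2.trans σ.2.2⟩
  simp only [Set.IccExtend_of_mem _ _ hr', h]

/-- Solutions of a holomorphic integral equation depending holomorphically on the initial value,
a parameter and the length of the (complex) time interval. -/
lemma exists_analyticAt_integral_solution {B : ℂ × ℂ × ℂ → ℂ} (hB : AnalyticAt ℂ B 0) :
    ∃ y : ℂ × ℂ × ℂ → ℂ, AnalyticAt ℂ y 0 ∧ y 0 = 0 ∧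
      ∀ᶠ p : ℂ × ℂ × ℂ in 𝓝 0, ∀ σ ∈ Icc (0 : ℝ) 1,
        y (p.1, p.2.1, σ * p.2.2) = p.2.1 + p.2.2 * ∫ r in (0 : ℝ)..σ,
          B (p.1, y (p.1, p.2.1, r * p.2.2), r * p.2.2) := by
  obtain ⟨Ω, hΩ, hΩB⟩ := exists_analyticAt_composition (K := unitInterval) hB
  let cst : ℂ →L[ℂ] C(unitInterval, ℂ) := ContinuousLinearMap.const ℂ unitInterval
  let τ : C(unitInterval, ℂ) := ⟨fun σ => ((σ : ℝ) : ℂ), by fun_prop⟩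
  let i₁ : C(unitInterval, ℂ) →L[ℂ] C(unitInterval, ℂ × ℂ × ℂ) :=
    (ContinuousLinearMap.inl ℂ ℂ (ℂ × ℂ)).compLeftContinuous ℂ unitInterval
  let i₂ : C(unitInterval, ℂ) →L[ℂ] C(unitInterval, ℂ × ℂ × ℂ) :=
    ((ContinuousLinearMap.inr ℂ ℂ (ℂ × ℂ)).comp
      (ContinuousLinearMap.inl ℂ ℂ ℂ)).compLeftContinuous ℂ unitInterval
  let i₃ : C(unitInterval, ℂ) →L[ℂ] C(unitInterval, ℂ × ℂ × ℂ) :=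
    ((ContinuousLinearMap.inr ℂ ℂ (ℂ × ℂ)).comp
      (ContinuousLinearMap.inr ℂ ℂ ℂ)).compLeftContinuous ℂ unitInterval
  let γ : (ℂ × ℂ × ℂ) × C(unitInterval, ℂ) → C(unitInterval, ℂ × ℂ × ℂ) := fun q =>
    i₁ (cst q.1.1) + i₂ q.2 + i₃ (q.1.2.2 • τ)
  have hγ_apply (q) (k : unitInterval) : γ q k = (q.1.1, q.2 k, (k : ℝ) * q.1.2.2) := by
    simp [γ, i₁, i₂, i₃, cst, τ, mul_comm]
  have hγ : AnalyticAt ℂ γ 0 := by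
    have : ContDiff ℂ ω γ := by fun_prop
    exact this.contDiffAt.analyticAt
  have hγ0 : γ 0 = 0 := by ext k <;> simp [hγ_apply]
  -- Zeros of `F` are the curves η with η(σ) = w + t ∫₀^σ B(x, η(r), r t) dr. Rescaling turns the
  -- complex time t into a parameter, so that all unknown curves live on the fixed interval [0, 1].
  let F : (ℂ × ℂ × ℂ) × C(unitInterval, ℂ) → C(unitInterval, ℂ) := fun q =>
    q.2 - cst q.1.2.1 - q.1.2.2 • primitive (Ω (γ q))
  have hF : ContDiffAt ℂ ω F 0 := by
    have h1 : ContDiffAt ℂ ω (fun q => Ω (γ q)) 0 :=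
      (AnalyticAt.comp (by rwa [hγ0]) hγ : AnalyticAt ℂ (Ω ∘ γ) 0).contDiffAt
    have h2 : ContDiffAt ℂ ω (fun q => primitive (Ω (γ q))) 0 :=
      primitive.contDiff.contDiffAt.comp 0 h1
    have h3 : ContDiffAt ℂ ω
        (fun q : (ℂ × ℂ × ℂ) × C(unitInterval, ℂ) => cst q.1.2.1) 0 :=
      cst.contDiff.contDiffAt.comp 0 (by fun_prop)
    have h4 : ContDiffAt ℂ ω
        (fun q : (ℂ × ℂ × ℂ) × C(unitInterval, ℂ) => q.1.2.2) 0 := by fun_prop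
    exact (contDiffAt_snd.sub h3).sub (h4.smul h2)
  have hF0 : F 0 = 0 := by
    ext k
    simp [F, cst]
  -- On the slice where the parameters vanish one has t = 0, so the integral term is absent and `F`
  -- is the identity in the unknown curve.
  have hinr : fderiv ℂ F 0 ∘L .inr ℂ (ℂ × ℂ × ℂ) C(unitInterval, ℂ) = .id ℂ _ := by
    have h1 : HasFDerivAt F (fderiv ℂ F 0)
        ((ContinuousLinearMap.inr ℂ (ℂ × ℂ × ℂ) C(unitInterval, ℂ)) 0) := by
      rw [map_zero]; exact (hF.differentiableAt (by simp)).hasFDerivAt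
    have h2 := h1.comp (0 : C(unitInterval, ℂ))
      (ContinuousLinearMap.inr ℂ (ℂ × ℂ × ℂ) C(unitInterval, ℂ)).hasFDerivAt
    have h3 : F ∘ (ContinuousLinearMap.inr ℂ (ℂ × ℂ × ℂ) C(unitInterval, ℂ)) = id := by
      ext η k; simp [F, cst]
    rw [h3] at h2
    exact h2.unique (hasFDerivAt_id _)
  have hinv : (fderiv ℂ F 0 ∘L .inr ℂ (ℂ × ℂ × ℂ) C(unitInterval, ℂ)).IsInvertible := by
    rw [hinr]; exact ⟨.refl ℂ _, rfl⟩
  let ψ := hF.implicitFunction (by simp) hinv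
  have hψ : ContDiffAt ℂ ω ψ 0 := hF.contDiffAt_implicitFunction (by simp) hinv
  have hψ0 : ψ 0 = 0 := hF.implicitFunction_apply_self (by simp) hinv
  have hψF : ∀ᶠ q in 𝓝 (0 : (ℂ × ℂ × ℂ) × C(unitInterval, ℂ)), F q = 0 ↔ ψ q.1 = q.2 := by
    have := hF.eventually_apply_eq_iff_implicitFunction (by simp) hinv
    rwa [hF0] at this
  have hBq : ∀ᶠ q in 𝓝 (0 : (ℂ × ℂ × ℂ) × C(unitInterval, ℂ)), ∀ k, Ω (γ q) k = B (γ q k) := by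
    have h := hγ.continuousAt.tendsto
    rw [hγ0] at h
    exact h.eventually hΩB
  obtain ⟨δ, hδ, hball⟩ := Metric.eventually_nhds_iff.1 (hψF.and hBq)
  have hsmall : ∀ᶠ p in 𝓝 (0 : ℂ × ℂ × ℂ), ‖p‖ < δ ∧ ‖ψ p‖ < δ := by
    have h1 : ∀ᶠ p in 𝓝 (0 : ℂ × ℂ × ℂ), ‖p‖ < δ := by
      have := (continuous_norm (E := ℂ × ℂ × ℂ)).tendsto 0
      rw [norm_zero] at this
      exact this.eventually_lt_const hδ
    have h2 : ∀ᶠ p in 𝓝 (0 : ℂ × ℂ × ℂ), ‖ψ p‖ < δ := by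
      have := hψ.continuousAt.norm.tendsto
      rw [hψ0, norm_zero] at this
      exact this.eventually_lt_const hδ
    exact h1.and h2
  have hint (q : (ℂ × ℂ × ℂ) × C(unitInterval, ℂ)) (hq1 : ‖q.1‖ < δ) (hq2 : ‖q.2‖ < δ)
      (g : ℝ → ℂ) (hg : ∀ r : unitInterval, q.2 r = g r) :
      (ψ q.1 = q.2 ↔ ∀ σ : unitInterval, q.2 σ = q.1.2.1 + q.1.2.2 *
        ∫ r in (0 : ℝ)..σ, B (q.1.1, g r, r * q.1.2.2)) := by
    have hq : dist q 0 < δ := by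
      rw [dist_zero_right, Prod.norm_def]; exact max_lt hq1 hq2
    obtain ⟨h1, h2⟩ := hball hq
    rw [← h1]
    have h3 (σ : unitInterval) : primitive (Ω (γ q)) σ =
        ∫ r in (0 : ℝ)..σ, B (q.1.1, g r, r * q.1.2.2) := by
      refine primitive_apply_eq (fun r => ?_) σ
      rw [h2, hγ_apply, hg]
    rw [ContinuousMap.ext_iff]
    refine forall_congr' fun σ => ?_
    have h4 : F q σ = q.2 σ - q.1.2.1 - q.1.2.2 * primitive (Ω (γ q)) σ := rfl
    rw [h4, h3, ContinuousMap.zero_apply, sub_sub, sub_eq_zero]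
  -- By local uniqueness the solution for time σt is the solution for time t, reparametrized by r ↦
  -- σr. Hence the endpoint values `ψ p 1` contain the whole curves.
  have hscale : ∀ᶠ p in 𝓝 (0 : ℂ × ℂ × ℂ), ∀ σ : unitInterval,
      ψ (p.1, p.2.1, (σ : ℝ) * p.2.2) 1 = ψ p σ := by
    filter_upwards [hsmall] with p hp σ
    have h1 := (hint (p, ψ p) hp.1 hp.2 (Set.IccExtend zero_le_one (ψ p))
      (fun r => by simp)).1 rfl
    let ζ : C(unitInterval, ℂ) := (ψ p).comp ⟨fun r => σ * r, by fun_prop⟩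
    have hσ : ‖((σ : ℝ) : ℂ)‖ ≤ 1 := by
      rw [Complex.norm_real, Real.norm_of_nonneg σ.2.1]; exact σ.2.2
    have hp' : ‖((p.1, p.2.1, (σ : ℝ) * p.2.2) : ℂ × ℂ × ℂ)‖ < δ := by
      refine lt_of_le_of_lt ?_ hp.1
      simp only [Prod.norm_def]
      gcongr
      rw [norm_mul]
      exact mul_le_of_le_one_left (norm_nonneg _) hσ
    have hζ : ‖ζ‖ < δ := by
      refine lt_of_le_of_lt ?_ hp.2
      exact (ContinuousMap.norm_le _ (norm_nonneg _)).2 fun r => (ψ p).norm_coe_le_norm _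
    have h2 := (hint ((p.1, p.2.1, (σ : ℝ) * p.2.2), ζ) hp' hζ
      (fun r => Set.IccExtend zero_le_one (ψ p) (σ * r)) (fun r => by
        have : ((σ : ℝ) * r) = ((σ * r : unitInterval) : ℝ) := rfl
        simp only [this, Set.IccExtend_val]
        rfl)).2 (fun ρ => by
        have h3 := h1 (σ * ρ)
        change ψ p (σ * ρ) = _
        rw [h3]
        simp only
        congr 1
        rw [mul_comm ((σ : ℝ) : ℂ) p.2.2, mul_assoc]
        congr 1
        have h5 := intervalIntegral.smul_integral_comp_mul_left (a := 0) (b := (ρ : ℝ))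
          (fun r => B (p.1, Set.IccExtend zero_le_one (ψ p) r, r * p.2.2)) (σ : ℝ)
        rw [mul_zero] at h5
        change _ = ∫ r in (0 : ℝ)..(σ : ℝ) * ρ, _ at h5
        rw [← Complex.real_smul]
        change (∫ r in (0 : ℝ)..(σ : ℝ) * ρ, _) = _
        rw [← h5]
        congr 1
        refine intervalIntegral.integral_congr fun r _ => ?_
        simp only [Complex.ofReal_mul]
        congr 3
        ring)
    have h6 : ψ (p.1, p.2.1, (σ : ℝ) * p.2.2) = ζ := h2
    rw [h6]
    change ψ p (σ * 1) = _
    rw [mul_one]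
  refine ⟨fun p => ψ p 1, ?_, by simp [hψ0], ?_⟩
  · have : ContDiffAt ℂ ω (fun p => ContinuousMap.evalCLM ℂ (1 : unitInterval) (ψ p)) 0 := by
      fun_prop
    exact this.analyticAt
  · filter_upwards [hsmall, hscale] with p hp hs σ hσ
    have h1 := (hint (p, ψ p) hp.1 hp.2 (fun r => ψ (p.1, p.2.1, r * p.2.2) 1)
      (fun r => (hs r).symm)).1 rfl ⟨σ, hσ⟩
    rw [← hs ⟨σ, hσ⟩] at h1
    exact h1
/-- A scalar holomorphic differential equation with a parameter has a solution which depends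
holomorphically on the time, the initial value and the parameter. -/
lemma exists_analyticAt_ode_solution {B : ℂ × ℂ × ℂ → ℂ} (hB : AnalyticAt ℂ B 0) :
    ∃ y : ℂ × ℂ × ℂ → ℂ, AnalyticAt ℂ y 0 ∧ y 0 = 0 ∧
      (∀ᶠ p : ℂ × ℂ × ℂ in 𝓝 0, y (p.1, p.2.1, 0) = p.2.1) ∧
      ∀ᶠ p in 𝓝 0, fderiv ℂ y p (0, 0, 1) = B (p.1, y p, p.2.2) := by
  obtain ⟨y, hy, hy0, hsol⟩ := exists_analyticAt_integral_solution hB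
  refine ⟨y, hy, hy0, hsol.mono fun p hp => by simpa using hp 0 (by simp), ?_⟩
  let b : ℂ × ℂ × ℂ → ℂ := fun q => B (q.1, y q, q.2.2)
  have hb : AnalyticAt ℂ b 0 := by
    have h1 : AnalyticAt ℂ (fun q : ℂ × ℂ × ℂ => (q.1, y q, q.2.2)) 0 :=
      analyticAt_fst.prod (hy.prod (analyticAt_snd.comp analyticAt_snd))
    refine AnalyticAt.comp (f := fun q : ℂ × ℂ × ℂ => (q.1, y q, q.2.2)) ?_ h1
    simp only [hy0]
    exact hB
  obtain ⟨δ, hδ, hball⟩ := Metric.eventually_nhds_iff_ball.1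
    (hsol.and (hy.eventually_analyticAt.and hb.eventually_analyticAt))
  -- For t ≠ 0 the integral equation is differentiated along σ ↦ (x, w, σt) at σ = 1. It is known
  -- only for σ ≤ 1, so one-sided derivatives are compared; the common factor t is then cancelled.
  have hne : ∀ p ∈ Metric.ball (0 : ℂ × ℂ × ℂ) δ, p.2.2 ≠ 0 →
      fderiv ℂ y p (0, 0, 1) = b p := by
    intro p hp ht
    obtain ⟨x, w, t⟩ := p
    let c : ℝ → ℂ × ℂ × ℂ := fun σ => (x, w, (σ : ℂ) * t)
    have hc1 : c 1 = (x, w, t) := by simp [c]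
    have hc : Continuous c := by fun_prop
    have hcball : ∀ σ ∈ Icc (0 : ℝ) 1, c σ ∈ Metric.ball (0 : ℂ × ℂ × ℂ) δ := by
      intro σ hσ
      rw [mem_ball_zero_iff] at hp ⊢
      refine lt_of_le_of_lt ?_ hp
      simp only [c, Prod.norm_def]
      gcongr
      rw [norm_mul, Complex.norm_real, Real.norm_of_nonneg hσ.1]
      exact mul_le_of_le_one_left (norm_nonneg _) hσ.2
    have hs : IsOpen (c ⁻¹' Metric.ball 0 δ) := Metric.isOpen_ball.preimage hc
    have hbc : ContinuousOn (fun σ => b (c σ)) (c ⁻¹' Metric.ball 0 δ) := fun σ hσ =>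
      ((hball _ hσ).2.2.continuousAt.comp hc.continuousAt).continuousWithinAt
    have h1s : (1 : ℝ) ∈ c ⁻¹' Metric.ball 0 δ := hcball 1 (by simp)
    have hR : HasDerivAt (fun σ : ℝ => w + t * ∫ r in (0 : ℝ)..σ, b (c r)) (t * b (c 1)) 1 := by
      refine ((intervalIntegral.integral_hasDerivAt_right ?_
        (hbc.stronglyMeasurableAtFilter hs 1 h1s)
        (hbc.continuousAt (hs.mem_nhds h1s))).const_mul t).const_add w
      refine (hbc.mono fun σ hσ => hcball σ ?_).intervalIntegrable
      rwa [uIcc_of_le zero_le_one] at hσ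
    have hcd : HasDerivAt c (0, 0, t) 1 := by
      have h3 : HasDerivAt (fun σ : ℝ => (σ : ℂ) * t) t 1 := by
        simpa using (Complex.ofRealCLM.hasDerivAt (x := (1 : ℝ))).mul_const t
      exact (hasDerivAt_const _ _).prodMk ((hasDerivAt_const _ _).prodMk h3)
    have hL : HasDerivAt (fun σ : ℝ => y (c σ)) (fderiv ℂ y (c 1) (0, 0, t)) 1 :=
      ((hball _ h1s).2.1.differentiableAt.hasFDerivAt.restrictScalars ℝ).comp_hasDerivAt 1 hcd
    have hu := uniqueDiffOn_Icc_zero_one (1 : ℝ) (by simp)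
    have hR' : HasDerivWithinAt (fun σ : ℝ => y (c σ)) (t * b (c 1)) (Icc 0 1) 1 := by
      refine hR.hasDerivWithinAt.congr (fun σ hσ => ?_) ?_
      · exact (hball _ hp).1 σ hσ
      · exact (hball _ hp).1 1 (by simp)
    have h := hu.eq_deriv _ hL.hasDerivWithinAt hR'
    rw [hc1] at h
    have h4 : ((0, 0, t) : ℂ × ℂ × ℂ) = t • (0, 0, 1) := by simp
    rw [h4, map_smul, smul_eq_mul] at h
    exact mul_left_cancel₀ ht h
  filter_upwards [Metric.ball_mem_nhds (0 : ℂ × ℂ × ℂ) hδ] with p hp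
  by_cases ht : p.2.2 = 0
  -- At t = 0 there is nothing to cancel, but both sides are continuous and agree at nearby times t
  -- ≠ 0.
  · have hA : ContinuousAt (fun q => fderiv ℂ y q (0, 0, 1)) p :=
      ((hball p hp).2.1.fderiv.continuousAt).clm_apply continuousAt_const
    have hBc : ContinuousAt b p := (hball p hp).2.2.continuousAt
    let l : ℂ → ℂ × ℂ × ℂ := fun s => (p.1, p.2.1, s)
    have hl : Continuous l := by fun_prop
    have hl0 : l 0 = p := by rw [← ht]
    have hev : ∀ᶠ s in 𝓝[≠] (0 : ℂ), fderiv ℂ y (l s) (0, 0, 1) = b (l s) := by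
      have h1 : ∀ᶠ s in 𝓝[≠] (0 : ℂ), l s ∈ Metric.ball (0 : ℂ × ℂ × ℂ) δ := by
        refine (hl.continuousAt.eventually_mem ?_).filter_mono nhdsWithin_le_nhds
        rw [hl0]
        exact Metric.isOpen_ball.mem_nhds hp
      filter_upwards [h1, self_mem_nhdsWithin] with s hs hs0
      exact hne _ hs hs0
    have hlt : Tendsto l (𝓝[≠] 0) (𝓝 p) := by
      have := hl.tendsto 0
      rw [hl0] at this
      exact this.mono_left nhdsWithin_le_nhds
    exact tendsto_nhds_unique_of_eventuallyEq (hA.tendsto.comp hlt) (hBc.tendsto.comp hlt) hev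
  · exact hne p hp ht

/-! ### Exterior derivatives under pullback, and local inverses -/

section Pullback

variable {𝕜 V W F : Type*} [RCLike 𝕜] [NormedAddCommGroup V] [NormedSpace 𝕜 V]
  [NormedAddCommGroup W] [NormedSpace 𝕜 W] [NormedAddCommGroup F] [NormedSpace 𝕜 F]

/-- The exterior derivative of a vector-valued one-form commutes with pullback. -/
lemma fderiv_pullback_sub {Φ : V → W} {α : W → W →L[𝕜] F} {x : V}
    (hΦ : ContDiffAt 𝕜 2 Φ x) (hα : DifferentiableAt 𝕜 α (Φ x)) (u v : V) :
    fderiv 𝕜 (fun x => (α (Φ x)).comp (fderiv 𝕜 Φ x)) x u v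
      - fderiv 𝕜 (fun x => (α (Φ x)).comp (fderiv 𝕜 Φ x)) x v u
      = fderiv 𝕜 α (Φ x) (fderiv 𝕜 Φ x u) (fderiv 𝕜 Φ x v)
        - fderiv 𝕜 α (Φ x) (fderiv 𝕜 Φ x v) (fderiv 𝕜 Φ x u) := by
  have h1 : DifferentiableAt 𝕜 Φ x := hΦ.differentiableAt (by simp)
  have h2 : DifferentiableAt 𝕜 (fderiv 𝕜 Φ) x :=
    (hΦ.fderiv_right (m := 1) (by norm_num)).differentiableAt (by simp)
  have h3 := ((hα.hasFDerivAt.comp x h1.hasFDerivAt).clm_comp h2.hasFDerivAt).fderiv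
  have hs : fderiv 𝕜 (fderiv 𝕜 Φ) x u v = fderiv 𝕜 (fderiv 𝕜 Φ) x v u :=
    (hΦ.isSymmSndFDerivAt (by simp)) u v
  simp only [Function.comp_def] at h3
  rw [h3]
  simp [hs]

end Pullback

section Inverse

variable {𝕜 V W : Type*} [RCLike 𝕜] [NormedAddCommGroup V] [NormedSpace 𝕜 V] [CompleteSpace V]
  [NormedAddCommGroup W] [NormedSpace 𝕜 W] [CompleteSpace W]

/-- The inverse function theorem, for a bijective derivative. -/
lemma exists_local_inverse {n : WithTop ℕ∞} (hn : n ≠ 0) {f : V → W} {a : V}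
    (hf : ContDiffAt 𝕜 n f a) (hb : Function.Bijective (fderiv 𝕜 f a)) :
    ∃ g : OpenPartialHomeomorph V W, (g : V → W) = f ∧ a ∈ g.source ∧
      ContDiffAt 𝕜 n g.symm (f a) := by
  let f' : V ≃L[𝕜] W := ContinuousLinearEquiv.ofBijective (fderiv 𝕜 f a)
    (LinearMap.ker_eq_bot.2 hb.1) (LinearMap.range_eq_top.2 hb.2)
  have hf' : HasFDerivAt f (f' : V →L[𝕜] W) a := by
    have h : (f' : V →L[𝕜] W) = fderiv 𝕜 f a := by ext; rfl
    rw [h]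
    exact (hf.differentiableAt hn).hasFDerivAt
  exact ⟨hf.toOpenPartialHomeomorph f hf' hn, rfl,
    hf.mem_toOpenPartialHomeomorph_source hf' hn, hf.to_localInverse hf' hn⟩

end Inverse

/-! ### The holomorphic Darboux theorem in dimension three -/

/-- The value of `α ∧ dα` on three vectors. -/
noncomputable def contactVolume {V : Type*} [NormedAddCommGroup V] [NormedSpace ℂ V]
    (α : V → V →L[ℂ] ℂ) (q u v w : V) : ℂ :=
  α q u * extD α q v w + α q v * extD α q w u + α q w * extD α q u v

/-- `α ∧ dα` vanishes if it vanishes on a spanning triple. -/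
lemma contactVolume_combination {V : Type*} [NormedAddCommGroup V] [NormedSpace ℂ V]
    (α : V → V →L[ℂ] ℂ) (q : V) (e : Fin 3 → V) (a b c : Fin 3 → ℂ) :
    contactVolume α q (∑ i, a i • e i) (∑ i, b i • e i) (∑ i, c i • e i) =
      (a 0 * (b 1 * c 2 - b 2 * c 1) - a 1 * (b 0 * c 2 - b 2 * c 0)
        + a 2 * (b 0 * c 1 - b 1 * c 0)) * contactVolume α q (e 0) (e 1) (e 2) := by
  simp only [contactVolume, extD, Fin.sum_univ_three, map_add, map_smul,
    add_apply, smul_apply, smul_eq_mul]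
  ring

/-- A holomorphic contact form on `ℂ³` pulled back by a holomorphic map. -/
lemma contactVolume_pullback {V W : Type*} [NormedAddCommGroup V] [NormedSpace ℂ V]
    [NormedAddCommGroup W] [NormedSpace ℂ W] {α : W → W →L[ℂ] ℂ} {Ψ : V → W} {p : V}
    (hΨ : ContDiffAt ℂ 2 Ψ p) (hα : DifferentiableAt ℂ α (Ψ p)) (u v w : V) :
    contactVolume (fun x => (α (Ψ x)).comp (fderiv ℂ Ψ x)) p u v w
      = contactVolume α (Ψ p) (fderiv ℂ Ψ p u) (fderiv ℂ Ψ p v) (fderiv ℂ Ψ p w) := by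
  simp only [contactVolume, extD, fderiv_pullback_sub hΨ hα]
  rfl

/-- The pullback of an analytic form is analytic. -/
lemma analyticAt_pullback {V W : Type*} [NormedAddCommGroup V] [NormedSpace ℂ V]
    [CompleteSpace V] [NormedAddCommGroup W] [NormedSpace ℂ W] [CompleteSpace W]
    {α : W → W →L[ℂ] ℂ} {Ψ : V → W}
    {p : V} (hΨ : AnalyticAt ℂ Ψ p) (hα : AnalyticAt ℂ α (Ψ p)) :
    AnalyticAt ℂ (fun x => (α (Ψ x)).comp (fderiv ℂ Ψ x)) p := by
  have h1 : ContDiffAt ℂ ω (fun x => α (Ψ x)) p :=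
    (hα.comp hΨ : AnalyticAt ℂ (α ∘ Ψ) p).contDiffAt
  have h2 : ContDiffAt ℂ ω (fderiv ℂ Ψ) p := hΨ.fderiv.contDiffAt
  exact (h1.clm_comp h2).analyticAt

/-- A holomorphic contact form that kills `∂_t` is a multiple of `dw - v dx` with `∂_t v ≠ 0`. -/
lemma exists_darboux_of_apply_eq_zero {γ : ℂ × ℂ × ℂ → ℂ × ℂ × ℂ →L[ℂ] ℂ}
    (hγ : AnalyticAt ℂ γ 0) (hw : γ 0 (0, 1, 0) ≠ 0) (ht : ∀ᶠ p in 𝓝 0, γ p (0, 0, 1) = 0)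
    (hc : contactVolume γ 0 (1, 0, 0) (0, 1, 0) (0, 0, 1) ≠ 0) :
    ∃ K : ℂ × ℂ × ℂ → ℂ × ℂ × ℂ, AnalyticAt ℂ K 0 ∧ K 0 = 0 ∧
      Function.Bijective (fderiv ℂ K 0) ∧
      ∀ᶠ p in 𝓝 0, ∀ ζ, γ p ζ = 0 ↔ (fderiv ℂ K p ζ).2.2 - (K p).2.1 * (fderiv ℂ K p ζ).1 = 0 := by
  let P : ℂ × ℂ × ℂ → ℂ := fun p => γ p (1, 0, 0)
  let Q : ℂ × ℂ × ℂ → ℂ := fun p => γ p (0, 1, 0)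
  have hev (e) : AnalyticAt ℂ (fun p => γ p e) 0 :=
    (ContDiffAt.clm_apply hγ.contDiffAt contDiffAt_const : ContDiffAt ℂ ω _ _).analyticAt
  have hP : AnalyticAt ℂ P 0 := hev _
  have hQ : AnalyticAt ℂ Q 0 := hev _
  let v : ℂ × ℂ × ℂ → ℂ := fun p => - P p / Q p
  have hv : AnalyticAt ℂ v 0 := hP.neg.div hQ hw
  have hγe (e f) : fderiv ℂ γ 0 e f = fderiv ℂ (fun p => γ p f) 0 e := by
    rw [fderiv_clm_apply hγ.differentiableAt (differentiableAt_const _)]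
    simp
  have hT : fderiv ℂ (fun p => γ p (0, 0, 1)) 0 = 0 := by
    have : (fun p => γ p (0, 0, 1)) =ᶠ[𝓝 0] fun _ => 0 := ht
    rw [this.fderiv_eq]; simp
  -- Here γ = P dx + Q dw = Q (dw − v dx), so γ ∧ dγ is −Q² ∂_t v times dx ∧ dw ∧ dt.
  have hvt : fderiv ℂ v 0 (0, 0, 1) ≠ 0 := by
    intro h0
    apply hc
    have hPv : P =ᶠ[𝓝 0] fun p => - (v p * Q p) := by
      filter_upwards [hQ.continuousAt.eventually_ne hw] with p hp
      simp only [v]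
      field_simp
    have hPt : fderiv ℂ P 0 (0, 0, 1) = - (v 0 * fderiv ℂ Q 0 (0, 0, 1)) := by
      rw [hPv.fderiv_eq, fderiv_fun_neg,
        fderiv_fun_mul hv.differentiableAt hQ.differentiableAt]
      simp [h0]
    have hP0 : γ 0 (1, 0, 0) = - (v 0 * Q 0) := hPv.self_of_nhds
    have e1 : fderiv ℂ γ 0 (0, 0, 1) (1, 0, 0) = - (v 0 * fderiv ℂ Q 0 (0, 0, 1)) := by
      rw [hγe]; exact hPt
    have e2 : fderiv ℂ γ 0 (0, 0, 1) (0, 1, 0) = fderiv ℂ Q 0 (0, 0, 1) := hγe _ _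
    have e3 (e) : fderiv ℂ γ 0 e (0, 0, 1) = 0 := by rw [hγe, hT]; rfl
    simp only [contactVolume, extD, e1, e2, e3, hP0, ht.self_of_nhds]
    change _ + Q 0 * _ + _ = 0
    ring
  -- Shifting v by its value at the origin alone would change dw − v dx. The shear w − v(0) x
  -- compensates for this, so that the form is kept and the origin is fixed.
  let K : ℂ × ℂ × ℂ → ℂ × ℂ × ℂ := fun p => (p.1, v p - v 0, p.2.1 - v 0 * p.1)
  have hK' (p) (hp : DifferentiableAt ℂ v p) (ζ) : fderiv ℂ K p ζ
      = (ζ.1, fderiv ℂ v p ζ, ζ.2.1 - v 0 * ζ.1) := by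
    have h1 : HasFDerivAt (fun p : ℂ × ℂ × ℂ => p.1) (.fst ℂ ℂ (ℂ × ℂ)) p := hasFDerivAt_fst
    have h2 : HasFDerivAt (fun p : ℂ × ℂ × ℂ => p.2.1)
        ((ContinuousLinearMap.fst ℂ ℂ ℂ).comp (.snd ℂ ℂ (ℂ × ℂ))) p :=
      ((ContinuousLinearMap.fst ℂ ℂ ℂ).comp (.snd ℂ ℂ (ℂ × ℂ))).hasFDerivAt
    have h3 : HasFDerivAt K _ p := h1.prodMk ((hp.hasFDerivAt.sub_const (v 0)).prodMk
      (h2.sub (h1.const_mul (v 0))))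
    rw [h3.fderiv]
    simp
  refine ⟨K, ?_, by simp [K], ?_, ?_⟩
  · have hx : AnalyticAt ℂ (fun p : ℂ × ℂ × ℂ => p.1) 0 := analyticAt_fst
    have hw' : AnalyticAt ℂ (fun p : ℂ × ℂ × ℂ => p.2.1) 0 := analyticAt_fst.comp analyticAt_snd
    exact hx.prod ((hv.sub analyticAt_const).prod (hw'.sub (analyticAt_const.mul hx)))
  · have hinj : Function.Injective (fderiv ℂ K 0 : ℂ × ℂ × ℂ →ₗ[ℂ] ℂ × ℂ × ℂ) := by
      rw [← LinearMap.ker_eq_bot, LinearMap.ker_eq_bot']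
      intro ζ hζ
      rw [ContinuousLinearMap.coe_coe, hK' 0 hv.differentiableAt] at hζ
      obtain ⟨x, w, t⟩ := ζ
      simp only [Prod.mk_eq_zero] at hζ
      obtain ⟨h1, h2, h3⟩ := hζ
      subst h1
      have hw0 : w = 0 := by simpa using h3
      subst hw0
      have h4 : ((0, 0, t) : ℂ × ℂ × ℂ) = t • (0, 0, 1) := by simp
      rw [h4, map_smul, smul_eq_mul] at h2
      have := (mul_eq_zero.1 h2).resolve_right hvt
      simp [this]
    exact ⟨hinj, LinearMap.surjective_of_injective hinj⟩
  · filter_upwards [ht, hQ.continuousAt.eventually_ne hw, hv.eventually_analyticAt]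
      with p htp hQp hvp ζ
    rw [hK' p hvp.differentiableAt]
    have hζ : ζ = ζ.1 • (1, 0, 0) + ζ.2.1 • (0, 1, 0) + ζ.2.2 • (0, 0, 1) := by
      ext <;> simp
    have h1 : γ p ζ = ζ.1 * P p + ζ.2.1 * Q p := by
      conv_lhs => rw [hζ]
      simp only [map_add, map_smul, htp, smul_eq_mul, P, Q]
      ring
    have h2 : P p = - (v p * Q p) := by simp only [v]; field_simp
    simp only [K]
    rw [h1, h2, show ζ.1 * -(v p * Q p) + ζ.2.1 * Q p
      = (ζ.2.1 - v 0 * ζ.1 - (v p - v 0) * ζ.1) * Q p by ring]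
    simp [hQp]

lemma triple_eq_sum (ζ : ℂ × ℂ × ℂ) : ζ = ∑ i, (![ζ.1, ζ.2.1, ζ.2.2] : Fin 3 → ℂ) i •
    (![(1, 0, 0), (0, 1, 0), (0, 0, 1)] : Fin 3 → ℂ × ℂ × ℂ) i := by
  simp [Fin.sum_univ_three]

/-- If `α ∧ dα` is nonzero, then it is nonzero on the standard basis. -/
lemma contactVolume_basis_ne_zero {γ : ℂ × ℂ × ℂ → ℂ × ℂ × ℂ →L[ℂ] ℂ} {p u v w : ℂ × ℂ × ℂ}
    (h : contactVolume γ p u v w ≠ 0) :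
    contactVolume γ p (1, 0, 0) (0, 1, 0) (0, 0, 1) ≠ 0 := by
  intro h0
  rw [triple_eq_sum u, triple_eq_sum v, triple_eq_sum w, contactVolume_combination] at h
  exact h (by simp [h0])

/-- The derivative of a function of several variables with values in `ℂ × ℂ × ℂ`. -/
lemma bijective_of_injective {f : ℂ × ℂ × ℂ →L[ℂ] ℂ × ℂ × ℂ} (h : ∀ ζ, f ζ = 0 → ζ = 0) :
    Function.Bijective f := by
  have hinj : Function.Injective (f : ℂ × ℂ × ℂ →ₗ[ℂ] ℂ × ℂ × ℂ) := by
    rw [← LinearMap.ker_eq_bot, LinearMap.ker_eq_bot']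
    exact h
  exact ⟨hinj, LinearMap.surjective_of_injective hinj⟩

/-- Darboux coordinates of a holomorphic contact form at the origin, up to a factor. -/
lemma exists_darboux_triple {β : ℂ × ℂ × ℂ → ℂ × ℂ × ℂ →L[ℂ] ℂ}
    (hβ : AnalyticAt ℂ β 0) (hy : β 0 (0, 1, 0) ≠ 0)
    (hc : ∃ u v w, contactVolume β 0 u v w ≠ 0) :
    ∃ Θ : ℂ × ℂ × ℂ → ℂ × ℂ × ℂ, AnalyticAt ℂ Θ 0 ∧ Θ 0 = 0 ∧
      Function.Bijective (fderiv ℂ Θ 0) ∧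
      ∀ᶠ p in 𝓝 0, ∀ ζ, β p ζ = 0 ↔ (fderiv ℂ Θ p ζ).2.2 - (Θ p).2.1 * (fderiv ℂ Θ p ζ).1 = 0 := by
  have hev (e) : AnalyticAt ℂ (fun p => β p e) 0 :=
    (ContDiffAt.clm_apply hβ.contDiffAt contDiffAt_const : ContDiffAt ℂ ω _ _).analyticAt
  -- The curves t ↦ (x, y, t) with x fixed and ∂_t y = −β(∂_t)/β(∂_y) are tangent to the kernel of
  -- β. With x, the initial value w and t as coordinates, the pullback of β therefore kills ∂_t.
  obtain ⟨y, hya, hy0, hyw, hyt⟩ := exists_analyticAt_ode_solution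
    ((hev (0, 0, 1)).neg.div (hev (0, 1, 0)) hy)
  let Ψ : ℂ × ℂ × ℂ → ℂ × ℂ × ℂ := fun p => (p.1, y p, p.2.2)
  have hΨ : AnalyticAt ℂ Ψ 0 :=
    analyticAt_fst.prod (hya.prod (analyticAt_snd.comp analyticAt_snd))
  have hΨ0 : Ψ 0 = 0 := by simp [Ψ, hy0]
  have hΨ' (p) (hp : DifferentiableAt ℂ y p) (ζ) : fderiv ℂ Ψ p ζ
      = (ζ.1, fderiv ℂ y p ζ, ζ.2.2) := by
    have h1 : HasFDerivAt (fun p : ℂ × ℂ × ℂ => p.1) (.fst ℂ ℂ (ℂ × ℂ)) p := hasFDerivAt_fst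
    have h2 : HasFDerivAt (fun p : ℂ × ℂ × ℂ => p.2.2)
        ((ContinuousLinearMap.snd ℂ ℂ ℂ).comp (.snd ℂ ℂ (ℂ × ℂ))) p :=
      ((ContinuousLinearMap.snd ℂ ℂ ℂ).comp (.snd ℂ ℂ (ℂ × ℂ))).hasFDerivAt
    have h3 : HasFDerivAt Ψ _ p := h1.prodMk (hp.hasFDerivAt.prodMk h2)
    rw [h3.fderiv]
    simp
  have hyw' : fderiv ℂ y 0 (0, 1, 0) = 1 := by
    let l : ℂ →L[ℂ] ℂ × ℂ × ℂ := (ContinuousLinearMap.inr ℂ ℂ (ℂ × ℂ)).comp (.inl ℂ ℂ ℂ)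
    have h1 : HasFDerivAt y (fderiv ℂ y 0) (l 0) := by
      rw [map_zero]; exact hya.differentiableAt.hasFDerivAt
    have h2 := h1.comp (0 : ℂ) l.hasFDerivAt
    have h3 : y ∘ l =ᶠ[𝓝 0] id := by
      have hl : Tendsto l (𝓝 0) (𝓝 0) := by simpa using l.continuous.tendsto 0
      filter_upwards [hl.eventually hyw] with s hs
      simpa [l] using hs
    have h4 := h2.fderiv
    rw [h3.fderiv_eq, fderiv_id] at h4
    have h5 := congrArg (fun f : ℂ →L[ℂ] ℂ => f 1) h4
    simpa [l] using h5.symm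
  have hΨb : Function.Bijective (fderiv ℂ Ψ 0) := by
    refine bijective_of_injective fun ζ hζ => ?_
    rw [hΨ' 0 hya.differentiableAt] at hζ
    obtain ⟨x, w, t⟩ := ζ
    simp only [Prod.mk_eq_zero] at hζ
    obtain ⟨h1, h2, h3⟩ := hζ
    subst h1 h3
    have h4 : ((0, w, 0) : ℂ × ℂ × ℂ) = w • (0, 1, 0) := by simp
    rw [h4, map_smul, hyw', smul_eq_mul, mul_one] at h2
    simp [h2]
  have hβΨ : AnalyticAt ℂ β (Ψ 0) := by rwa [hΨ0]
  let γ : ℂ × ℂ × ℂ → ℂ × ℂ × ℂ →L[ℂ] ℂ := fun p => (β (Ψ p)).comp (fderiv ℂ Ψ p)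
  have hγ : AnalyticAt ℂ γ 0 := analyticAt_pullback hΨ hβΨ
  obtain ⟨K, hK, hK0, hKb, hKγ⟩ := exists_darboux_of_apply_eq_zero (γ := γ) hγ
    (by
      simp only [γ, ContinuousLinearMap.comp_apply]
      rw [hΨ' 0 hya.differentiableAt, hyw', hΨ0]
      exact hy)
    (by
      have h1 : ∀ᶠ p in 𝓝 0, β (Ψ p) (0, 1, 0) ≠ 0 := by
        have : ContinuousAt (fun p => β (Ψ p) (0, 1, 0)) 0 :=
          (hβΨ.continuousAt.comp hΨ.continuousAt).clm_apply continuousAt_const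
        exact this.eventually_ne (by rwa [hΨ0])
      filter_upwards [hyt, h1, hya.eventually_analyticAt] with p hp hp1 hpa
      simp only [γ, ContinuousLinearMap.comp_apply]
      rw [hΨ' p hpa.differentiableAt, hp]
      have h2 (s : ℂ) : ((0, s, 1) : ℂ × ℂ × ℂ) = s • (0, 1, 0) + (0, 0, 1) := by simp
      rw [h2, map_add, map_smul, smul_eq_mul]
      simp only [Pi.div_apply, Pi.neg_apply]
      change -(β (Ψ p) (0, 0, 1)) / β (Ψ p) (0, 1, 0) * _ + _ = 0
      field_simp
      simp)
    (by
      obtain ⟨u, v, w, h⟩ := hc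
      obtain ⟨u, rfl⟩ := hΨb.2 u
      obtain ⟨v, rfl⟩ := hΨb.2 v
      obtain ⟨w, rfl⟩ := hΨb.2 w
      refine contactVolume_basis_ne_zero (u := u) (v := v) (w := w) ?_
      rw [contactVolume_pullback hΨ.contDiffAt hβΨ.differentiableAt]
      rwa [hΨ0])
  obtain ⟨g, hgΨ, hg0, hg⟩ := exists_local_inverse (n := ω) (by simp) hΨ.contDiffAt hΨb
  rw [hΨ0] at hg
  have hgs : g.symm 0 = 0 := by
    have := g.left_inv hg0
    rwa [hgΨ, hΨ0] at this
  have h0t : (0 : ℂ × ℂ × ℂ) ∈ g.target := by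
    have := g.map_source hg0
    rwa [hgΨ, hΨ0] at this
  have hgt : Tendsto g.symm (𝓝 0) (𝓝 0) := by
    have := hg.continuousAt.tendsto
    rwa [hgs] at this
  have hKg : AnalyticAt ℂ K (g.symm 0) := by rwa [hgs]
  have hid : ∀ᶠ p in 𝓝 0, Ψ (g.symm p) = p := by
    filter_upwards [g.open_target.mem_nhds h0t] with p hp
    rw [← hgΨ]
    exact g.right_inv hp
  have hderiv : ∀ᶠ p in 𝓝 0, ∀ ζ, fderiv ℂ Ψ (g.symm p) (fderiv ℂ g.symm p ζ) = ζ := by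
    filter_upwards [hid.eventually_nhds, hg.analyticAt.eventually_analyticAt,
      hgt.eventually hΨ.eventually_analyticAt] with p hp hgp hΨp ζ
    have h1 := hΨp.differentiableAt.hasFDerivAt.comp p hgp.differentiableAt.hasFDerivAt
    have h2 : Ψ ∘ g.symm =ᶠ[𝓝 p] id := hp
    have h3 := h1.fderiv
    rw [h2.fderiv_eq, fderiv_id] at h3
    exact (DFunLike.congr_fun h3 ζ).symm
  refine ⟨K ∘ g.symm, hKg.comp hg.analyticAt, by simp [hgs, hK0], ?_, ?_⟩
  · rw [fderiv_comp _ hKg.differentiableAt hg.analyticAt.differentiableAt]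
    refine bijective_of_injective fun ζ hζ => ?_
    rw [hgs] at hζ
    have h1 : fderiv ℂ g.symm 0 ζ = 0 := hKb.1 (hζ.trans (map_zero _).symm)
    have h2 := hderiv.self_of_nhds ζ
    rw [h1, map_zero] at h2
    exact h2.symm
  · filter_upwards [hid, hderiv, hgt.eventually hKγ, hgt.eventually hK.eventually_analyticAt,
      hg.analyticAt.eventually_analyticAt] with p h1 h2 h3 h4 h5 ζ
    rw [fderiv_comp _ h4.differentiableAt h5.differentiableAt]
    have h6 := h3 (fderiv ℂ g.symm p ζ)
    simp only [γ, ContinuousLinearMap.comp_apply, h2, h1] at h6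
    exact h6

/-- Darboux coordinates for holomorphic contact forms on `ℂ³`, up to a factor. -/
lemma exists_darboux {α : C3 → C3 →L[ℂ] ℂ} {q : C3} (hα : IsHolomorphicContactForm α q) :
    ∃ Θ : C3 → ℂ × ℂ × ℂ, AnalyticAt ℂ Θ q ∧ Θ q = 0 ∧
      Function.Bijective (fderiv ℂ Θ q) ∧
      ∀ᶠ p in 𝓝 q, ∀ ζ, α p ζ = 0 ↔
        (fderiv ℂ Θ p ζ).2.2 - (Θ p).2.1 * (fderiv ℂ Θ p ζ).1 = 0 := by
  obtain ⟨hαa, u, v, w, hc⟩ := hα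
  have hb : ∃ b, α q b ≠ 0 := by
    by_contra! h
    simp [h] at hc
  obtain ⟨b, hb⟩ := hb
  -- Linear coordinates are chosen so that the second basis vector lies outside the kernel of `α q`;
  -- `exists_darboux_triple` divides by that coefficient.
  obtain ⟨A, hA⟩ : ∃ A : (ℂ × ℂ × ℂ) ≃L[ℂ] C3, α q (A (0, 1, 0)) ≠ 0 := by
    have hfr : Module.finrank ℂ (ℂ × ℂ × ℂ) = Module.finrank ℂ C3 := by simp
    let A₀ : (ℂ × ℂ × ℂ) ≃L[ℂ] C3 := ContinuousLinearEquiv.ofFinrankEq hfr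
    obtain ⟨f, hf⟩ : ∃ f : (ℂ × ℂ × ℂ) ≃L[ℂ] ℂ × ℂ × ℂ, f (0, 1, 0) = A₀.symm b := by
      refine SeparatingDual.exists_continuousLinearEquiv_apply_eq (by simp) ?_
      intro h
      apply hb
      rw [show b = 0 by simpa using h, map_zero]
    exact ⟨f.trans A₀, by simpa [hf] using hb⟩
  let τ : ℂ × ℂ × ℂ → C3 := fun p => q + A p
  have hτ : ∀ p, HasFDerivAt τ (A : ℂ × ℂ × ℂ →L[ℂ] C3) p := fun p =>
    A.hasFDerivAt.const_add q
  have hτ' (p) : fderiv ℂ τ p = A := (hτ p).fderiv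
  have hτ0 : τ 0 = q := by simp [τ]
  have hτa : AnalyticAt ℂ τ 0 := by
    have : ContDiff ℂ ω τ := contDiff_const.add A.contDiff
    exact this.contDiffAt.analyticAt
  have hατ : AnalyticAt ℂ α (τ 0) := by rwa [hτ0]
  let σ : C3 → ℂ × ℂ × ℂ := fun z => A.symm (z - q)
  have hσ : ∀ z, HasFDerivAt σ (A.symm : C3 →L[ℂ] ℂ × ℂ × ℂ) z := fun z => by
    have h : HasFDerivAt σ ((A.symm : C3 →L[ℂ] ℂ × ℂ × ℂ).comp (.id ℂ C3)) z :=
      A.symm.hasFDerivAt.comp z ((hasFDerivAt_id z).sub_const q)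
    rwa [ContinuousLinearMap.comp_id] at h
  have hσ' (z) : fderiv ℂ σ z = A.symm := (hσ z).fderiv
  have hσq : σ q = 0 := by simp [σ]
  have hσa : AnalyticAt ℂ σ q := by
    have : ContDiff ℂ ω σ := A.symm.contDiff.comp (contDiff_id.sub contDiff_const)
    exact this.contDiffAt.analyticAt
  have hτσ (z) : τ (σ z) = z := by simp [τ, σ]
  obtain ⟨Θ, hΘ, hΘ0, hΘb, hΘβ⟩ := exists_darboux_triple
    (β := fun p => (α (τ p)).comp (fderiv ℂ τ p)) (analyticAt_pullback hτa hατ)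
    (by simpa [hτ', hτ0] using hA)
    ⟨A.symm u, A.symm v, A.symm w, by
      rw [contactVolume_pullback hτa.contDiffAt hατ.differentiableAt]
      simpa [hτ', hτ0, contactVolume] using hc⟩
  have hΘσ : AnalyticAt ℂ Θ (σ q) := by rwa [hσq]
  have hσt : Tendsto σ (𝓝 q) (𝓝 0) := by
    have := hσa.continuousAt.tendsto
    rwa [hσq] at this
  refine ⟨Θ ∘ σ, hΘσ.comp hσa, by simp [hσq, hΘ0], ?_, ?_⟩
  · rw [fderiv_comp _ hΘσ.differentiableAt hσa.differentiableAt, hσ', hσq]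
    exact hΘb.comp A.symm.bijective
  · filter_upwards [hσt.eventually hΘβ, hσt.eventually hΘ.eventually_analyticAt] with z h1 h2 ζ
    rw [fderiv_comp _ h2.differentiableAt (hσ z).differentiableAt, hσ']
    have h3 := h1 (A.symm ζ)
    simpa [hτ', hτσ] using h3

/-! ### Smooth germs of maps and local diffeomorphisms -/

section LocalDiffeo

variable {U V W : Type*} [NormedAddCommGroup U] [NormedSpace ℝ U] [NormedAddCommGroup V]
  [NormedSpace ℝ V] [NormedAddCommGroup W] [NormedSpace ℝ W]

lemma SmoothNear.contDiffAt {f : V → W} {p : V} (h : SmoothNear f p) : ContDiffAt ℝ ∞ f p :=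
  h.self_of_nhds

lemma SmoothNear.comp {g : V → W} {f : U → V} {p : U} (hg : SmoothNear g (f p))
    (hf : SmoothNear f p) : SmoothNear (g ∘ f) p := by
  filter_upwards [hf, hf.contDiffAt.continuousAt.eventually hg] with x hx hgx
  exact hgx.comp x hx

lemma SmoothNear.congr {f g : V → W} {p : V} (hf : SmoothNear f p) (h : g =ᶠ[𝓝 p] f) :
    SmoothNear g p := by
  filter_upwards [hf, h.eventually_nhds] with x hx hgx
  exact hx.congr_of_eventuallyEq hgx

lemma SmoothNear.eventually_smoothNear {f : V → W} {p : V} (h : SmoothNear f p) :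
    ∀ᶠ x in 𝓝 p, SmoothNear f x :=
  h.eventually_nhds

lemma SmoothNear.fderiv {f : V → W} {p : V} (h : SmoothNear f p) :
    SmoothNear (fderiv ℝ f) p :=
  h.mono fun _ hx => hx.fderiv_right (m := ∞) (by simp)

lemma SmoothNear.of_contDiff {f : V → W} (h : ContDiff ℝ ∞ f) (p : V) : SmoothNear f p :=
  .of_forall fun _ => h.contDiffAt

lemma IsLocalDiffeoNear.comp {Ψ : V → W} {Φ : U → V} {p : U} (hΨ : IsLocalDiffeoNear Ψ (Φ p))
    (hΦ : IsLocalDiffeoNear Φ p) : IsLocalDiffeoNear (Ψ ∘ Φ) p := by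
  refine ⟨hΨ.1.comp hΦ.1, ?_⟩
  rw [fderiv_comp _ (hΨ.1.contDiffAt.differentiableAt (by simp))
    (hΦ.1.contDiffAt.differentiableAt (by simp))]
  exact hΨ.2.comp hΦ.2

lemma IsLocalDiffeoNear.fderiv_comp_eventually {Ψ : V → W} {Φ : U → V} {p : U}
    (hΨ : SmoothNear Ψ (Φ p)) (hΦ : SmoothNear Φ p) :
    ∀ᶠ x in 𝓝 p, fderiv ℝ (Ψ ∘ Φ) x = (fderiv ℝ Ψ (Φ x)).comp (fderiv ℝ Φ x) := by
  filter_upwards [hΦ, hΦ.contDiffAt.continuousAt.eventually hΨ] with x h1 h2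
  exact fderiv_comp _ (h2.differentiableAt (by simp)) (h1.differentiableAt (by simp))

lemma IsLocalDiffeoNear.eventually_bijective [CompleteSpace V] [CompleteSpace W] {Φ : V → W}
    {p : V} (h : IsLocalDiffeoNear Φ p) :
    ∀ᶠ x in 𝓝 p, Function.Bijective (fderiv ℝ Φ x) := by
  let f' : V ≃L[ℝ] W := ContinuousLinearEquiv.ofBijective (fderiv ℝ Φ p)
    (LinearMap.ker_eq_bot.2 h.2.1) (LinearMap.range_eq_top.2 h.2.2)
  have hf' : (f' : V →L[ℝ] W) = fderiv ℝ Φ p := by ext; rfl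
  have h1 := f'.nhds
  rw [hf'] at h1
  filter_upwards [h.1.fderiv.contDiffAt.continuousAt.eventually_mem h1] with x ⟨e, he⟩
  rw [← he]
  exact e.bijective

end LocalDiffeo

/-! ### Complex-contact germs and diffeomorphisms -/

/-- Near `p`, the field of subspaces `D` is the pullback of `D'` by `Φ`. -/
def IsPullbackNear (Φ : E6 → E6) (D D' : E6 → Submodule ℝ E6) (p : E6) : Prop :=
  ∀ᶠ x in 𝓝 p, ∀ v, v ∈ D x ↔ fderiv ℝ Φ x v ∈ D' (Φ x)

lemma IsPullbackNear.of_map {Φ : E6 → E6} {D D' : E6 → Submodule ℝ E6} {p : E6}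
    (hΦ : IsLocalDiffeoNear Φ p)
    (h : ∀ᶠ x in 𝓝 p, D' (Φ x) = (D x).map (fderiv ℝ Φ x : E6 →ₗ[ℝ] E6)) :
    IsPullbackNear Φ D D' p := by
  filter_upwards [h, hΦ.eventually_bijective] with x hx hb v
  rw [hx, Submodule.mem_map]
  constructor
  · exact fun hv => ⟨v, hv, rfl⟩
  · rintro ⟨w, hw, hwv⟩
    rwa [← hb.1 hwv]

lemma SupportsComplexContact.pullback {Φ : E6 → E6} {D D' : E6 → Submodule ℝ E6} {p : E6}
    (hD' : SupportsComplexContact D' (Φ p)) (hΦ : IsLocalDiffeoNear Φ p)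
    (h : IsPullbackNear Φ D D' p) : SupportsComplexContact D p := by
  obtain ⟨Ψ, hΨ, α, hα, hD⟩ := hD'
  refine ⟨Ψ ∘ Φ, hΨ.comp hΦ, α, hα, ?_⟩
  filter_upwards [h, hΦ.1.contDiffAt.continuousAt.eventually hD,
    IsLocalDiffeoNear.fderiv_comp_eventually hΨ.1 hΦ.1] with x h1 h2 h3 v
  rw [h1, h2, h3]
  rfl

lemma SupportsComplexContact.congr {D D' : E6 → Submodule ℝ E6} {p : E6}
    (hD : SupportsComplexContact D p) (h : ∀ᶠ x in 𝓝 p, D' x = D x) :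
    SupportsComplexContact D' p := by
  obtain ⟨Ψ, hΨ, α, hα, hD⟩ := hD
  refine ⟨Ψ, hΨ, α, hα, ?_⟩
  filter_upwards [hD, h] with x h1 h2 v
  rw [h2, h1]

/-! ### Complex coordinates on six-space -/

/-- The complex coordinate `x_i + √-1 x_j`. -/
noncomputable def cc (i j : Fin 6) : E6 →L[ℝ] ℂ :=
  Complex.ofRealCLM.comp (dcoord i) + Complex.I • Complex.ofRealCLM.comp (dcoord j)

lemma cc_apply (i j : Fin 6) (v : E6) : cc i j v = v i + Complex.I * v j := by
  simp [cc, dcoord]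

/-- Identification of `ℝ⁶` with `ℂ³`. -/
noncomputable def toTriple : E6 ≃L[ℝ] ℂ × ℂ × ℂ :=
  LinearEquiv.toContinuousLinearEquiv
    { toFun := fun v => (cc 0 1 v, cc 2 3 v, cc 4 5 v)
      map_add' := by intros; simp
      map_smul' := by intros; simp
      invFun := fun ζ => !₂[ζ.1.re, ζ.1.im, ζ.2.1.re, ζ.2.1.im, ζ.2.2.re, ζ.2.2.im]
      left_inv := by
        intro v
        ext i
        fin_cases i <;> simp [cc_apply]
      right_inv := by
        intro ζ
        simp [cc_apply, mul_comm Complex.I, Complex.re_add_im] }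

lemma toTriple_apply (v : E6) : toTriple v = (cc 0 1 v, cc 2 3 v, cc 4 5 v) := rfl

/-- The standard complex contact form `dw - v du` on `ℝ⁶`. -/
noncomputable def stdForm (y : E6) : E6 →L[ℝ] ℂ := cc 4 5 - cc 2 3 y • cc 0 1

/-- Darboux coordinates for complex-contact germs. -/
lemma SupportsComplexContact.exists_darboux {D : E6 → Submodule ℝ E6} {p : E6}
    (hD : SupportsComplexContact D p) :
    ∃ Ψ : E6 → E6, IsLocalDiffeoNear Ψ p ∧ Ψ p = 0 ∧
      ∀ᶠ x in 𝓝 p, ∀ v, v ∈ D x ↔ stdForm (Ψ x) (fderiv ℝ Ψ x v) = 0 := by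
  obtain ⟨Φ, hΦ, α, hα, hD⟩ := hD
  obtain ⟨Θ, hΘ, hΘ0, hΘb, hΘα⟩ := FatReeb.exists_darboux hα
  have hΘd {z : C3} (hz : AnalyticAt ℂ Θ z) :
      fderiv ℝ Θ z = (fderiv ℂ Θ z).restrictScalars ℝ :=
    (hz.differentiableAt.hasFDerivAt.restrictScalars ℝ).fderiv
  have hΘl : IsLocalDiffeoNear Θ (Φ p) := by
    refine ⟨?_, ?_⟩
    · filter_upwards [hΘ.eventually_analyticAt] with z hz
      exact (hz.contDiffAt (n := ∞)).restrict_scalars ℝ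
    · rw [hΘd hΘ]; exact hΘb
  have hT (z) : fderiv ℝ toTriple.symm z = toTriple.symm := toTriple.symm.hasFDerivAt.fderiv
  have hTl (z) : IsLocalDiffeoNear toTriple.symm z := by
    refine ⟨.of_contDiff toTriple.symm.contDiff z, ?_⟩
    rw [hT]
    exact toTriple.symm.bijective
  have hcomp := hΘl.comp hΦ
  refine ⟨toTriple.symm ∘ (Θ ∘ Φ), (hTl _).comp hcomp, by simp [hΘ0], ?_⟩
  filter_upwards [hD, hΦ.1.contDiffAt.continuousAt.eventually hΘα,
    IsLocalDiffeoNear.fderiv_comp_eventually (hTl _).1 hcomp.1,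
    IsLocalDiffeoNear.fderiv_comp_eventually hΘl.1 hΦ.1,
    hΦ.1.contDiffAt.continuousAt.eventually hΘ.eventually_analyticAt] with x h1 h2 h3 h4 h5 v
  rw [h1, h2, h3, h4, hT, hΘd h5]
  have key (a b : ℂ × ℂ × ℂ) :
      stdForm (toTriple.symm a) (toTriple.symm b) = b.2.2 - a.2.1 * b.1 := by
    have ha := toTriple.apply_symm_apply a
    have hb := toTriple.apply_symm_apply b
    rw [toTriple_apply] at ha hb
    have e1 := congrArg (fun t => t.2.1) ha
    have e2 := congrArg (fun t => t.1) hb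
    have e3 := congrArg (fun t => t.2.2) hb
    simp only at e1 e2 e3
    simp [stdForm, e1, e2, e3]
  simp only [Function.comp_apply, ContinuousLinearMap.comp_apply,
    ContinuousLinearEquiv.coe_coe, key]
  rfl

/-! ### The pointwise structure of a complex contact form -/

/-- The antisymmetrization of a complex bilinear form on `ℂ³`. -/
noncomputable def altForm (b : Fin 3 → Fin 3 → ℂ) (ξ η : Fin 3 → ℂ) : ℂ :=
  ∑ j, ∑ l, b j l * (ξ l * η j - η l * ξ j)

/-- The value `θ` of a complex contact form and the value `δ` of its exterior derivative, pulled
back to `ℝ⁶` by a linear isomorphism `ℝ⁶ → ℂ³`. -/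
def IsContactJet (θ : E6 →L[ℝ] ℂ) (δ : E6 → E6 → ℂ) : Prop :=
  ∃ (L : E6 →ₗ[ℝ] Fin 3 → ℂ) (a : Fin 3 → ℂ) (b : Fin 3 → Fin 3 → ℂ),
    Function.Surjective L ∧ a ≠ 0 ∧ (∀ v, θ v = ∑ j, a j * L v j) ∧
    (∀ u v, δ u v = altForm b (L u) (L v)) ∧
    ∀ ξ, ∑ j, a j * ξ j = 0 → (∀ η, ∑ j, a j * η j = 0 → altForm b ξ η = 0) → ξ = 0

/-- The Pfaffian of an antisymmetric `4 × 4` matrix. -/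
noncomputable def pf (c : Fin 4 → Fin 4 → ℂ) : ℂ :=
  c 0 1 * c 2 3 - c 0 2 * c 1 3 + c 0 3 * c 1 2

/-- Conjugating the complex structure of ℂ³ conjugates the contact form without changing its kernel.
This symmetry exchanges the coefficients of dz and dz̄ and so allows the normalization |μ| ≤ 1. -/
lemma IsContactJet.conj {θ : E6 →L[ℝ] ℂ} {δ : E6 → E6 → ℂ} (h : IsContactJet θ δ) :
    IsContactJet ((Complex.conjCLE : ℂ →L[ℝ] ℂ).comp θ)
      (fun u v => (starRingEnd ℂ) (δ u v)) := by
  obtain ⟨L, a, b, hL, ha, hθ, hδ, hnd⟩ := h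
  let S : (Fin 3 → ℂ) →ₗ[ℝ] Fin 3 → ℂ :=
    { toFun := fun ξ j => (starRingEnd ℂ) (ξ j)
      map_add' := by intros; ext; simp
      map_smul' := by intros; ext; simp }
  have hS (ξ j) : S ξ j = (starRingEnd ℂ) (ξ j) := rfl
  have hSS (ξ) : S (S ξ) = ξ := by ext j; simp [hS]
  have hform (ξ η) : altForm (fun j l => (starRingEnd ℂ) (b j l)) ξ η
      = (starRingEnd ℂ) (altForm b (S ξ) (S η)) := by
    simp [altForm, hS]
  have hsum (ξ : Fin 3 → ℂ) : ∑ j, S a j * ξ j = (starRingEnd ℂ) (∑ j, a j * S ξ j) := by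
    simp [hS]
  refine ⟨S.comp L, S a, fun j l => (starRingEnd ℂ) (b j l), ?_, ?_, ?_, ?_, ?_⟩
  · intro ξ
    obtain ⟨v, hv⟩ := hL (S ξ)
    exact ⟨v, by rw [LinearMap.comp_apply, hv, hSS]⟩
  · intro h0
    apply ha
    rw [← hSS a, h0, map_zero]
  · intro v
    rw [hsum, LinearMap.comp_apply, hSS, ← hθ]
    rfl
  · intro u v
    beta_reduce
    rw [hform, LinearMap.comp_apply, LinearMap.comp_apply, hSS, hSS, hδ]
  · intro ξ hξ hη
    rw [hsum, map_eq_zero] at hξ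
    have h1 : S ξ = 0 := by
      refine hnd _ hξ fun η hη' => ?_
      have h2 := hη (S η) (by rw [hsum, hSS, hη', map_zero])
      rwa [hform, hSS, map_eq_zero] at h2
    rw [← hSS ξ, h1, map_zero]

/-- The relation eliminates r, so that `c` becomes a multiple of the decomposable form s ∧ t, whose
square is zero. -/
lemma pf_eq_zero_of_relation {a₀ a₁ a₂ β₁ β₂ β₃ : ℂ} (r s t : Fin 4 → ℂ) (ha : a₀ ≠ 0)
    (h : ∀ i, a₀ * r i + a₁ * s i + a₂ * t i = 0) (c : Fin 4 → Fin 4 → ℂ)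
    (hc : ∀ i j, c i j = β₁ * (r i * s j - s i * r j) + β₂ * (r i * t j - t i * r j)
      + β₃ * (s i * t j - t i * s j)) : pf c = 0 := by
  have h1 (i j) : c i j = (β₁ * a₂ - β₂ * a₁ + β₃ * a₀) / a₀ * (s i * t j - t i * s j) := by
    rw [hc]
    field_simp
    linear_combination (β₁ * s j + β₂ * t j) * h i - (β₁ * s i + β₂ * t i) * h j
  simp only [pf, h1]
  ring

/-- On the two-dimensional kernel of a complex contact form, Pfaffians vanish. -/
lemma IsContactJet.pf_eq_zero {θ : E6 →L[ℝ] ℂ} {δ : E6 → E6 → ℂ} (h : IsContactJet θ δ)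
    {X : Fin 4 → E6} (hX : ∀ i, θ (X i) = 0) : pf (fun i j => δ (X i) (X j)) = 0 := by
  obtain ⟨L, a, b, hL, ha, hθ, hδ, hnd⟩ := h
  have h0 (i) : a 0 * L (X i) 0 + a 1 * L (X i) 1 + a 2 * L (X i) 2 = 0 := by
    rw [← hX i, hθ, Fin.sum_univ_three]
  have hδ' (i j) : δ (X i) (X j) = altForm b (L (X i)) (L (X j)) := hδ _ _
  simp only [altForm, Fin.sum_univ_three] at hδ'
  -- The three cases permute the coordinates so that a nonzero coefficient of the form comes first.
  obtain ⟨m, hm⟩ := Function.ne_iff.1 ha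
  fin_cases m
  · refine pf_eq_zero_of_relation (a₀ := a 0) (a₁ := a 1) (a₂ := a 2) (β₁ := b 1 0 - b 0 1)
      (β₂ := b 2 0 - b 0 2) (β₃ := b 2 1 - b 1 2) (fun i => L (X i) 0) (fun i => L (X i) 1)
      (fun i => L (X i) 2) hm h0 _ fun i j => ?_
    rw [hδ']
    ring
  · refine pf_eq_zero_of_relation (a₀ := a 1) (a₁ := a 0) (a₂ := a 2) (β₁ := b 0 1 - b 1 0)
      (β₂ := b 2 1 - b 1 2) (β₃ := b 2 0 - b 0 2) (fun i => L (X i) 1) (fun i => L (X i) 0)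
      (fun i => L (X i) 2) hm (fun i => by linear_combination h0 i) _ fun i j => ?_
    rw [hδ']
    ring
  · refine pf_eq_zero_of_relation (a₀ := a 2) (a₁ := a 0) (a₂ := a 1) (β₁ := b 0 2 - b 2 0)
      (β₂ := b 1 2 - b 2 1) (β₃ := b 1 0 - b 0 1) (fun i => L (X i) 2) (fun i => L (X i) 0)
      (fun i => L (X i) 1) hm (fun i => by linear_combination h0 i) _ fun i j => ?_
    rw [hδ']
    ring

lemma altForm_sum_left (b : Fin 3 → Fin 3 → ℂ) (ξ : Fin 4 → ℂ) (ζ : Fin 4 → Fin 3 → ℂ)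
    (η : Fin 3 → ℂ) : altForm b (∑ i, ξ i • ζ i) η = ∑ i, ξ i * altForm b (ζ i) η := by
  simp only [altForm, Fin.sum_univ_three, Fin.sum_univ_four, Pi.add_apply, Pi.smul_apply,
    smul_eq_mul]
  ring

lemma altForm_swap (b : Fin 3 → Fin 3 → ℂ) (ξ η : Fin 3 → ℂ) :
    altForm b ξ η = - altForm b η ξ := by
  simp only [altForm, Fin.sum_univ_three]
  ring

/-- A complex vector in the kernel that annihilates the kernel has type `(0, 1)`. -/
lemma IsContactJet.sum_eq_zero {θ : E6 →L[ℝ] ℂ} {δ : E6 → E6 → ℂ} (h : IsContactJet θ δ)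
    {X : Fin 4 → E6} (hX : ∀ i, θ (X i) = 0)
    (hspan : ∀ v, θ v = 0 → ∃ t : Fin 4 → ℝ, v = ∑ i, t i • X i) {ξ : Fin 4 → ℂ}
    (hξ : ∀ j, ∑ i, ξ i * δ (X i) (X j) = 0) (u : E6) : ∑ i, ξ i * δ u (X i) = 0 := by
  obtain ⟨L, a, b, hL, ha, hθ, hδ, hnd⟩ := h
  -- The vectors L(X_i) span the kernel of the complex form, so the hypothesis on ξ is that its
  -- image in ℂ³ annihilates this kernel. By nondegeneracy the image is zero, and then every
  -- contraction with ξ vanishes.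
  have hη : ∑ i, ξ i • L (X i) = 0 := by
    refine hnd _ ?_ fun ζ hζ => ?_
    · have h1 (i) : ∑ j, a j * L (X i) j = 0 := by rw [← hθ, hX]
      simp only [Fin.sum_univ_three] at h1
      simp only [Fin.sum_univ_three, Fin.sum_univ_four, Pi.add_apply, Pi.smul_apply, smul_eq_mul]
      linear_combination ξ 0 * h1 0 + ξ 1 * h1 1 + ξ 2 * h1 2 + ξ 3 * h1 3
    · obtain ⟨v, rfl⟩ := hL ζ
      obtain ⟨t, rfl⟩ := hspan v (by rw [hθ, hζ])
      have h2 : L (∑ i, t i • X i) = ∑ i, (t i : ℂ) • L (X i) := by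
        rw [map_sum]
        refine Finset.sum_congr rfl fun i _ => ?_
        rw [map_smul]
        ext j
        simp
      rw [h2, altForm_swap, altForm_sum_left, neg_eq_zero]
      refine Finset.sum_eq_zero fun j _ => ?_
      rw [altForm_swap, altForm_sum_left]
      simp only [← hδ, hξ, neg_zero, mul_zero]
  simp only [hδ]
  have h3 := altForm_sum_left b ξ (fun i => L (X i)) (L u)
  rw [hη] at h3
  have h4 : ∑ i, ξ i * altForm b (L u) (L (X i)) = - ∑ i, ξ i * altForm b (L (X i)) (L u) := by
    rw [← Finset.sum_neg_distrib]
    exact Finset.sum_congr rfl fun i _ => by rw [altForm_swap]; ring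
  rw [h4, ← h3]
  simp [altForm]

/-- The standard basis of `ℂ³`. -/
noncomputable def e3 (j : Fin 3) : C3 := EuclideanSpace.single j 1

lemma C3_eq_sum (ξ : C3) : ξ = ∑ j, ξ j • e3 j := by
  ext k
  simp [e3, Pi.single_apply]

lemma contactVolume_e3_ne_zero {α : C3 → C3 →L[ℂ] ℂ} {q u v w : C3}
    (h : contactVolume α q u v w ≠ 0) : contactVolume α q (e3 0) (e3 1) (e3 2) ≠ 0 := by
  intro h0
  rw [C3_eq_sum u, C3_eq_sum v, C3_eq_sum w, contactVolume_combination] at h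
  exact h (by simp [h0])

/-- `dα` is nondegenerate on the kernel of a contact form. -/
lemma eq_zero_of_extD_eq_zero {α : C3 → C3 →L[ℂ] ℂ} {q : C3}
    (h : contactVolume α q (e3 0) (e3 1) (e3 2) ≠ 0) {ξ : C3} (hξ : α q ξ = 0)
    (hη : ∀ η, α q η = 0 → extD α q ξ η = 0) : ξ = 0 := by
  -- The vector α(w) v − α(v) w lies in the kernel of α. Testing ξ on it shows that the contraction
  -- of α ∧ dα with ξ vanishes, which forces ξ = 0 because α ∧ dα is a volume form.
  have hv (v w : C3) : contactVolume α q ξ v w = 0 := by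
    have h1 := hη (α q w • v - α q v • w) (by simp [mul_comm])
    simp only [extD, map_sub, map_smul, sub_apply, smul_apply, smul_eq_mul] at h1
    simp only [contactVolume, extD, hξ]
    linear_combination h1
  have hj (j : Fin 3) : ξ j = 0 := by
    have e (j : Fin 3) : e3 j = ∑ i, (Pi.single j 1 : Fin 3 → ℂ) i • e3 i := by
      simp [Pi.single_apply]
    have h2 (k l : Fin 3) := hv (e3 k) (e3 l)
    have h3 (k l : Fin 3) : contactVolume α q (∑ j, ξ j • e3 j)
        (∑ i, (Pi.single k 1 : Fin 3 → ℂ) i • e3 i)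
        (∑ i, (Pi.single l 1 : Fin 3 → ℂ) i • e3 i) = 0 := by
      rw [← e, ← e, ← C3_eq_sum]
      exact hv _ _
    simp only [contactVolume_combination, mul_eq_zero, h, or_false] at h3
    fin_cases j
    · simpa using h3 1 2
    · simpa using h3 0 2
    · simpa using h3 0 1
  ext j
  exact hj j

/-- A complex-contact germ is the kernel of a form with the pointwise structure of a complex
contact form. -/
lemma SupportsComplexContact.exists_isContactJet {D : E6 → Submodule ℝ E6} {p : E6}
    (hD : SupportsComplexContact D p) :
    ∃ Θ : E6 → E6 →L[ℝ] ℂ, SmoothNear Θ p ∧ ∀ᶠ x in 𝓝 p, (∀ v, v ∈ D x ↔ Θ x v = 0) ∧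
      IsContactJet (Θ x) (fun u v => fderiv ℝ Θ x u v - fderiv ℝ Θ x v u) := by
  obtain ⟨Φ, hΦ, α, ⟨hα, u, v, w, hvol⟩, hD⟩ := hD
  let r : (C3 →L[ℂ] ℂ) →L[ℝ] (C3 →L[ℝ] ℂ) :=
    ContinuousLinearMap.restrictScalarsL ℂ C3 ℂ ℝ ℝ
  let αr : C3 → C3 →L[ℝ] ℂ := fun z => r (α z)
  have hαr' {z : C3} (hz : AnalyticAt ℂ α z) (ξ η : C3) :
      DifferentiableAt ℝ αr z ∧ fderiv ℝ αr z ξ η = fderiv ℂ α z ξ η := by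
    have h1 : HasFDerivAt αr (r.comp ((fderiv ℂ α z).restrictScalars ℝ)) z :=
      r.hasFDerivAt.comp z (hz.differentiableAt.hasFDerivAt.restrictScalars ℝ)
    exact ⟨h1.differentiableAt, by rw [h1.fderiv]; rfl⟩
  have hvol' : contactVolume α (Φ p) (e3 0) (e3 1) (e3 2) ≠ 0 :=
    contactVolume_e3_ne_zero (u := u) (v := v) (w := w) hvol
  have hcont : ∀ᶠ z in 𝓝 (Φ p), contactVolume α z (e3 0) (e3 1) (e3 2) ≠ 0 := by
    have h1 : ContinuousAt α (Φ p) := hα.continuousAt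
    have h2 : ContinuousAt (fderiv ℂ α) (Φ p) := hα.fderiv.continuousAt
    have : ContinuousAt (fun z => contactVolume α z (e3 0) (e3 1) (e3 2)) (Φ p) := by
      unfold contactVolume extD
      fun_prop
    exact this.eventually_ne hvol'
  refine ⟨fun x => (αr (Φ x)).comp (fderiv ℝ Φ x), ?_, ?_⟩
  · filter_upwards [hΦ.1, hΦ.1.fderiv,
      hΦ.1.contDiffAt.continuousAt.eventually hα.eventually_analyticAt] with x h1 h2 h3
    have h4 : ContDiffAt ℝ ∞ (fun x => αr (Φ x)) x :=
      r.contDiff.contDiffAt.comp x (((h3.contDiffAt (n := ∞)).restrict_scalars ℝ).comp x h1)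
    exact h4.clm_comp h2
  · filter_upwards [hΦ.1, hΦ.eventually_bijective, hD,
      hΦ.1.contDiffAt.continuousAt.eventually hα.eventually_analyticAt,
      hΦ.1.contDiffAt.continuousAt.eventually hcont] with x h1 h2 h3 h4 h5
    refine ⟨h3, (WithLp.linearEquiv 2 ℝ (Fin 3 → ℂ)).toLinearMap.comp
        (fderiv ℝ Φ x : E6 →ₗ[ℝ] C3), fun j => α (Φ x) (e3 j),
        fun j l => fderiv ℂ α (Φ x) (e3 l) (e3 j), ?_, ?_, ?_, ?_, ?_⟩
    · exact (WithLp.linearEquiv 2 ℝ (Fin 3 → ℂ)).surjective.comp h2.2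
    · intro h0
      apply h5
      have h6 (j) : α (Φ x) (e3 j) = 0 := congrFun h0 j
      simp [contactVolume, h6]
    · intro v
      change α (Φ x) (fderiv ℝ Φ x v) = ∑ j, α (Φ x) (e3 j) * (fderiv ℝ Φ x v) j
      conv_lhs => rw [C3_eq_sum (fderiv ℝ Φ x v)]
      simp [mul_comm]
    · intro u v
      beta_reduce
      rw [fderiv_pullback_sub (h1.of_le ENat.LEInfty.out) (hαr' h4 0 0).1,
        (hαr' h4 _ _).2, (hαr' h4 _ _).2]
      change _ = altForm _ (fun j => (fderiv ℝ Φ x u) j) (fun j => (fderiv ℝ Φ x v) j)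
      conv_lhs => rw [C3_eq_sum (fderiv ℝ Φ x v), C3_eq_sum (fderiv ℝ Φ x u)]
      simp only [altForm, Fin.sum_univ_three, map_add, map_smul, add_apply, smul_apply,
        smul_eq_mul]
      ring
    · intro ξ hξ hη
      have hα' (ζ : C3) : α (Φ x) ζ = ∑ j, α (Φ x) (e3 j) * ζ j := by
        conv_lhs => rw [C3_eq_sum ζ]
        simp [mul_comm]
      have h6 : (WithLp.toLp 2 ξ : C3) = 0 := by
        refine eq_zero_of_extD_eq_zero h5 ?_ fun η hη' => ?_
        · rw [hα']; exact hξ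
        · have h7 := hη (fun j => η j) (by rw [← hα', hη'])
          rw [← h7]
          conv_lhs => rw [C3_eq_sum η, C3_eq_sum (WithLp.toLp 2 ξ)]
          simp only [extD, altForm, Fin.sum_univ_three, map_add, map_smul, add_apply, smul_apply,
            smul_eq_mul]
          ring
      ext j
      exact congrArg (fun z : C3 => z j) h6

/-! ### Distributions given as graphs -/

/-- The index of a base coordinate. -/
abbrev base (i : Fin 4) : Fin 6 := i.castLE (by norm_num)

/-- The standard basis of `ℝ⁶`. -/
noncomputable def e6 (k : Fin 6) : E6 := EuclideanSpace.single k 1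

@[simp] lemma e6_apply (k l : Fin 6) : (e6 k) l = if l = k then (1 : ℝ) else 0 := by
  simp [e6]

/-- The subspace `dz = ∑ f_i dx_i` with `z = x₄ + √-1 x₅`. -/
noncomputable def graphForm (f : Fin 4 → ℂ) : E6 →L[ℝ] ℂ :=
  cc 4 5 - ∑ i, f i • Complex.ofRealCLM.comp (dcoord (base i))

lemma graphForm_apply (f : Fin 4 → ℂ) (v : E6) :
    graphForm f v = v 4 + Complex.I * v 5 - ∑ i, f i * v (base i) := by
  simp [graphForm, cc_apply, dcoord]

/-- The horizontal lift of the `i`-th base coordinate field. -/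
noncomputable def frame (f : Fin 4 → ℂ) (i : Fin 4) : E6 :=
  e6 (base i) + (f i).re • e6 4 + (f i).im • e6 5

lemma graphForm_frame (f : Fin 4 → ℂ) (i : Fin 4) : graphForm f (frame f i) = 0 := by
  rw [graphForm_apply]
  have h := Complex.re_add_im (f i)
  fin_cases i <;> simp [frame, Fin.sum_univ_four, base, mul_comm Complex.I] at h ⊢

lemma exists_eq_sum_frame {f : Fin 4 → ℂ} {v : E6} (hv : graphForm f v = 0) :
    v = ∑ i, v (base i) • frame f i := by
  rw [graphForm_apply, sub_eq_zero] at hv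
  have h1 := congrArg Complex.re hv
  have h2 := congrArg Complex.im hv
  simp [Fin.sum_univ_four, base] at h1 h2
  ext k
  fin_cases k <;> simp [frame, Fin.sum_univ_four, base, h1, h2] <;> ring

/-- The curvature `θ([X_i, X_j])` of the graph distribution with coefficients `F`. -/
noncomputable def curv (F : E6 → Fin 4 → ℂ) (x : E6) (i j : Fin 4) : ℂ :=
  fderiv ℝ F x (frame (F x) i) j - fderiv ℝ F x (frame (F x) j) i

/-- The curvature `(θ + m θ̄)([X_i, X_j])`. -/
noncomputable def curvB (F : E6 → Fin 4 → ℂ) (m : ℂ) (x : E6) (i j : Fin 4) : ℂ :=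
  curv F x i j + m * (starRingEnd ℂ) (curv F x i j)

/-- Coefficients of a complex horizontal vector in the kernel of the curvature. -/
noncomputable def kerVec (c : Fin 4 → Fin 4 → ℂ) : Fin 4 → ℂ := ![c 1 2, - c 0 2, c 0 1, 0]

/-- The vector is the contraction of `c` with e₀ ∧ e₁ ∧ e₂. Three of the four equations hold by
antisymmetry, and the last one is the Pfaffian. -/
lemma kerVec_mem_ker {c : Fin 4 → Fin 4 → ℂ} (hc : ∀ i j, c i j = - c j i) (hpf : pf c = 0)
    (j : Fin 4) : ∑ i, kerVec c i * c i j = 0 := by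
  have h0 (i) : c i i = 0 := by
    have := hc i i
    exact self_eq_neg.1 this
  rw [pf] at hpf
  fin_cases j <;> simp [kerVec, Fin.sum_univ_four, h0]
  · rw [hc 1 0, hc 2 0]; ring
  · rw [hc 2 1]; ring
  · ring
  · linear_combination hpf

/-- The obstruction to the integrability of the almost complex structure defined by the graph
distribution with coefficients `F` and the Beltrami coefficient `μ`. -/
noncomputable def obstruction (F : E6 → Fin 4 → ℂ) (μ : E6 → ℂ) (x : E6) : ℂ :=
  ∑ i, kerVec (curvB F (μ x) x) i * (2 * fderiv ℝ μ x (frame (F x) i)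
    + (1 - μ x) * (fderiv ℝ F x (e6 4) i + μ x * (starRingEnd ℂ) (fderiv ℝ F x (e6 4) i))
    + Complex.I * (1 + μ x) *
      (fderiv ℝ F x (e6 5) i + μ x * (starRingEnd ℂ) (fderiv ℝ F x (e6 5) i)))

lemma curvB_swap (F : E6 → Fin 4 → ℂ) (m : ℂ) (x : E6) (i j : Fin 4) :
    curvB F m x i j = - curvB F m x j i := by
  simp only [curvB, curv, map_sub]
  ring

/-- The coefficient of `dz` of a real-linear form. -/
noncomputable def coefZ (θ : E6 →L[ℝ] ℂ) : ℂ := (θ (e6 4) - Complex.I * θ (e6 5)) / 2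

/-- The coefficient of `dz̄` of a real-linear form. -/
noncomputable def coefZbar (θ : E6 →L[ℝ] ℂ) : ℂ := (θ (e6 4) + Complex.I * θ (e6 5)) / 2

lemma apply_vertical (θ : E6 →L[ℝ] ℂ) (a : ℂ) :
    θ (a.re • e6 4 + a.im • e6 5) = coefZ θ * a + coefZbar θ * (starRingEnd ℂ) a := by
  have h1 : (starRingEnd ℂ) a = a.re - a.im * Complex.I := by
    apply Complex.ext <;> simp
  conv_rhs => rw [h1]; enter [1]; rw [← Complex.re_add_im a]
  simp only [map_add, map_smul, Complex.real_smul, coefZ, coefZbar]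
  linear_combination ((a.im : ℂ) * θ (e6 5)) * Complex.I_mul_I

lemma hasFDerivAt_frame {F : E6 → Fin 4 → ℂ} {x : E6} (hF : DifferentiableAt ℝ F x)
    (i : Fin 4) (u : E6) : DifferentiableAt ℝ (fun y => frame (F y) i) x ∧
      fderiv ℝ (fun y => frame (F y) i) x u
        = (fderiv ℝ F x u i).re • e6 4 + (fderiv ℝ F x u i).im • e6 5 := by
  have h1 : HasFDerivAt (fun y => F y i) ((ContinuousLinearMap.proj i).comp (fderiv ℝ F x)) x :=
    (hasFDerivAt_pi'.1 hF.hasFDerivAt) i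
  have h2 : HasFDerivAt (fun y => (F y i).re) _ x := Complex.reCLM.hasFDerivAt.comp x h1
  have h3 : HasFDerivAt (fun y => (F y i).im) _ x := Complex.imCLM.hasFDerivAt.comp x h1
  have h4 := ((h2.smul_const (e6 4)).const_add (e6 (base i))).add (h3.smul_const (e6 5))
  have h5 : HasFDerivAt (fun y => frame (F y) i) _ x := h4
  refine ⟨h5.differentiableAt, ?_⟩
  rw [h5.fderiv]
  simp

/-- Differentiating `Θ(X_i) = 0`. -/
lemma fderiv_apply_frame {F : E6 → Fin 4 → ℂ} {Θ : E6 → E6 →L[ℝ] ℂ} {x : E6}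
    (hF : DifferentiableAt ℝ F x) (hΘ : DifferentiableAt ℝ Θ x)
    (h0 : ∀ᶠ y in 𝓝 x, ∀ i, Θ y (frame (F y) i) = 0) (i : Fin 4) (u : E6) :
    fderiv ℝ Θ x u (frame (F x) i) = - (coefZ (Θ x) * fderiv ℝ F x u i
      + coefZbar (Θ x) * (starRingEnd ℂ) (fderiv ℝ F x u i)) := by
  obtain ⟨h1, h2⟩ := hasFDerivAt_frame hF i u
  have h3 := (hΘ.hasFDerivAt.clm_apply h1.hasFDerivAt).fderiv
  have h4 : (fun y => Θ y (frame (F y) i)) =ᶠ[𝓝 x] fun _ => 0 := h0.mono fun y hy => hy i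
  rw [h4.fderiv_eq] at h3
  have h5 := congrArg (fun f : E6 →L[ℝ] ℂ => f u) h3
  simp [h2] at h5
  rw [← apply_vertical]
  simp only [map_add, map_smul, Complex.real_smul]
  linear_combination -h5

/-- The integrability obstruction vanishes for a form of complex contact type, normalized. -/
lemma obstruction_eq_zero {F : E6 → Fin 4 → ℂ} {Θ : E6 → E6 →L[ℝ] ℂ} {μ : E6 → ℂ} {x : E6}
    (hF : DifferentiableAt ℝ F x) (hΘ : DifferentiableAt ℝ Θ x) (hμ : DifferentiableAt ℝ μ x)
    (hker : ∀ᶠ y in 𝓝 x, ∀ v, Θ y v = 0 ↔ graphForm (F y) v = 0)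
    (hjet : IsContactJet (Θ x) (fun u v => fderiv ℝ Θ x u v - fderiv ℝ Θ x v u))
    (hZ : coefZ (Θ x) ≠ 0) (hk : ∀ᶠ y in 𝓝 x, coefZbar (Θ y) = coefZ (Θ y) * μ y) :
    pf (curvB F (μ x) x) = 0 ∧ obstruction F μ x = 0 := by
  have h0 : ∀ᶠ y in 𝓝 x, ∀ i, Θ y (frame (F y) i) = 0 :=
    hker.mono fun y hy i => (hy _).2 (graphForm_frame _ _)
  have hd := fderiv_apply_frame hF hΘ h0
  have hkx := hk.self_of_nhds
  -- Since Θ vanishes on the frame, derivatives of its vertical coefficients do not enter here; only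
  -- the curvature of the graph does.
  have hcurv (i j) : fderiv ℝ Θ x (frame (F x) i) (frame (F x) j)
      - fderiv ℝ Θ x (frame (F x) j) (frame (F x) i)
      = - coefZ (Θ x) * curvB F (μ x) x i j := by
    rw [hd, hd, hkx]
    simp only [curvB, curv, map_sub]
    ring
  have hpf : pf (curvB F (μ x) x) = 0 := by
    have h1 := hjet.pf_eq_zero h0.self_of_nhds
    simp only [hcurv] at h1
    simp only [pf] at h1 ⊢
    have h2 : coefZ (Θ x) ^ 2 ≠ 0 := pow_ne_zero 2 hZ
    refine (mul_eq_zero.1 ?_).resolve_left h2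
    linear_combination h1
  refine ⟨hpf, ?_⟩
  set ξ := kerVec (curvB F (μ x) x) with hξ
  have hξ0 := hjet.sum_eq_zero h0.self_of_nhds
    (fun v hv => ⟨_, exists_eq_sum_frame ((hker.self_of_nhds v).1 hv)⟩) (ξ := ξ) (fun j => by
      simp only [hcurv]
      have h1 := kerVec_mem_ker (curvB_swap F (μ x) x) hpf j
      calc ∑ i, ξ i * (-coefZ (Θ x) * curvB F (μ x) x i j)
          = -coefZ (Θ x) * ∑ i, ξ i * curvB F (μ x) x i j := by
            rw [Finset.mul_sum]; exact Finset.sum_congr rfl fun i _ => by ring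
        _ = 0 := by rw [hξ, h1, mul_zero])
  have hΘe (e u : E6) : fderiv ℝ Θ x u e = fderiv ℝ (fun y => Θ y e) x u := by
    rw [fderiv_clm_apply hΘ (differentiableAt_const _)]
    simp
  have hde (e : E6) : DifferentiableAt ℝ (fun y => Θ y e) x :=
    hΘ.clm_apply (differentiableAt_const _)
  -- This differentiates Θ(∂_z̄) = μ Θ(∂_z), and is the only source of derivatives of μ.
  have hrel (u : E6) : fderiv ℝ Θ x u (e6 4) + Complex.I * fderiv ℝ Θ x u (e6 5)
      = (fderiv ℝ Θ x u (e6 4) - Complex.I * fderiv ℝ Θ x u (e6 5)) * μ x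
        + 2 * coefZ (Θ x) * fderiv ℝ μ x u := by
    have h1 : (fun y => Θ y (e6 4) + Complex.I * Θ y (e6 5))
        =ᶠ[𝓝 x] fun y => (Θ y (e6 4) - Complex.I * Θ y (e6 5)) * μ y := by
      filter_upwards [hk] with y hy
      simp only [coefZ, coefZbar] at hy
      linear_combination 2 * hy
    have h2 := h1.fderiv_eq (𝕜 := ℝ)
    have hsub : DifferentiableAt ℝ (fun y => Θ y (e6 4) - Complex.I * Θ y (e6 5)) x :=
      (hde _).sub ((hde _).const_mul _)
    rw [fderiv_fun_add (hde _) ((hde _).const_mul _), fderiv_const_mul (hde _),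
      fderiv_fun_mul hsub hμ,
      fderiv_fun_sub (hde _) ((hde _).const_mul _), fderiv_const_mul (hde _)] at h2
    have h3 := congrArg (fun f : E6 →L[ℝ] ℂ => f u) h2
    simp only [add_apply, sub_apply, smul_apply, smul_eq_mul] at h3
    rw [hΘe, hΘe, h3, coefZ]
    ring
  have h4 := hξ0 (e6 4)
  have h5 := hξ0 (e6 5)
  refine (mul_eq_zero.1 ?_).resolve_left hZ
  rw [obstruction, ← hξ]
  simp only [Fin.sum_univ_four] at h4 h5 ⊢
  simp only [hd, hkx] at h4 h5
  have hr := fun i => hrel (frame (F x) i)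
  -- The weights 1 − μ and i(1 + μ) on `e6 4` and `e6 5` form the vector 2(∂_z̄ − μ ∂_z), which Θ
  -- kills. The relations `hr` then cancel all derivatives of the vertical coefficients of Θ and
  -- leave `coefZ (Θ x)` times the obstruction.
  linear_combination (-(1 - μ x)) * h4 - Complex.I * (1 + μ x) * h5 
    + (-ξ 0) * hr 0 - ξ 1 * hr 1 - ξ 2 * hr 2 - ξ 3 * hr 3

/-! ### The Beltrami coefficient -/

/-- The mixed Pfaffian of an antisymmetric matrix and its conjugate. -/
noncomputable def mixedPf (c : Fin 4 → Fin 4 → ℂ) : ℝ :=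
  2 * (c 0 1 * (starRingEnd ℂ) (c 2 3) - c 0 2 * (starRingEnd ℂ) (c 1 3)
    + c 0 3 * (starRingEnd ℂ) (c 1 2)).re

/-- The matrix is that of an elliptic pencil, positively oriented. -/
def IsElliptic (c : Fin 4 → Fin 4 → ℂ) : Prop :=
  0 < mixedPf c ∧ 4 * Complex.normSq (pf c) < mixedPf c ^ 2

/-- The solution of modulus less than one of `pf (c + m c̄) = 0`. -/
noncomputable def beltrami (c : Fin 4 → Fin 4 → ℂ) : ℂ :=
  -2 * pf c / ((mixedPf c + √(mixedPf c ^ 2 - 4 * Complex.normSq (pf c)) : ℝ) : ℂ)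

/-- The Pfaffian is polarized. The middle coefficient is real and the outer ones are conjugate, so
for nonzero `pf c` the roots are exchanged by m ↦ 1/m̄. -/
lemma pf_add_mul_conj (c : Fin 4 → Fin 4 → ℂ) (m : ℂ) :
    pf (fun i j => c i j + m * (starRingEnd ℂ) (c i j))
      = pf c + mixedPf c * m + (starRingEnd ℂ) (pf c) * m ^ 2 := by
  have h (a : ℂ) : ((2 * a.re : ℝ) : ℂ) = a + (starRingEnd ℂ) a := (Complex.add_conj a).symm
  rw [mixedPf, h]
  simp only [pf, map_add, map_sub, map_mul, Complex.conj_conj]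
  ring

lemma IsElliptic.two_norm_lt {c : Fin 4 → Fin 4 → ℂ} (h : IsElliptic c) :
    2 * ‖pf c‖ < mixedPf c := by
  refine lt_of_pow_lt_pow_left₀ 2 h.1.le ?_
  have := h.2
  rw [Complex.normSq_eq_norm_sq] at this
  linarith [this, mul_pow 2 ‖pf c‖ 2]

lemma IsElliptic.norm_beltrami_lt {c : Fin 4 → Fin 4 → ℂ} (h : IsElliptic c) :
    ‖beltrami c‖ < 1 := by
  have h1 := h.two_norm_lt
  have h2 := Real.sqrt_nonneg (mixedPf c ^ 2 - 4 * Complex.normSq (pf c))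
  have h3 := h.1
  rw [beltrami, norm_div, norm_mul, norm_neg, Complex.norm_two, Complex.norm_real,
    Real.norm_of_nonneg (by linarith), div_lt_one (by linarith)]
  linarith

/-- Ellipticity keeps the roots off the unit circle, and their symmetry under inversion leaves only
one of them in the closed disc. -/
lemma IsElliptic.eq_beltrami {c : Fin 4 → Fin 4 → ℂ} (h : IsElliptic c) {m : ℂ} (hm : ‖m‖ ≤ 1)
    (hpf : pf (fun i j => c i j + m * (starRingEnd ℂ) (c i j)) = 0) : m = beltrami c := by
  rw [pf_add_mul_conj] at hpf
  have h1 := h.two_norm_lt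
  have h3 := h.1
  set P := mixedPf c with hP
  set A := pf c with hA
  set S := √(P ^ 2 - 4 * Complex.normSq A) with hS
  have hS0 : 0 ≤ S := Real.sqrt_nonneg _
  have hS2 : (S : ℂ) ^ 2 = P ^ 2 - 4 * (A * (starRingEnd ℂ) A) := by
    rw [Complex.mul_conj]
    have : S ^ 2 = P ^ 2 - 4 * Complex.normSq A := Real.sq_sqrt (by linarith [h.2])
    exact_mod_cast this
  have hPS : ((P + S : ℝ) : ℂ) ≠ 0 := by
    have : P + S ≠ 0 := by linarith
    exact_mod_cast this
  have hb : beltrami c = -2 * A / ((P + S : ℝ) : ℂ) := rfl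
  rw [hb, eq_div_iff hPS]
  -- The square is completed after multiplication by 4Ā. When A = 0 this loses the equation, so that
  -- case goes back to `hpf`, which is then linear.
  have h4 : (2 * (starRingEnd ℂ) A * m + P - S) * (2 * (starRingEnd ℂ) A * m + P + S) = 0 := by
    linear_combination 4 * (starRingEnd ℂ) A * hpf - hS2
  push_cast
  rcases mul_eq_zero.1 h4 with h5 | h5
  · by_cases hA0 : A = 0
    · rw [hA0] at hpf ⊢
      simp only [map_zero, zero_mul, add_zero, zero_add, mul_eq_zero] at hpf
      have : (P : ℂ) ≠ 0 := by exact_mod_cast h3.ne'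
      rw [hpf.resolve_left this]
      simp
    · have hA' : (starRingEnd ℂ) A ≠ 0 := by simpa using hA0
      refine mul_left_cancel₀ hA' ?_
      linear_combination (1 / 2 : ℂ) * (P + S) * h5 + (1 / 2 : ℂ) * hS2
  -- The other factor gives 2|A||m| = P + S, but |m| ≤ 1 and 2|A| < P.
  · exfalso
    have h6 : 2 * (starRingEnd ℂ) A * m = -((P + S : ℝ) : ℂ) := by
      push_cast
      linear_combination h5
    have h7 := congrArg norm h6
    rw [norm_mul, norm_mul, Complex.norm_two, RCLike.norm_conj, norm_neg, Complex.norm_real,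
      Real.norm_of_nonneg (by linarith)] at h7
    nlinarith [norm_nonneg A, norm_nonneg m]

/-! ### Obstruction for complex-contact germs -/

lemma coefZ_conj (θ : E6 →L[ℝ] ℂ) :
    coefZ ((Complex.conjCLE : ℂ →L[ℝ] ℂ).comp θ) = (starRingEnd ℂ) (coefZbar θ) := by
  simp [coefZ, coefZbar, map_ofNat (starRingEnd ℂ)]
  ring

lemma coefZbar_conj (θ : E6 →L[ℝ] ℂ) :
    coefZbar ((Complex.conjCLE : ℂ →L[ℝ] ℂ).comp θ) = (starRingEnd ℂ) (coefZ θ) := by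
  simp [coefZ, coefZbar, map_ofNat (starRingEnd ℂ)]

lemma contDiffAt_div {P : Type*} [NormedAddCommGroup P] [NormedSpace ℝ P] {f g : P → ℂ} {z : P}
    {n : ℕ∞ω} (hf : ContDiffAt ℝ n f z) (hg : ContDiffAt ℝ n g z) (h0 : g z ≠ 0) :
    ContDiffAt ℝ n (fun y => f y / g y) z := by
  simp only [div_eq_mul_inv]
  exact hf.mul (hg.inv h0)

lemma contDiff_coefZ : ContDiff ℝ ∞ coefZ := by
  have h (e : E6) : ContDiff ℝ ∞ fun θ : E6 →L[ℝ] ℂ => θ e :=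
    (ContinuousLinearMap.apply ℝ ℂ e).contDiff
  exact ((h _).sub (contDiff_const.mul (h _))).div_const _

lemma contDiff_coefZbar : ContDiff ℝ ∞ coefZbar := by
  have h (e : E6) : ContDiff ℝ ∞ fun θ : E6 →L[ℝ] ℂ => θ e :=
    (ContinuousLinearMap.apply ℝ ℂ e).contDiff
  exact ((h _).add (contDiff_const.mul (h _))).div_const _

lemma graphForm_e4 (f : Fin 4 → ℂ) : graphForm f (e6 4) = 1 := by
  simp [graphForm_apply, Fin.sum_univ_four, base]

lemma graphForm_vertical (f : Fin 4 → ℂ) (a : ℂ) :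
    graphForm f (a.re • e6 4 + a.im • e6 5) = a := by
  rw [graphForm_apply]
  simp [Fin.sum_univ_four, base, mul_comm Complex.I, Complex.re_add_im]

/-- If the dominant coefficient were zero, both would be, and θ would vanish on the vertical plane,
which is transverse to a graph. -/
lemma coefZ_ne_zero_of_ker {θ : E6 →L[ℝ] ℂ} {f : Fin 4 → ℂ}
    (h : ∀ v, θ v = 0 ↔ graphForm f v = 0) (hle : ‖coefZbar θ‖ ≤ ‖coefZ θ‖) : coefZ θ ≠ 0 := by
  intro h0
  rw [h0, norm_zero, norm_le_zero_iff] at hle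
  have h1 := apply_vertical θ 1
  rw [h0, hle, zero_mul, zero_mul, add_zero, h, graphForm_vertical] at h1
  exact one_ne_zero h1

lemma exists_beltrami_of_norm_le {F : E6 → Fin 4 → ℂ} {Θ : E6 → E6 →L[ℝ] ℂ} {p : E6}
    (hF : SmoothNear F p) (hΘ : SmoothNear Θ p)
    (hker : ∀ᶠ y in 𝓝 p, ∀ v, Θ y v = 0 ↔ graphForm (F y) v = 0)
    (hjet : ∀ᶠ x in 𝓝 p, IsContactJet (Θ x) (fun u v => fderiv ℝ Θ x u v - fderiv ℝ Θ x v u))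
    (hle : ‖coefZbar (Θ p)‖ ≤ ‖coefZ (Θ p)‖) :
    ∃ μ : E6 → ℂ, SmoothNear μ p ∧ ‖μ p‖ ≤ 1 ∧
      ∀ᶠ x in 𝓝 p, pf (curvB F (μ x) x) = 0 ∧ obstruction F μ x = 0 := by
  have hne := coefZ_ne_zero_of_ker hker.self_of_nhds hle
  have hz : ContinuousAt (fun x => coefZ (Θ x)) p :=
    contDiff_coefZ.continuous.continuousAt.comp hΘ.contDiffAt.continuousAt
  have hne' := hz.eventually_ne hne
  have hμ : SmoothNear (fun x => coefZbar (Θ x) / coefZ (Θ x)) p := by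
    filter_upwards [hΘ, hne'] with x hx hx0
    exact contDiffAt_div (contDiff_coefZbar.contDiffAt.comp x hx)
      (contDiff_coefZ.contDiffAt.comp x hx) hx0
  obtain ⟨μ, hμd⟩ : ∃ μ : E6 → ℂ, μ = fun x => coefZbar (Θ x) / coefZ (Θ x) := ⟨_, rfl⟩
  rw [← hμd] at hμ
  have hk : ∀ᶠ y in 𝓝 p, coefZbar (Θ y) = coefZ (Θ y) * μ y :=
    hne'.mono fun y hy => by rw [hμd]; exact (mul_div_cancel₀ _ hy).symm
  refine ⟨μ, hμ, ?_, ?_⟩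
  · rw [hμd, norm_div]
    exact div_le_one_of_le₀ hle (norm_nonneg _)
  · filter_upwards [hF, hΘ, hμ, hker.eventually_nhds, hjet, hne', hk.eventually_nhds]
      with x h1 h2 h3 h4 h5 h6 h7
    exact obstruction_eq_zero (h1.differentiableAt (by simp)) (h2.differentiableAt (by simp))
      (h3.differentiableAt (by simp)) h4 h5 h6 h7

/-- A complex-contact germ that is a graph has a smooth Beltrami coefficient for which the
integrability obstruction vanishes. -/
theorem SupportsComplexContact.exists_beltrami {D : E6 → Submodule ℝ E6} {F : E6 → Fin 4 → ℂ}
    {p : E6} (hD : SupportsComplexContact D p) (hF : SmoothNear F p)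
    (hgraph : ∀ᶠ x in 𝓝 p, ∀ v, v ∈ D x ↔ graphForm (F x) v = 0) :
    ∃ μ : E6 → ℂ, SmoothNear μ p ∧ ‖μ p‖ ≤ 1 ∧
      ∀ᶠ x in 𝓝 p, pf (curvB F (μ x) x) = 0 ∧ obstruction F μ x = 0 := by
  obtain ⟨Θ, hΘ, hΘD⟩ := hD.exists_isContactJet
  have hker : ∀ᶠ y in 𝓝 p, ∀ v, Θ y v = 0 ↔ graphForm (F y) v = 0 := by
    filter_upwards [hΘD, hgraph] with y h1 h2 v
    rw [← h1.1, h2]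
  -- If the coefficient of dz̄ dominates, Θ is replaced by its conjugate, a contact form for the
  -- conjugate complex structure with the same kernel.
  rcases le_total ‖coefZbar (Θ p)‖ ‖coefZ (Θ p)‖ with hle | hle
  · exact exists_beltrami_of_norm_le hF hΘ hker (hΘD.mono fun _ h => h.2) hle
  · let C : (E6 →L[ℝ] ℂ) →L[ℝ] (E6 →L[ℝ] ℂ) :=
      ContinuousLinearMap.compL ℝ E6 ℂ ℂ (Complex.conjCLE : ℂ →L[ℝ] ℂ)
    have hC (θ : E6 →L[ℝ] ℂ) (v : E6) : C θ v = (starRingEnd ℂ) (θ v) := rfl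
    refine exists_beltrami_of_norm_le (Θ := fun x => C (Θ x)) hF ?_ ?_ ?_ ?_
    · exact hΘ.mono fun x hx => C.contDiff.contDiffAt.comp x hx
    · filter_upwards [hker] with y hy v
      rw [hC, map_eq_zero, hy]
    · filter_upwards [hΘ, hΘD] with x h1 h2
      have h3 : HasFDerivAt (fun x => C (Θ x)) (C.comp (fderiv ℝ Θ x)) x :=
        C.hasFDerivAt.comp x (h1.differentiableAt (by simp)).hasFDerivAt
      have h4 := h2.2.conj
      rw [h3.fderiv]
      convert! h4 using 3
      rw [map_sub]
      rfl
    · change ‖coefZbar ((Complex.conjCLE : ℂ →L[ℝ] ℂ).comp (Θ p))‖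
        ≤ ‖coefZ ((Complex.conjCLE : ℂ →L[ℝ] ℂ).comp (Θ p))‖
      rwa [coefZ_conj, coefZbar_conj, RCLike.norm_conj, RCLike.norm_conj]

/-! ### Kernels of smooth forms as graphs -/

lemma apply_eq_coef_graphForm {θ : E6 →L[ℝ] ℂ} {f : Fin 4 → ℂ} (hf : ∀ i, θ (frame f i) = 0)
    (v : E6) : θ v = coefZ θ * graphForm f v + coefZbar θ * (starRingEnd ℂ) (graphForm f v) := by
  have h1 : graphForm f (v - ((graphForm f v).re • e6 4 + (graphForm f v).im • e6 5)) = 0 := by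
    rw [map_sub, graphForm_vertical, sub_self]
  have h2 := congrArg θ (exists_eq_sum_frame h1)
  rw [map_sum] at h2
  simp only [map_smul, hf, smul_zero, Finset.sum_const_zero] at h2
  rw [map_sub, sub_eq_zero] at h2
  rw [h2, apply_vertical]

/-- The number is the determinant of θ restricted to the vertical plane, as a real-linear map a ↦ Z
a + Z' ā. This restriction is injective because the plane meets the kernel only in zero. -/
lemma normSq_sub_ne_zero_of_ker {θ : E6 →L[ℝ] ℂ} {f : Fin 4 → ℂ}
    (h : ∀ v, θ v = 0 ↔ graphForm f v = 0) :
    Complex.normSq (coefZ θ) - Complex.normSq (coefZbar θ) ≠ 0 := by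
  intro h0
  have h1 (a : ℂ) (ha : coefZ θ * a + coefZbar θ * (starRingEnd ℂ) a = 0) : a = 0 := by
    rw [← apply_vertical, h, graphForm_vertical] at ha
    exact ha
  have h0' : coefZ θ * (starRingEnd ℂ) (coefZ θ) - coefZbar θ * (starRingEnd ℂ) (coefZbar θ)
      = 0 := by
    rw [Complex.mul_conj, Complex.mul_conj]
    exact_mod_cast h0
  have h2 := h1 ((starRingEnd ℂ) (coefZ θ) - coefZbar θ) (by
    simp only [map_sub, Complex.conj_conj]
    linear_combination h0')
  have h3 := h1 (Complex.I * ((starRingEnd ℂ) (coefZ θ) + coefZbar θ)) (by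
    simp only [map_add, map_mul, Complex.conj_conj, Complex.conj_I]
    linear_combination Complex.I * h0')
  have h3' := (mul_eq_zero.1 h3).resolve_left Complex.I_ne_zero
  have h4 : coefZbar θ = 0 := by linear_combination (h3' - h2) / 2
  have h5 : (starRingEnd ℂ) (coefZ θ) = 0 := by linear_combination (h3' + h2) / 2
  have h6 := h1 1 (by simp [h4, (map_eq_zero _).1 h5])
  exact one_ne_zero h6

lemma contDiff_conj : ContDiff ℝ ∞ fun a : ℂ => (starRingEnd ℂ) a :=
  (Complex.conjCLE : ℂ →L[ℝ] ℂ).contDiff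

/-- If the kernel of a smooth form is a graph at a point, then it is a graph with smooth
coefficients near that point. -/
lemma exists_smooth_graph {P : Type*} [NormedAddCommGroup P] [NormedSpace ℝ P]
    {θ : P → E6 →L[ℝ] ℂ} {z : P} (hθ : SmoothNear θ z)
    (hz : ∃ f, ∀ v, θ z v = 0 ↔ graphForm f v = 0) :
    ∃ F : P → Fin 4 → ℂ, SmoothNear F z ∧
      ∀ᶠ y in 𝓝 z, ∀ v, θ y v = 0 ↔ graphForm (F y) v = 0 := by
  obtain ⟨f, hf⟩ := hz
  let Δ : P → ℂ := fun y => coefZ (θ y) * (starRingEnd ℂ) (coefZ (θ y))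
    - coefZbar (θ y) * (starRingEnd ℂ) (coefZbar (θ y))
  -- Cramer's rule for Z f + Z' f̄ = −θ(e_i) and its conjugate, with determinant `Δ`. The equation
  -- says that θ kills the i-th frame vector.
  let F : P → Fin 4 → ℂ := fun y i => (coefZbar (θ y) * (starRingEnd ℂ) (θ y (e6 (base i)))
    - (starRingEnd ℂ) (coefZ (θ y)) * θ y (e6 (base i))) / Δ y
  have hs {y} (hy : ContDiffAt ℝ ∞ θ y) : ContDiffAt ℝ ∞ (fun y => coefZ (θ y)) y ∧
      ContDiffAt ℝ ∞ (fun y => coefZbar (θ y)) y :=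
    ⟨contDiff_coefZ.contDiffAt.comp y hy, contDiff_coefZbar.contDiffAt.comp y hy⟩
  have hconj {g : P → ℂ} {y} (hy : ContDiffAt ℝ ∞ g y) :
      ContDiffAt ℝ ∞ (fun y => (starRingEnd ℂ) (g y)) y :=
    contDiff_conj.contDiffAt.comp y hy
  have hΔs {y} (hy : ContDiffAt ℝ ∞ θ y) : ContDiffAt ℝ ∞ Δ y :=
    ((hs hy).1.mul (hconj (hs hy).1)).sub ((hs hy).2.mul (hconj (hs hy).2))
  have hΔz : Δ z ≠ 0 := by
    have h1 := normSq_sub_ne_zero_of_ker hf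
    simp only [Δ, Complex.mul_conj]
    exact_mod_cast h1
  have hΔ := (hΔs hθ.contDiffAt).continuousAt.eventually_ne hΔz
  refine ⟨F, ?_, ?_⟩
  · filter_upwards [hθ, hΔ] with y hy hΔy
    refine contDiffAt_pi.2 fun i => ?_
    have he : ContDiffAt ℝ ∞ (fun y => θ y (e6 (base i))) y := hy.clm_apply contDiffAt_const
    exact contDiffAt_div (((hs hy).2.mul (hconj he)).sub ((hconj (hs hy).1).mul he))
      (hΔs hy) hΔy
  · filter_upwards [hΔ] with y hΔy v
    have hΔc : (starRingEnd ℂ) (Δ y) = Δ y := by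
      simp only [Δ, map_sub, map_mul, Complex.conj_conj]; ring
    have hfr (i) : θ y (frame (F y) i) = 0 := by
      have h1 : frame (F y) i = e6 (base i) + ((F y i).re • e6 4 + (F y i).im • e6 5) := by
        rw [frame, add_assoc]
      rw [h1, map_add, apply_vertical]
      simp only [F, map_div₀, hΔc, map_sub, map_mul, Complex.conj_conj]
      field_simp
      simp only [Δ]
      ring
    rw [apply_eq_coef_graphForm hfr]
    constructor
    · intro h0
      have h2 := congrArg (starRingEnd ℂ) h0
      simp only [map_add, map_mul, Complex.conj_conj, map_zero] at h2
      refine (mul_eq_zero.1 ?_).resolve_left hΔy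
      simp only [Δ]
      linear_combination (starRingEnd ℂ) (coefZ (θ y)) * h0 - coefZbar (θ y) * h2
    · intro h0
      simp [h0]

/-! ### Smooth dependence on parameters -/

section Parameters

variable {S : Type*} [NormedAddCommGroup S] [NormedSpace ℝ S]

lemma contDiffAt_partial_fderiv {V W : Type*} [NormedAddCommGroup V] [NormedSpace ℝ V]
    [NormedAddCommGroup W] [NormedSpace ℝ W] {f : S × V → W} {z : S × V}
    (hf : ContDiffAt ℝ ∞ f z) :
    ContDiffAt ℝ ∞ (fun z : S × V => fderiv ℝ (fun y => f (z.1, y)) z.2) z := by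
  have h1 : ContDiffAt ℝ ∞ (Function.uncurry fun (z : S × V) (y : V) => f (z.1, y)) (z, z.2) := by
    have h2 : ContDiffAt ℝ ∞ (fun w : (S × V) × V => (w.1.1, w.2)) (z, z.2) := by fun_prop
    exact ContDiffAt.comp (g := f) (z, z.2) hf h2
  exact ContDiffAt.fderiv h1 contDiffAt_snd (by simp)

lemma contDiffAt_iteratedDeriv_param {W : Type*} [NormedAddCommGroup W] [NormedSpace ℝ W]
    {g : S × ℝ → W} {z : S × ℝ} (hg : ContDiffAt ℝ ∞ g z) (k : ℕ) :
    ContDiffAt ℝ ∞ (fun z : S × ℝ => iteratedDeriv k (fun t => g (z.1, t)) z.2) z := by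
  induction k with
  | zero => simpa using hg
  | succ k ih =>
    simp only [iteratedDeriv_succ]
    have h := contDiffAt_partial_fderiv ih
    exact h.clm_apply contDiffAt_const

lemma contDiff_frame (i : Fin 4) : ContDiff ℝ ∞ fun f : Fin 4 → ℂ => frame f i := by
  have h : ContDiff ℝ ∞ fun f : Fin 4 → ℂ => f i := contDiff_apply ℝ ℂ i
  exact (contDiff_const.add ((Complex.reCLM.contDiff.comp h).smul contDiff_const)).add
    ((Complex.imCLM.contDiff.comp h).smul contDiff_const)

variable {F : S × E6 → Fin 4 → ℂ} {z : S × E6}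

lemma contDiffAt_curv (hF : ContDiffAt ℝ ∞ F z) (i j : Fin 4) :
    ContDiffAt ℝ ∞ (fun z : S × E6 => curv (fun y => F (z.1, y)) z.2 i j) z := by
  have h1 (k l : Fin 4) : ContDiffAt ℝ ∞
      (fun z : S × E6 => fderiv ℝ (fun y => F (z.1, y)) z.2 (frame (F z) k) l) z :=
    contDiffAt_pi.1 ((contDiffAt_partial_fderiv hF).clm_apply
      ((contDiff_frame k).contDiffAt.comp z hF)) l
  exact (h1 i j).sub (h1 j i)

lemma contDiffAt_conj {P : Type*} [NormedAddCommGroup P] [NormedSpace ℝ P] {f : P → ℂ} {z : P}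
    (hf : ContDiffAt ℝ ∞ f z) : ContDiffAt ℝ ∞ (fun y => (starRingEnd ℂ) (f y)) z :=
  contDiff_conj.contDiffAt.comp z hf

lemma IsElliptic.eventually {P : Type*} [TopologicalSpace P] {c : P → Fin 4 → Fin 4 → ℂ} {z : P}
    (hc : ∀ i j, ContinuousAt (fun y => c y i j) z)
    (h : IsElliptic (c z)) : ∀ᶠ y in 𝓝 z, IsElliptic (c y) := by
  have h1 : ContinuousAt (fun y => pf (c y)) z :=
    (((hc 0 1).mul (hc 2 3)).sub ((hc 0 2).mul (hc 1 3))).add ((hc 0 3).mul (hc 1 2))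
  have hd (i j) : ContinuousAt (fun y => (starRingEnd ℂ) (c y i j)) z :=
    Complex.continuous_conj.continuousAt.comp (hc i j)
  have h2 : ContinuousAt (fun y => mixedPf (c y)) z :=
    continuousAt_const.mul (Complex.continuous_re.continuousAt.comp
      ((((hc 0 1).mul (hd 2 3)).sub ((hc 0 2).mul (hd 1 3))).add ((hc 0 3).mul (hd 1 2))))
  have h3 : ContinuousAt (fun y => 4 * Complex.normSq (pf (c y))) z :=
    continuousAt_const.mul (Complex.continuous_normSq.continuousAt.comp h1)
  exact (h2.eventually_const_lt h.1).and (h3.eventually_lt (h2.pow 2) h.2)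

section Pencil

variable {P : Type*} [NormedAddCommGroup P] [NormedSpace ℝ P] {c : P → Fin 4 → Fin 4 → ℂ} {z : P}

lemma contDiffAt_pf (hc : ∀ i j, ContDiffAt ℝ ∞ (fun y => c y i j) z) :
    ContDiffAt ℝ ∞ (fun y => pf (c y)) z :=
  (((hc 0 1).mul (hc 2 3)).sub ((hc 0 2).mul (hc 1 3))).add ((hc 0 3).mul (hc 1 2))

lemma contDiffAt_mixedPf (hc : ∀ i j, ContDiffAt ℝ ∞ (fun y => c y i j) z) :
    ContDiffAt ℝ ∞ (fun y => mixedPf (c y)) z := by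
  have hd := fun i j => contDiffAt_conj (hc i j)
  have h := (((hc 0 1).mul (hd 2 3)).sub ((hc 0 2).mul (hd 1 3))).add ((hc 0 3).mul (hd 1 2))
  exact contDiffAt_const.mul (Complex.reCLM.contDiff.contDiffAt.comp z h)

lemma contDiffAt_normSq_pf (hc : ∀ i j, ContDiffAt ℝ ∞ (fun y => c y i j) z) :
    ContDiffAt ℝ ∞ (fun y => Complex.normSq (pf (c y))) z := by
  have h := contDiffAt_pf hc
  have h2 : ContDiffAt ℝ ∞ (fun y => (pf (c y) * (starRingEnd ℂ) (pf (c y))).re) z :=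
    Complex.reCLM.contDiff.contDiffAt.comp z (h.mul (contDiffAt_conj h))
  simpa [Complex.mul_conj] using h2

lemma contDiffAt_beltrami (hc : ∀ i j, ContDiffAt ℝ ∞ (fun y => c y i j) z)
    (h : IsElliptic (c z)) : ContDiffAt ℝ ∞ (fun y => beltrami (c y)) z := by
  have h1 := contDiffAt_mixedPf hc
  have hpos : 0 < mixedPf (c z) ^ 2 - 4 * Complex.normSq (pf (c z)) := by linarith [h.2]
  have h2 : ContDiffAt ℝ ∞
      (fun y => √(mixedPf (c y) ^ 2 - 4 * Complex.normSq (pf (c y)))) z :=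
    ((h1.pow 2).sub (contDiffAt_const.mul (contDiffAt_normSq_pf hc))).sqrt hpos.ne'
  have h3 : ContDiffAt ℝ ∞ (fun y => ((mixedPf (c y) +
      √(mixedPf (c y) ^ 2 - 4 * Complex.normSq (pf (c y))) : ℝ) : ℂ)) z :=
    Complex.ofRealCLM.contDiff.contDiffAt.comp z (h1.add h2)
  refine contDiffAt_div (contDiffAt_const.mul (contDiffAt_pf hc)) h3 ?_
  have := Real.sqrt_nonneg (mixedPf (c z) ^ 2 - 4 * Complex.normSq (pf (c z)))
  have h4 := h.1
  exact_mod_cast (by linarith : mixedPf (c z) +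
      √(mixedPf (c z) ^ 2 - 4 * Complex.normSq (pf (c z))) ≠ 0)

end Pencil

/-! ### The normalized obstruction and its smooth dependence on parameters -/

/-- The Beltrami coefficient of a graph distribution. -/
noncomputable def beltramiOf (F : E6 → Fin 4 → ℂ) (x : E6) : ℂ := beltrami (curv F x)

/-- The normalized integrability obstruction of a graph distribution. -/
noncomputable def torsion (F : E6 → Fin 4 → ℂ) (x : E6) : ℂ :=
  obstruction F (beltramiOf F) x / (-4 * curvB F (beltramiOf F x) x 1 2)

/-- The condition on the one-jet under which the torsion is a smooth function of the two-jet. -/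
def IsRegular (F : E6 → Fin 4 → ℂ) (x : E6) : Prop :=
  IsElliptic (curv F x) ∧ curvB F (beltramiOf F x) x 1 2 ≠ 0

lemma contDiffAt_beltramiOf (hF : ContDiffAt ℝ ∞ F z)
    (h : IsElliptic (curv (fun y => F (z.1, y)) z.2)) :
    ContDiffAt ℝ ∞ (fun z : S × E6 => beltramiOf (fun y => F (z.1, y)) z.2) z :=
  contDiffAt_beltrami (contDiffAt_curv hF) h

lemma contDiffAt_curvB (hF : ContDiffAt ℝ ∞ F z)
    (h : IsElliptic (curv (fun y => F (z.1, y)) z.2)) (i j : Fin 4) :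
    ContDiffAt ℝ ∞ (fun z : S × E6 => curvB (fun y => F (z.1, y))
      (beltramiOf (fun y => F (z.1, y)) z.2) z.2 i j) z :=
  (contDiffAt_curv hF i j).add ((contDiffAt_beltramiOf hF h).mul
    (contDiffAt_conj (contDiffAt_curv hF i j)))

lemma contDiffAt_torsion (hF : ContDiffAt ℝ ∞ F z)
    (h : IsRegular (fun y => F (z.1, y)) z.2) :
    ContDiffAt ℝ ∞ (fun z : S × E6 => torsion (fun y => F (z.1, y)) z.2) z := by
  have hμ := contDiffAt_beltramiOf hF h.1
  have hc := contDiffAt_curvB hF h.1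
  have hfr (i) : ContDiffAt ℝ ∞ (fun z => frame (F z) i) z :=
    (contDiff_frame i).contDiffAt.comp z hF
  have hdF (e : E6) (i : Fin 4) : ContDiffAt ℝ ∞
      (fun z : S × E6 => fderiv ℝ (fun y => F (z.1, y)) z.2 e i) z :=
    contDiffAt_pi.1 ((contDiffAt_partial_fderiv hF).clm_apply contDiffAt_const) i
  have hdFc := fun e i => contDiffAt_conj (hdF e i)
  have hdμ (i : Fin 4) : ContDiffAt ℝ ∞ (fun z : S × E6 =>
      fderiv ℝ (fun x => beltramiOf (fun y => F (z.1, y)) x) z.2 (frame (F z) i)) z :=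
    (contDiffAt_partial_fderiv hμ).clm_apply (hfr i)
  have hker (i : Fin 4) : ContDiffAt ℝ ∞ (fun z : S × E6 => kerVec (curvB (fun y => F (z.1, y))
      (beltramiOf (fun y => F (z.1, y)) z.2) z.2) i) z := by
    fin_cases i
    · exact hc 1 2
    · exact (hc 0 2).neg
    · exact hc 0 1
    · exact contDiffAt_const
  refine contDiffAt_div ?_ (contDiffAt_const.mul (hc 1 2))
    (mul_ne_zero (by norm_num) h.2)
  refine ContDiffAt.sum fun i _ => (hker i).mul ?_
  exact ((contDiffAt_const.mul (hdμ i)).add ((contDiffAt_const.sub hμ).mul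
    ((hdF _ i).add (hμ.mul (hdFc _ i))))).add
    ((contDiffAt_const.mul (contDiffAt_const.add hμ)).mul ((hdF _ i).add (hμ.mul (hdFc _ i))))

lemma IsRegular.eventually (hF : ContDiffAt ℝ ∞ F z)
    (h : IsRegular (fun y => F (z.1, y)) z.2) :
    ∀ᶠ z in 𝓝 z, IsRegular (fun y => F (z.1, y)) z.2 :=
  (IsElliptic.eventually (fun i j => (contDiffAt_curv hF i j).continuousAt) h.1).and
    ((contDiffAt_curvB hF h.1 1 2).continuousAt.eventually_ne h.2)

end Parameters

/-- This is the parametrized statement with a dummy real parameter. -/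
lemma continuousAt_curv {F : E6 → Fin 4 → ℂ} {x : E6} (hF : ContDiffAt ℝ ∞ F x) (i j : Fin 4) :
    ContinuousAt (fun x => curv F x i j) x := by
  have h1 : ContDiffAt ℝ ∞ (fun z : ℝ × E6 => F z.2) (0, x) :=
    ContDiffAt.comp (0, x) hF contDiffAt_snd
  have h2 := (contDiffAt_curv h1 i j).continuousAt
  exact ContinuousAt.comp (g := fun z : ℝ × E6 => curv (fun y => F y) z.2 i j)
    (f := fun x : E6 => ((0 : ℝ), x)) h2 (by fun_prop)

/-! ### Dependence on the germ -/

lemma curv_congr {F F' : E6 → Fin 4 → ℂ} {x : E6} (h : F =ᶠ[𝓝 x] F') : curv F x = curv F' x := by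
  ext i j
  simp only [curv, h.fderiv_eq, h.self_of_nhds]

lemma torsion_congr {F F' : E6 → Fin 4 → ℂ} {x : E6} (h : F =ᶠ[𝓝 x] F') :
    torsion F x = torsion F' x := by
  have h1 : beltramiOf F =ᶠ[𝓝 x] beltramiOf F' :=
    h.eventuallyEq_nhds.mono fun y hy => by simp only [beltramiOf, curv_congr hy]
  have h2 (m : ℂ) : curvB F m x = curvB F' m x := by
    ext i j
    simp only [curvB, curv_congr h]
  simp only [torsion, obstruction, h2, h.fderiv_eq, h1.fderiv_eq, h.self_of_nhds,
    h1.self_of_nhds]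

lemma isRegular_congr {F F' : E6 → Fin 4 → ℂ} {x : E6} (h : F =ᶠ[𝓝 x] F') :
    IsRegular F x ↔ IsRegular F' x := by
  simp only [IsRegular, curvB, beltramiOf, curv_congr h]

/-! ### The invariant of germs and its vanishing on complex-contact germs -/

/-- The first derivatives of the torsion at the origin, along a line. -/
noncomputable def torsionJet (n : ℕ) (F : E6 → Fin 4 → ℂ) : EuclideanSpace ℝ (Fin n) :=
  WithLp.toLp 2 fun k => (iteratedDeriv k (fun t : ℝ => torsion F (t • e6 0)) 0).re

lemma tendsto_smul_e6 (k : Fin 6) : Tendsto (fun t : ℝ => t • e6 k) (𝓝 0) (𝓝 0) := by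
  have : Continuous fun t : ℝ => t • e6 k := by fun_prop
  simpa using this.tendsto 0

lemma torsionJet_congr {n : ℕ} {F F' : E6 → Fin 4 → ℂ} (h : F =ᶠ[𝓝 0] F') :
    torsionJet n F = torsionJet n F' := by
  have h1 : (fun t : ℝ => torsion F (t • e6 0)) =ᶠ[𝓝 0] fun t : ℝ => torsion F' (t • e6 0) :=
    (tendsto_smul_e6 0).eventually (h.eventuallyEq_nhds.mono fun y hy => torsion_congr hy)
  unfold torsionJet
  simp only [h1.iteratedDeriv_eq]

open Classical in
/-- The coefficients of a subspace as a graph. -/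
noncomputable def subspaceCoef (K : Submodule ℝ E6) : Fin 4 → ℂ :=
  if h : ∃ f, ∀ v, v ∈ K ↔ graphForm f v = 0 then h.choose else 0

/-- The coefficients of a field of subspaces as a graph. -/
noncomputable def graphCoef (D : E6 → Submodule ℝ E6) (x : E6) : Fin 4 → ℂ :=
  subspaceCoef (D x)

lemma graphForm_ker_injective {f g : Fin 4 → ℂ}
    (h : ∀ v, graphForm f v = 0 ↔ graphForm g v = 0) : f = g := by
  ext i
  have h1 := (h _).1 (graphForm_frame f i)
  have h2 : frame f i = frame g i + ((f i - g i).re • e6 4 + (f i - g i).im • e6 5) := by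
    simp only [frame, Complex.sub_re, Complex.sub_im]
    module
  rw [h2, map_add, graphForm_frame, graphForm_vertical, zero_add, sub_eq_zero] at h1
  exact h1

lemma graphCoef_eq {D : E6 → Submodule ℝ E6} {x : E6} {f : Fin 4 → ℂ}
    (h : ∀ v, v ∈ D x ↔ graphForm f v = 0) : graphCoef D x = f := by
  have h' : ∃ f, ∀ v, v ∈ D x ↔ graphForm f v = 0 := ⟨f, h⟩
  rw [graphCoef, subspaceCoef, dif_pos h']
  refine graphForm_ker_injective fun v => ?_
  rw [← h'.choose_spec v, h]

lemma graphCoef_congr {D D' : E6 → Submodule ℝ E6} {x : E6} (h : D x = D' x) :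
    graphCoef D x = graphCoef D' x := by
  simp only [graphCoef, h]

/-- The germ of `D` at the origin is a graph with regular coefficients. -/
def IsRegularGerm (D : E6 → Submodule ℝ E6) : Prop :=
  (∃ f, ∀ v, v ∈ D 0 ↔ graphForm f v = 0) ∧ IsRegular (graphCoef D) 0

lemma isRegularGerm_congr {D D' : E6 → Submodule ℝ E6} (h : D =ᶠ[𝓝 0] D') :
    IsRegularGerm D ↔ IsRegularGerm D' := by
  have h1 : graphCoef D =ᶠ[𝓝 0] graphCoef D' := h.mono fun x hx => graphCoef_congr hx
  simp only [IsRegularGerm, h.self_of_nhds, isRegular_congr h1]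

open Classical in
/-- A function of germs of distributions that vanishes on complex-contact germs. -/
noncomputable def germInvariant (n : ℕ) (D : E6 → Submodule ℝ E6) : EuclideanSpace ℝ (Fin n) :=
  if IsRegularGerm D then torsionJet n (graphCoef D) else 0

lemma germInvariant_congr {n : ℕ} {D D' : E6 → Submodule ℝ E6} (h : D =ᶠ[𝓝 0] D') :
    germInvariant n D = germInvariant n D' := by
  have h1 : graphCoef D =ᶠ[𝓝 0] graphCoef D' := h.mono fun x hx => graphCoef_congr hx
  by_cases hD : IsRegularGerm D
  · rw [germInvariant, if_pos hD, germInvariant, if_pos ((isRegularGerm_congr h).1 hD),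
      torsionJet_congr h1]
  · rw [germInvariant, if_neg hD, germInvariant, if_neg (mt (isRegularGerm_congr h).2 hD)]

/-- The invariant vanishes on complex-contact germs. -/
lemma SupportsComplexContact.germInvariant_eq_zero {D : E6 → Submodule ℝ E6}
    (hD : SupportsComplexContact D 0) (n : ℕ) : germInvariant n D = 0 := by
  -- Off the regular germs the invariant is zero by convention, so only regular germs need an
  -- argument.
  by_cases hreg : IsRegularGerm D
  swap
  · simp [germInvariant, hreg]
  rw [germInvariant, if_pos hreg]
  obtain ⟨Θ, hΘ, hΘD⟩ := hD.exists_isContactJet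
  obtain ⟨f, hf⟩ := hreg.1
  obtain ⟨F, hF, hFΘ⟩ := exists_smooth_graph hΘ
    ⟨f, fun v => by rw [← hΘD.self_of_nhds.1, hf]⟩
  have hgraph : ∀ᶠ x in 𝓝 0, ∀ v, v ∈ D x ↔ graphForm (F x) v = 0 := by
    filter_upwards [hΘD, hFΘ] with x h1 h2 v
    rw [h1.1, h2]
  have hcoef : graphCoef D =ᶠ[𝓝 0] F := hgraph.mono fun x hx => graphCoef_eq hx
  rw [torsionJet_congr hcoef]
  have hreg0 := (isRegular_congr hcoef).1 hreg.2
  obtain ⟨μ, hμ, hμ1, hob⟩ := hD.exists_beltrami hF hgraph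
  have hell := IsElliptic.eventually (continuousAt_curv hF.contDiffAt) hreg0.1
  -- The bound |μ| ≤ 1 is available only at the origin. There uniqueness of the root improves it to
  -- a strict bound, which persists nearby, so that uniqueness applies on a neighbourhood and the
  -- derivatives agree too.
  have hμ0 : μ 0 = beltramiOf F 0 := hreg0.1.eq_beltrami hμ1 hob.self_of_nhds.1
  have hlt : ∀ᶠ x in 𝓝 0, ‖μ x‖ < 1 := by
    refine hμ.contDiffAt.continuousAt.norm.eventually_lt_const ?_
    beta_reduce
    rw [hμ0]
    exact hreg0.1.norm_beltrami_lt
  have hμF : μ =ᶠ[𝓝 0] beltramiOf F := by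
    filter_upwards [hell, hlt, hob] with x h1 h2 h3
    exact h1.eq_beltrami h2.le h3.1
  have hT : ∀ᶠ x in 𝓝 0, torsion F x = 0 := by
    filter_upwards [hob, hμF.eventually_nhds] with x h1 h2
    have h3 : μ =ᶠ[𝓝 x] beltramiOf F := h2
    have h4 : obstruction F (beltramiOf F) x = obstruction F μ x := by
      simp only [obstruction, h3.fderiv_eq, h3.self_of_nhds]
    rw [torsion, h4, h1.2, zero_div]
  have hT' : (fun t : ℝ => torsion F (t • e6 0)) =ᶠ[𝓝 0] fun _ => 0 :=
    (tendsto_smul_e6 0).eventually hT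
  ext k
  simp [torsionJet, hT'.iteratedDeriv_eq]

/-- The invariant is smooth along smooth families through a regular germ. -/
lemma smoothNear_germInvariant {S : Type*} [NormedAddCommGroup S] [NormedSpace ℝ S]
    {D : S → E6 → Submodule ℝ E6} {θ : S × E6 → E6 →L[ℝ] ℂ} (hθ : SmoothNear θ (0, 0))
    (hD : ∀ᶠ z in 𝓝 ((0 : S), (0 : E6)), ∀ v, v ∈ D z.1 z.2 ↔ θ z v = 0)
    (hreg : IsRegularGerm (D 0)) (n : ℕ) : SmoothNear (fun s => germInvariant n (D s)) 0 := by
  obtain ⟨f, hf⟩ := hreg.1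
  obtain ⟨F, hF, hFθ⟩ := exists_smooth_graph hθ
    ⟨f, fun v => by rw [← hf, ← hD.self_of_nhds v]⟩
  have hgraph : ∀ᶠ z in 𝓝 ((0 : S), (0 : E6)), ∀ v, v ∈ D z.1 z.2 ↔ graphForm (F z) v = 0 := by
    filter_upwards [hD, hFθ] with x h1 h2 v
    rw [h1, h2]
  have hcoef : ∀ᶠ s in 𝓝 (0 : S), graphCoef (D s) =ᶠ[𝓝 0] fun x => F (s, x) := by
    rw [nhds_prod_eq] at hgraph
    filter_upwards [hgraph.curry] with s hs
    exact hs.mono fun x hx => graphCoef_eq hx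
  have hreg0 : IsRegular (fun x => F ((0 : S), x)) 0 :=
    (isRegular_congr hcoef.self_of_nhds).1 hreg.2
  have hslice : Tendsto (fun s : S => (s, (0 : E6))) (𝓝 0) (𝓝 (0, 0)) := by
    have : Continuous fun s : S => (s, (0 : E6)) := by fun_prop
    exact this.tendsto 0
  have hregs : ∀ᶠ s in 𝓝 (0 : S), IsRegular (fun x => F (s, x)) 0 :=
    hslice.eventually (IsRegular.eventually (z := ((0 : S), (0 : E6))) hF.contDiffAt hreg0)
  -- Regularity is an open condition, so the default value of the invariant is not taken for small
  -- parameters.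
  have heq : (fun s => germInvariant n (D s)) =ᶠ[𝓝 0] fun s => torsionJet n fun x => F (s, x) := by
    filter_upwards [hcoef, hregs, hslice.eventually hgraph] with s h1 h2 h3
    rw [germInvariant, if_pos ⟨⟨_, h3⟩, (isRegular_congr h1).2 h2⟩, torsionJet_congr h1]
  refine SmoothNear.congr ?_ heq
  filter_upwards [hslice.eventually hF, hregs] with s h1 h2
  have h3 : ContDiffAt ℝ ∞ (fun z : S × E6 => torsion (fun y => F (z.1, y)) z.2) (s, 0) :=
    contDiffAt_torsion h1 h2
  have h4 : ContDiffAt ℝ ∞ (fun z : S × ℝ => torsion (fun y => F (z.1, y)) (z.2 • e6 0))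
      (s, 0) := by
    refine ContDiffAt.comp (g := fun z : S × E6 => torsion (fun y => F (z.1, y)) z.2)
      (f := fun z : S × ℝ => (z.1, z.2 • e6 0)) (s, 0) ?_ (by fun_prop)
    simpa using h3
  refine (contDiffAt_euclidean).2 fun k => ?_
  have h5 := contDiffAt_iteratedDeriv_param h4 (k : ℕ)
  have h6 : ContDiffAt ℝ ∞ (fun s : S =>
      iteratedDeriv k (fun t : ℝ => torsion (fun y => F (s, y)) (t • e6 0)) 0) s :=
    ContDiffAt.comp (f := fun s : S => (s, (0 : ℝ))) s h5 (by fun_prop)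
  exact Complex.reCLM.contDiff.contDiffAt.comp s h6

/-! ### Fatness and Reeb directions of graph distributions -/

lemma hasFDerivAt_graphForm {F : E6 → Fin 4 → ℂ} {x : E6} (hF : DifferentiableAt ℝ F x) :
    ∃ G : E6 →L[ℝ] E6 →L[ℝ] ℂ, HasFDerivAt (fun y => graphForm (F y)) G x ∧
      ∀ u v, G u v = - ∑ i, fderiv ℝ F x u i * v (base i) := by
  have h1 (i : Fin 4) : HasFDerivAt (fun y => F y i)
      ((ContinuousLinearMap.proj i).comp (fderiv ℝ F x)) x :=
    (hasFDerivAt_pi'.1 hF.hasFDerivAt) i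
  have h2 := HasFDerivAt.fun_sum (u := Finset.univ) fun i _ =>
    (h1 i).smul_const (Complex.ofRealCLM.comp (dcoord (base i)))
  have h3 : HasFDerivAt (fun y => graphForm (F y)) _ x := h2.const_sub (cc 4 5)
  refine ⟨_, h3, fun u v => ?_⟩
  simp [dcoord]

lemma contDiff_graphForm : ContDiff ℝ ∞ graphForm := by
  have h (i : Fin 4) : ContDiff ℝ ∞ fun f : Fin 4 → ℂ => f i := contDiff_apply ℝ ℂ i
  exact contDiff_const.sub (ContDiff.sum fun i _ => (h i).smul contDiff_const)

/-- The real and imaginary part of the form that defines a graph distribution. -/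
noncomputable def graphForms (F : E6 → Fin 4 → ℂ) : Fin 2 → E6 → E6 →L[ℝ] ℝ :=
  ![fun x => Complex.reCLM.comp (graphForm (F x)), fun x => Complex.imCLM.comp (graphForm (F x))]

lemma graphForms_zero_apply (F : E6 → Fin 4 → ℂ) (x v : E6) :
    graphForms F 0 x v = (graphForm (F x) v).re := rfl

lemma graphForms_one_apply (F : E6 → Fin 4 → ℂ) (x v : E6) :
    graphForms F 1 x v = (graphForm (F x) v).im := rfl

lemma extD_comp_graphForm (g : ℂ →L[ℝ] ℝ) {F : E6 → Fin 4 → ℂ} {x : E6}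
    (hF : DifferentiableAt ℝ F x) (u v : E6) :
    extD (fun x => g.comp (graphForm (F x))) x u v
      = g (- ∑ i, (fderiv ℝ F x u i * v (base i) - fderiv ℝ F x v i * u (base i))) := by
  obtain ⟨G, hG, hG'⟩ := hasFDerivAt_graphForm hF
  have h1 : HasFDerivAt (fun x => g.comp (graphForm (F x)))
      ((ContinuousLinearMap.compL ℝ E6 ℂ ℝ g).comp G) x :=
    (ContinuousLinearMap.compL ℝ E6 ℂ ℝ g).hasFDerivAt.comp x hG
  rw [extD, h1.fderiv]
  change g (G u v) - g (G v u) = _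
  rw [← map_sub, hG', hG', Finset.sum_sub_distrib]
  congr 1
  ring

lemma isDefinedBy_graphForms {D : E6 → Submodule ℝ E6} {F : E6 → Fin 4 → ℂ} {p : E6}
    (hF : SmoothNear F p) (hD : ∀ᶠ x in 𝓝 p, ∀ v, v ∈ D x ↔ graphForm (F x) v = 0) :
    IsDefinedBy D (graphForms F) p := by
  refine ⟨fun i => ?_, ?_, ?_⟩
  · have h (g : ℂ →L[ℝ] ℝ) : SmoothNear (fun x => g.comp (graphForm (F x))) p :=
      hF.mono fun x hx => (ContinuousLinearMap.compL ℝ E6 ℂ ℝ g).contDiff.contDiffAt.comp x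
        (contDiff_graphForm.contDiffAt.comp x hx)
    fin_cases i
    · exact h _
    · exact h _
  · have hpair : (fun i => graphForms F i p) = ![graphForms F 0 p, graphForms F 1 p] := by
      ext i : 1
      fin_cases i <;> rfl
    rw [hpair, LinearIndependent.pair_iff]
    intro s t hst
    have h4 := congrArg (fun f : E6 →L[ℝ] ℝ => f ((1 : ℂ).re • e6 4 + (1 : ℂ).im • e6 5)) hst
    have h5 := congrArg
      (fun f : E6 →L[ℝ] ℝ => f (Complex.I.re • e6 4 + Complex.I.im • e6 5)) hst
    simp only [add_apply, smul_apply, graphForms_zero_apply, graphForms_one_apply,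
      graphForm_vertical] at h4 h5
    simpa using And.intro h4 h5
  · filter_upwards [hD] with x hx v
    rw [hx, Complex.ext_iff, Fin.forall_fin_two, graphForms_zero_apply, graphForms_one_apply]
    rfl

lemma frame_base (f : Fin 4 → ℂ) (i j : Fin 4) : frame f i (base j) = if j = i then 1 else 0 := by
  fin_cases i <;> fin_cases j <;> simp [frame, base]

lemma extD_graphForm_frame (g : ℂ →L[ℝ] ℝ) {F : E6 → Fin 4 → ℂ} {x : E6}
    (hF : DifferentiableAt ℝ F x) (i j : Fin 4) :
    extD (fun x => g.comp (graphForm (F x))) x (frame (F x) i) (frame (F x) j)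
      = g (- curv F x i j) := by
  rw [extD_comp_graphForm g hF]
  congr 1
  simp only [frame_base, curv, Finset.sum_sub_distrib]
  fin_cases i <;> fin_cases j <;> simp [Fin.sum_univ_four]

/-- Graph distributions with elliptic curvature are fat. -/
lemma isFat_of_isElliptic {D : E6 → Submodule ℝ E6} {F : E6 → Fin 4 → ℂ} {p : E6}
    (hF : SmoothNear F p) (hD : ∀ᶠ x in 𝓝 p, ∀ v, v ∈ D x ↔ graphForm (F x) v = 0)
    (hell : ∀ᶠ x in 𝓝 p, IsElliptic (curv F x)) : IsFat D p := by
  refine ⟨graphForms F, isDefinedBy_graphForms hF hD, ?_⟩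
  filter_upwards [hF, hD, hell] with x h1 h2 h3
  refine ⟨frame (F x), fun i => (h2 _).2 (graphForm_frame _ _), fun a b hab => ?_⟩
  have hd := h1.differentiableAt (n := ∞) (by simp)
  have e0 (i j) : extD (graphForms F 0) x (frame (F x) i) (frame (F x) j)
      = - (curv F x i j).re := by
    rw [← Complex.neg_re]
    exact extD_graphForm_frame Complex.reCLM hd i j
  have e1 (i j) : extD (graphForms F 1) x (frame (F x) i) (frame (F x) j)
      = - (curv F x i j).im := by
    rw [← Complex.neg_im]
    exact extD_graphForm_frame Complex.imCLM hd i j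
  simp only [wedgeSq, e0, e1]
  set c := curv F x
  have hlt := h3.two_norm_lt
  have hN : 0 < a ^ 2 + b ^ 2 := by
    rcases eq_or_ne a 0 with rfl | ha
    · have hb : b ≠ 0 := by rintro rfl; exact hab rfl
      positivity
    · positivity
  -- With λ = a − ib the form in question is −Re(λc) on the frame, and its wedge square is |λ|²
  -- `mixedPf c` / 2 + Re(λ² `pf c`). Ellipticity makes the first term dominate.
  have hre : -((a ^ 2 + b ^ 2) * ‖pf c‖) ≤ (a ^ 2 - b ^ 2) * (pf c).re + 2 * a * b * (pf c).im := by
    have h4 := Complex.abs_re_le_norm ((⟨a, -b⟩ : ℂ) ^ 2 * pf c)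
    have h5 : ‖(⟨a, -b⟩ : ℂ)‖ ^ 2 = a ^ 2 + b ^ 2 := by
      rw [← Complex.normSq_eq_norm_sq, Complex.normSq_mk]; ring
    rw [norm_mul, norm_pow, h5] at h4
    have h6 : ((⟨a, -b⟩ : ℂ) ^ 2 * pf c).re
        = (a ^ 2 - b ^ 2) * (pf c).re + 2 * a * b * (pf c).im := by
      simp [pow_two, Complex.mul_re, Complex.mul_im]
      ring
    rw [← h6]
    exact (abs_le.1 h4).1
  have hP : mixedPf c = 2 * ((c 0 1).re * (c 2 3).re + (c 0 1).im * (c 2 3).im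
      - ((c 0 2).re * (c 1 3).re + (c 0 2).im * (c 1 3).im)
      + ((c 0 3).re * (c 1 2).re + (c 0 3).im * (c 1 2).im)) := by
    simp [mixedPf, Complex.mul_re]
  have hAre : (pf c).re = (c 0 1).re * (c 2 3).re - (c 0 1).im * (c 2 3).im
      - ((c 0 2).re * (c 1 3).re - (c 0 2).im * (c 1 3).im)
      + ((c 0 3).re * (c 1 2).re - (c 0 3).im * (c 1 2).im) := by
    simp [pf, Complex.mul_re]
  have hAim : (pf c).im = (c 0 1).re * (c 2 3).im + (c 0 1).im * (c 2 3).re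
      - ((c 0 2).re * (c 1 3).im + (c 0 2).im * (c 1 3).re)
      + ((c 0 3).re * (c 1 2).im + (c 0 3).im * (c 1 2).re) := by
    simp [pf, Complex.mul_im]
  have hfinal : 0 < (a ^ 2 + b ^ 2) * mixedPf c / 2
      + ((a ^ 2 - b ^ 2) * (pf c).re + 2 * a * b * (pf c).im) := by
    have := mul_lt_mul_of_pos_left hlt hN
    linarith
  refine lt_of_lt_of_eq hfinal ?_
  rw [hP, hAre, hAim]
  ring

/-- The vertical fields are Reeb directions of an invariant graph distribution. -/
lemma areReebDirections_dz {D : E6 → Submodule ℝ E6} {F : E6 → Fin 4 → ℂ} {p : E6}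
    (hF : SmoothNear F p) (hD : ∀ᶠ x in 𝓝 p, ∀ v, v ∈ D x ↔ graphForm (F x) v = 0)
    (h4 : ∀ᶠ x in 𝓝 p, fderiv ℝ F x (e6 4) = 0) (h5 : ∀ᶠ x in 𝓝 p, fderiv ℝ F x (e6 5) = 0) :
    AreReebDirections D dz p := by
  have hdz (x : E6) : (fun i => dz i x) = ![e6 4, e6 5] := by
    ext i : 1
    fin_cases i <;> rfl
  have hdz0 (x : E6) : dz 0 x = e6 4 := rfl
  have hdz1 (x : E6) : dz 1 x = e6 5 := rfl
  have hg4 (f) : graphForm f (e6 4) = 1 := graphForm_e4 f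
  have hg5 (f) : graphForm f (e6 5) = Complex.I := by
    simpa using graphForm_vertical f Complex.I
  refine ⟨fun i => ?_, graphForms F, isDefinedBy_graphForms hF hD, ?_⟩
  · fin_cases i
    · exact .of_contDiff contDiff_const p
    · exact .of_contDiff contDiff_const p
  filter_upwards [hF, hD, h4, h5] with x h1 h2 h4 h5
  have hd := h1.differentiableAt (n := ∞) (by simp)
  refine ⟨?_, ?_, ?_, ?_⟩
  · rw [hdz, Matrix.range_cons, Matrix.range_cons, Matrix.range_empty, union_empty,
      singleton_union]
    constructor
    · rw [Submodule.disjoint_def]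
      intro v hv hv'
      obtain ⟨s, t, rfl⟩ := Submodule.mem_span_pair.1 hv'
      rw [h2, show s • e6 4 + t • e6 5 = (⟨s, t⟩ : ℂ).re • e6 4 + (⟨s, t⟩ : ℂ).im • e6 5 from rfl,
        graphForm_vertical] at hv
      have hs : s = 0 := congrArg Complex.re hv
      have ht : t = 0 := congrArg Complex.im hv
      simp [hs, ht]
    · rw [codisjoint_iff, Submodule.eq_top_iff']
      intro v
      refine Submodule.mem_sup.2 ⟨v - ((graphForm (F x) v).re • e6 4
        + (graphForm (F x) v).im • e6 5), ?_, _, ?_, sub_add_cancel _ _⟩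
      · rw [h2, map_sub, graphForm_vertical, sub_self]
      · exact Submodule.mem_span_pair.2 ⟨_, _, rfl⟩
  · simp only [Fin.forall_fin_two, graphForms_zero_apply, graphForms_one_apply, hdz0, hdz1, hg4,
      hg5]
    simp
  · have key (g : ℂ →L[ℝ] ℝ) (k : Fin 6) (hk : fderiv ℝ F x (e6 k) = 0)
        (hk' : ∀ i, e6 k (base i) = 0) (v : E6) :
        extD (fun x => g.comp (graphForm (F x))) x (e6 k) v = 0 := by
      rw [extD_comp_graphForm g hd]
      simp only [hk, hk']
      simp
    have hb4 (i : Fin 4) : e6 4 (base i) = 0 := by fin_cases i <;> simp [base]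
    have hb5 (i : Fin 4) : e6 5 (base i) = 0 := by fin_cases i <;> simp [base]
    simp only [Fin.forall_fin_two, hdz0, hdz1]
    exact ⟨⟨fun v _ => key _ 4 h4 hb4 v, fun v _ => key _ 4 h4 hb4 v⟩,
      ⟨fun v _ => key _ 5 h5 hb5 v, fun v _ => key _ 5 h5 hb5 v⟩⟩
  · have e0 : dz 0 = fun _ => e6 4 := rfl
    have e1 : dz 1 = fun _ => e6 5 := rfl
    simp [VectorField.lieBracket_eq, e0, e1]

/-! ### The family `H_κ` -/

/-- The coefficients of `H_κ` as a graph distribution. -/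
noncomputable def coefH (κ : ℝ → ℝ) (x : E6) : Fin 4 → ℂ :=
  ![x 2 + Complex.I * x 3, x 3 + Complex.I * x 2,
    (((x 1) ^ 3 / 3 + x 1 + 2 * x 0 + κ (x 2) : ℝ) : ℂ), 0]

/-- The complex form α¹ + i α² is already a graph form. -/
lemma mem_H_iff (κ : ℝ → ℝ) (x v : E6) : v ∈ H κ x ↔ graphForm (coefH κ x) v = 0 := by
  have h1 : v ∈ H κ x ↔ alpha1 κ x v = 0 ∧ alpha2 x v = 0 := Iff.rfl
  rw [h1, graphForm_apply, Complex.ext_iff]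
  simp [alpha1, alpha2, dcoord, Fin.sum_univ_four, base, coefH, -Complex.ofReal_pow]
  constructor <;> rintro ⟨h2, h3⟩ <;> constructor <;> linarith

/-- The projection to a coordinate, complex-valued. -/
noncomputable def coordC (k : Fin 6) : E6 →L[ℝ] ℂ := Complex.ofRealCLM.comp (dcoord k)

lemma coordC_apply (k : Fin 6) (x : E6) : coordC k x = x k := rfl

lemma hasFDerivAt_coefH {κ : ℝ → ℝ} (hκ : ContDiff ℝ ∞ κ) (x : E6) :
    HasFDerivAt (coefH κ) (ContinuousLinearMap.pi ![coordC 2 + Complex.I • coordC 3,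
      coordC 3 + Complex.I • coordC 2,
      ((x 1 : ℂ) ^ 2 + 1) • coordC 1 + (2 : ℂ) • coordC 0 + ((deriv κ (x 2) : ℝ) : ℂ) • coordC 2,
      0]) x := by
  rw [hasFDerivAt_pi']
  intro i
  rw [ContinuousLinearMap.proj_pi]
  have hc (k : Fin 6) : HasFDerivAt (fun y : E6 => y k) (dcoord k) x := (dcoord k).hasFDerivAt
  have hC (k : Fin 6) : HasFDerivAt (fun y : E6 => ((y k : ℝ) : ℂ)) (coordC k) x :=
    (coordC k).hasFDerivAt
  fin_cases i
  · exact (hC 2).add ((hC 3).const_mul Complex.I)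
  · exact (hC 3).add ((hC 2).const_mul Complex.I)
  · have h1 : HasFDerivAt (fun y : E6 => κ (y 2)) (deriv κ (x 2) • dcoord 2) x :=
      ((hκ.differentiable (by simp)).differentiableAt.hasDerivAt).comp_hasFDerivAt x (hc 2)
    have h2 : HasFDerivAt (fun y : E6 => (y 1) ^ 3 / 3 + y 1 + 2 * y 0 + κ (y 2))
        (((x 1) ^ 2 + 1) • dcoord 1 + (2 : ℝ) • dcoord 0 + deriv κ (x 2) • dcoord 2) x := by
      have h3 : HasDerivAt (fun t : ℝ => t ^ 3 / 3 + t) ((x 1) ^ 2 + 1) (x 1) := by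
        have h4 := ((hasDerivAt_pow 3 (x 1)).div_const 3).add (hasDerivAt_id (x 1))
        convert! h4 using 1
        simp
      exact ((h3.comp_hasFDerivAt x (hc 1)).add ((hc 0).const_mul 2)).add h1
    have h5 := Complex.ofRealCLM.hasFDerivAt.comp x h2
    refine h5.congr_fderiv ?_
    ext v
    simp [coordC_apply, dcoord]
  · exact hasFDerivAt_const _ _

lemma contDiff_coefH {κ : ℝ → ℝ} (hκ : ContDiff ℝ ∞ κ) : ContDiff ℝ ∞ (coefH κ) := by
  rw [contDiff_pi]
  intro i
  have hc (k : Fin 6) : ContDiff ℝ ∞ (fun y : E6 => y k) := (dcoord k).contDiff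
  have hC (k : Fin 6) : ContDiff ℝ ∞ (fun y : E6 => ((y k : ℝ) : ℂ)) := (coordC k).contDiff
  fin_cases i
  · exact (hC 2).add (contDiff_const.mul (hC 3))
  · exact (hC 3).add (contDiff_const.mul (hC 2))
  · exact Complex.ofRealCLM.contDiff.comp ((((((hc 1).pow 3).div_const 3).add (hc 1)).add
      (contDiff_const.mul (hc 0))).add (hκ.comp (hc 2)))
  · exact contDiff_const

lemma fderiv_coefH {κ : ℝ → ℝ} (hκ : ContDiff ℝ ∞ κ) (x u : E6) :
    fderiv ℝ (coefH κ) x u = ![u 2 + Complex.I * u 3, u 3 + Complex.I * u 2,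
      ((x 1 : ℂ) ^ 2 + 1) * u 1 + 2 * u 0 + deriv κ (x 2) * u 2, 0] := by
  rw [(hasFDerivAt_coefH hκ x).fderiv]
  ext i
  fin_cases i <;> simp [coordC_apply]

lemma frame_apply_zero (f : Fin 4 → ℂ) (i : Fin 4) : frame f i 0 = if i = 0 then 1 else 0 :=
  (frame_base f i 0).trans (by simp only [eq_comm])

lemma frame_apply_one (f : Fin 4 → ℂ) (i : Fin 4) : frame f i 1 = if i = 1 then 1 else 0 :=
  (frame_base f i 1).trans (by simp only [eq_comm])

lemma frame_apply_two (f : Fin 4 → ℂ) (i : Fin 4) : frame f i 2 = if i = 2 then 1 else 0 :=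
  (frame_base f i 2).trans (by simp only [eq_comm])

lemma frame_apply_three (f : Fin 4 → ℂ) (i : Fin 4) : frame f i 3 = if i = 3 then 1 else 0 :=
  (frame_base f i 3).trans (by simp only [eq_comm])

/-- The function κ drops out because κ(y₁) dy₁ is closed. The cubic term contributes its derivative
x₂² + 1, the only nonconstant part of the curvature. -/
lemma curv_coefH {κ : ℝ → ℝ} (hκ : ContDiff ℝ ∞ κ) (x : E6) :
    curv (coefH κ) x 0 1 = 0 ∧ curv (coefH κ) x 0 2 = 1 ∧ curv (coefH κ) x 0 3 = -Complex.I ∧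
    curv (coefH κ) x 1 2 = (x 1 : ℂ) ^ 2 + 1 - Complex.I ∧ curv (coefH κ) x 1 3 = -1 ∧
    curv (coefH κ) x 2 3 = 0 := by
  simp only [curv, fderiv_coefH hκ, frame_apply_zero, frame_apply_one, frame_apply_two,
    frame_apply_three]
  refine ⟨?_, ?_, ?_, ?_, ?_, ?_⟩ <;> simp
  norm_num

/-- This is the quadratic equation for μ. At m = ±1 its value is ±4, so these are never roots. -/
lemma pf_curvB_coefH {κ : ℝ → ℝ} (hκ : ContDiff ℝ ∞ κ) (x : E6) (m : ℂ) :
    pf (curvB (coefH κ) m x) = 4 * m - Complex.I * ((x 1 : ℂ) ^ 2 + 1) * (1 - m ^ 2) := by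
  obtain ⟨h01, h02, h03, h12, h13, h23⟩ := curv_coefH hκ x
  simp only [pf, curvB, h01, h02, h03, h12, h13, h23]
  simp
  linear_combination (1 - m) ^ 2 * Complex.I_sq

/-- At the origin the Pfaffian is −i and the mixed Pfaffian is 4, so the discriminant is 16 − 4 > 0.
-/
lemma isElliptic_coefH {κ : ℝ → ℝ} (hκ : ContDiff ℝ ∞ κ) :
    IsElliptic (curv (coefH κ) 0) := by
  obtain ⟨h01, h02, h03, h12, h13, h23⟩ := curv_coefH hκ 0
  simp only [IsElliptic, mixedPf, pf, h01, h02, h03, h12, h13, h23]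
  simp [Complex.normSq_apply]
  norm_num

lemma isFat_H {κ : ℝ → ℝ} (hκ : ContDiff ℝ ∞ κ) : IsFat (H κ) 0 :=
  isFat_of_isElliptic (.of_contDiff (contDiff_coefH hκ) 0) (.of_forall fun x v => mem_H_iff κ x v)
    (IsElliptic.eventually (continuousAt_curv (contDiff_coefH hκ).contDiffAt)
      (isElliptic_coefH hκ))

lemma areReebDirections_H {κ : ℝ → ℝ} (hκ : ContDiff ℝ ∞ κ) : AreReebDirections (H κ) dz 0 := by
  refine areReebDirections_dz (.of_contDiff (contDiff_coefH hκ) 0)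
    (.of_forall fun x v => mem_H_iff κ x v) (.of_forall fun x => ?_) (.of_forall fun x => ?_)
  · rw [fderiv_coefH hκ]
    ext i
    fin_cases i <;> simp
  · rw [fderiv_coefH hκ]
    ext i
    fin_cases i <;> simp

lemma not_supportsComplexContact_H {κ : ℝ → ℝ} (hκ : ContDiff ℝ ∞ κ) :
    ¬ SupportsComplexContact (H κ) 0 := by
  intro hH
  obtain ⟨μ, hμ, -, hob⟩ := hH.exists_beltrami (.of_contDiff (contDiff_coefH hκ) 0)
    (.of_forall fun x v => mem_H_iff κ x v)
  have hev : ∀ᶠ t : ℝ in 𝓝[≠] 0, SmoothNear μ (t • e6 1) ∧ ∀ᶠ x in 𝓝 (t • e6 1),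
      pf (curvB (coefH κ) (μ x) x) = 0 ∧ obstruction (coefH κ) μ x = 0 :=
    ((tendsto_smul_e6 1).eventually
      (hμ.eventually_smoothNear.and hob.eventually_nhds)).filter_mono nhdsWithin_le_nhds
  -- The derivative of x₂² + 1 contributes a factor 2t to `hfin`, which has to be cancelled. Hence a
  -- point of the x₂-axis other than the origin is used.
  obtain ⟨t, ⟨ht1, ht2⟩, ht0⟩ := (hev.and self_mem_nhdsWithin).exists
  have ht0' : (t : ℂ) ≠ 0 := by exact_mod_cast ht0
  set x : E6 := t • e6 1 with hx
  have hx1 : x 1 = t := by simp [hx]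
  have hμd : HasFDerivAt μ (fderiv ℝ μ x) x :=
    (ht1.contDiffAt.differentiableAt (by simp)).hasFDerivAt
  have hq : (fun y : E6 => 4 * μ y - Complex.I * ((y 1 : ℂ) ^ 2 + 1) * (1 - μ y ^ 2))
      =ᶠ[𝓝 x] fun _ => 0 := ht2.mono fun y hy => (pf_curvB_coefH hκ y _).symm.trans hy.1
  have hC : HasFDerivAt (fun y : E6 => ((y 1 : ℝ) : ℂ)) (coordC 1) x := (coordC 1).hasFDerivAt
  have hd := ((hμd.const_mul 4).sub ((((hC.pow 2).add_const 1).const_mul Complex.I).mul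
    ((hμd.pow 2).const_sub 1))).fderiv
  have hd' : fderiv ℝ (fun y : E6 => 4 * μ y - Complex.I * ((y 1 : ℂ) ^ 2 + 1) * (1 - μ y ^ 2)) x
      = 0 := by
    rw [hq.fderiv_eq]; simp
  have hrel (u : E6) : fderiv ℝ μ x u * (4 + 2 * Complex.I * ((t : ℂ) ^ 2 + 1) * μ x)
      = Complex.I * (2 * t * u 1) * (1 - μ x ^ 2) := by
    have h1 := congrArg (fun f : E6 →L[ℝ] ℂ => f u) (hd.symm.trans hd')
    simp [coordC_apply, hx1] at h1
    linear_combination h1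
  obtain ⟨hpf, hT⟩ := ht2.self_of_nhds
  rw [pf_curvB_coefH hκ, hx1] at hpf
  obtain ⟨h01, h02, h03, h12, h13, h23⟩ := curv_coefH hκ x
  have h4 : fderiv ℝ (coefH κ) x (e6 4) = 0 := by
    rw [fderiv_coefH hκ]
    ext i
    fin_cases i <;> simp
  have h5 : fderiv ℝ (coefH κ) x (e6 5) = 0 := by
    rw [fderiv_coefH hκ]
    ext i
    fin_cases i <;> simp
  rw [obstruction, h4, h5] at hT
  simp [Fin.sum_univ_four, kerVec, curvB, h01, h02, h12] at hT
  have r0 := hrel (frame (coefH κ x) 0)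
  have r1 := hrel (frame (coefH κ x) 1)
  rw [frame_apply_one] at r0 r1
  simp at r0 r1
  -- The equation for μ involves only x₂, so the X₀-derivative drops out and the obstruction reads
  -- (1 + μ) X₁μ = 0. Multiplying it by the factor 4 + 2i(t² + 1)μ from `hrel` lets X₁μ be replaced
  -- by its value without knowing that this factor is nonzero.
  have hfin : (1 + μ x) * (2 * t) * (1 - μ x ^ 2) = 0 := by
    have h6 : Complex.I * ((1 + μ x) * (2 * t) * (1 - μ x ^ 2)) = 0 := by
      set a := fderiv ℝ μ x (frame (coefH κ x) 0)
      set b := fderiv ℝ μ x (frame (coefH κ x) 1)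
      have r2 := mul_eq_zero.2 r0
      linear_combination (-(1 + μ x)) * r1 +
        ((x 1 : ℂ) ^ 2 + 1 - Complex.I + μ x * ((x 1 : ℂ) ^ 2 + 1 + Complex.I)) * r2 -
        (4 + 2 * Complex.I * ((t : ℂ) ^ 2 + 1) * μ x) / 2 * hT
    exact (mul_eq_zero.1 h6).resolve_left Complex.I_ne_zero
  have h7 : (1 + μ x) ^ 2 * (1 - μ x) = 0 := by
    have h8 : (2 * (t : ℂ)) * ((1 + μ x) ^ 2 * (1 - μ x)) = 0 := by linear_combination hfin
    exact (mul_eq_zero.1 h8).resolve_left (by simpa using ht0')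
  rcases mul_eq_zero.1 h7 with h8 | h8
  -- For μ = ±1 the Pfaffian equation becomes ±4 = 0.
  · have h9 : μ x = -1 := by linear_combination pow_eq_zero_iff (two_ne_zero) |>.1 h8
    rw [h9] at hpf
    norm_num at hpf
  · have h9 : μ x = 1 := by linear_combination -h8
    rw [h9] at hpf
    norm_num at hpf

/-- The family is as large as the space of germs of functions. -/
lemma eventually_eq_of_H_eq {κ κ' : ℝ → ℝ} (h : ∀ᶠ x in 𝓝 (0 : E6), H κ x = H κ' x) :
    ∀ᶠ t in 𝓝 (0 : ℝ), κ t = κ' t := by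
  -- On the y₁-axis the coefficient of dy₁ in the graph is exactly κ(t).
  filter_upwards [(tendsto_smul_e6 2).eventually h] with t ht
  have h1 : coefH κ (t • e6 2) = coefH κ' (t • e6 2) :=
    graphForm_ker_injective fun v => by rw [← mem_H_iff, ht, mem_H_iff]
  have h2 := congrFun h1 2
  simpa [coefH] using h2

/-! ### Deformations of the standard complex contact structure -/

section Model

variable {n : ℕ}

/-- The polynomial `∑ s_k ζ^(k + j) / (k + j)!`. -/
noncomputable def divPow (j : ℕ) (s : EuclideanSpace ℝ (Fin n)) (ζ : ℂ) : ℂ :=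
  ∑ k, (s k : ℂ) * (ζ ^ ((k : ℕ) + j) / ((k : ℕ) + j).factorial)

/-- Divided powers make differentiation a shift of the index. The indices 2, 1 and 0 give the
coefficient of the deformation, minus its Beltrami coefficient, and its torsion. -/
lemma hasDerivAt_divPow (j : ℕ) (s : EuclideanSpace ℝ (Fin n)) (ζ : ℂ) :
    HasDerivAt (divPow (j + 1) s) (divPow j s ζ) ζ := by
  refine HasDerivAt.fun_sum fun k _ => ?_
  have h := ((hasDerivAt_pow ((k : ℕ) + (j + 1)) ζ).div_const
    (((k : ℕ) + (j + 1)).factorial : ℂ)).const_mul (s k : ℂ)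
  convert! h using 2
  rw [← Nat.add_assoc, Nat.factorial_succ, Nat.add_sub_cancel]
  push_cast
  rw [mul_div_mul_left _ _ (by exact_mod_cast Nat.succ_ne_zero ((k : ℕ) + j))]

lemma divPow_zero_left (j : ℕ) (ζ : ℂ) : divPow j (0 : EuclideanSpace ℝ (Fin n)) ζ = 0 := by
  simp [divPow]

/-- The coordinate `x₀ - √-1 x₁`. -/
noncomputable def uBar : E6 →L[ℝ] ℂ := (Complex.conjCLE : ℂ →L[ℝ] ℂ).comp (cc 0 1)

lemma uBar_apply (x : E6) : uBar x = x 0 - Complex.I * x 1 := by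
  simp [uBar, cc_apply, sub_eq_add_neg]

/-- The graph coefficients of `dw = v du - Φ_s(ū) dv̄`, with `u = x₀ + √-1 x₁` and
`v = x₂ + √-1 x₃`. -/
noncomputable def modelCoef (s : EuclideanSpace ℝ (Fin n)) (x : E6) : Fin 4 → ℂ :=
  ![cc 2 3 x, Complex.I * cc 2 3 x, -divPow 2 s (uBar x), Complex.I * divPow 2 s (uBar x)]

lemma contDiff_modelCoef :
    ContDiff ℝ ∞ fun z : EuclideanSpace ℝ (Fin n) × E6 => modelCoef z.1 z.2 := by
  have h1 : ContDiff ℝ ∞ fun z : EuclideanSpace ℝ (Fin n) × E6 => cc 2 3 z.2 :=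
    (cc 2 3).contDiff.comp contDiff_snd
  have h2 : ContDiff ℝ ∞ fun z : EuclideanSpace ℝ (Fin n) × E6 => uBar z.2 :=
    uBar.contDiff.comp contDiff_snd
  have h3 (k : Fin n) : ContDiff ℝ ∞ fun z : EuclideanSpace ℝ (Fin n) × E6 => (z.1 k : ℂ) :=
    (Complex.ofRealCLM.comp (EuclideanSpace.proj k)).contDiff.comp contDiff_fst
  have h4 : ContDiff ℝ ∞ fun z : EuclideanSpace ℝ (Fin n) × E6 => divPow 2 z.1 (uBar z.2) :=
    ContDiff.sum fun k _ => (h3 k).mul ((h2.pow _).div_const _)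
  rw [contDiff_pi]
  intro i
  fin_cases i
  · exact h1
  · exact contDiff_const.mul h1
  · exact h4.neg
  · exact contDiff_const.mul h4

lemma contDiff_modelCoef_right (s : EuclideanSpace ℝ (Fin n)) : ContDiff ℝ ∞ (modelCoef s) :=
  contDiff_modelCoef.comp (contDiff_const.prodMk contDiff_id)

lemma fderiv_modelCoef (s : EuclideanSpace ℝ (Fin n)) (x u : E6) :
    fderiv ℝ (modelCoef s) x u = ![cc 2 3 u, Complex.I * cc 2 3 u,
      -(divPow 1 s (uBar x) * uBar u), Complex.I * (divPow 1 s (uBar x) * uBar u)] := by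
  have h1 : HasFDerivAt (fun x => divPow 2 s (uBar x)) (divPow 1 s (uBar x) • uBar) x :=
    (hasDerivAt_divPow 1 s (uBar x)).comp_hasFDerivAt x uBar.hasFDerivAt
  have h2 : HasFDerivAt (cc 2 3) (cc 2 3) x := (cc 2 3).hasFDerivAt
  have h : HasFDerivAt (modelCoef s) (ContinuousLinearMap.pi ![cc 2 3, Complex.I • cc 2 3,
      -(divPow 1 s (uBar x) • uBar), Complex.I • (divPow 1 s (uBar x) • uBar)]) x := by
    rw [hasFDerivAt_pi']
    intro i
    rw [ContinuousLinearMap.proj_pi]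
    fin_cases i
    · exact h2
    · exact h2.const_mul Complex.I
    · exact h1.neg
    · exact h1.const_mul Complex.I
  rw [h.fderiv]
  ext i
  fin_cases i <;> simp

lemma curv_modelCoef (s : EuclideanSpace ℝ (Fin n)) (x : E6) :
    curv (modelCoef s) x 0 1 = 0 ∧
    curv (modelCoef s) x 0 2 = -divPow 1 s (uBar x) - 1 ∧
    curv (modelCoef s) x 0 3 = Complex.I * (divPow 1 s (uBar x) - 1) ∧
    curv (modelCoef s) x 1 2 = Complex.I * (divPow 1 s (uBar x) - 1) ∧
    curv (modelCoef s) x 1 3 = divPow 1 s (uBar x) + 1 ∧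
    curv (modelCoef s) x 2 3 = 0 := by
  simp only [curv, fderiv_modelCoef, cc_apply, uBar_apply (frame _ _), frame_apply_zero,
    frame_apply_one, frame_apply_two, frame_apply_three]
  refine ⟨?_, ?_, ?_, ?_, ?_, ?_⟩ <;> simp
  · ring
  · ring
  · linear_combination (-divPow 1 s (uBar x)) * Complex.I_mul_I

/-- With a = `divPow 1 s (uBar x)` the Pfaffian is 4a and the mixed Pfaffian is 4(1 + |a|²), so the
discriminant is 16(1 − |a|²)². -/
lemma isElliptic_modelCoef {s : EuclideanSpace ℝ (Fin n)} {x : E6}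
    (h : ‖divPow 1 s (uBar x)‖ < 1) : IsElliptic (curv (modelCoef s) x) := by
  obtain ⟨h01, h02, h03, h12, h13, h23⟩ := curv_modelCoef s x
  set a := divPow 1 s (uBar x)
  have h1 : mixedPf (curv (modelCoef s) x) = 4 * (1 + ‖a‖ ^ 2) := by
    simp only [mixedPf, h01, h02, h03, h12, h13, h23, ← Complex.normSq_eq_norm_sq,
      Complex.normSq_apply]
    simp
    ring
  have h2 : pf (curv (modelCoef s) x) = 4 * a := by
    simp only [pf, h01, h02, h03, h12, h13, h23]
    linear_combination (a - 1) ^ 2 * Complex.I_mul_I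
  rw [IsElliptic, h1, h2, Complex.normSq_eq_norm_sq, norm_mul]
  have h3 : 0 < 1 - ‖a‖ ^ 2 := by nlinarith [norm_nonneg a]
  refine ⟨by positivity, ?_⟩
  have h4 : ‖(4 : ℂ)‖ = 4 := by simp
  rw [h4]
  nlinarith [sq_pos_of_pos h3]

/-- The quadratic equation factors as 4(a + m)(1 + ā m) = 0, and m = −a is the root in the unit
disc. -/
lemma beltramiOf_modelCoef {s : EuclideanSpace ℝ (Fin n)} {x : E6}
    (h : ‖divPow 1 s (uBar x)‖ < 1) : beltramiOf (modelCoef s) x = -divPow 1 s (uBar x) := by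
  refine ((isElliptic_modelCoef h).eq_beltrami (by rw [norm_neg]; exact h.le) ?_).symm
  obtain ⟨h01, h02, h03, h12, h13, h23⟩ := curv_modelCoef s x
  set a := divPow 1 s (uBar x)
  simp only [pf, h01, h02, h03, h12, h13, h23]
  simp
  linear_combination ((a - 1) ^ 2 - 2 * a * (a - 1) * (1 - (starRingEnd ℂ) a)
    + a ^ 2 * (1 - (starRingEnd ℂ) a) ^ 2) * Complex.I_sq

lemma curvB_modelCoef {s : EuclideanSpace ℝ (Fin n)} {x : E6}
    (h : ‖divPow 1 s (uBar x)‖ < 1) :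
    curvB (modelCoef s) (beltramiOf (modelCoef s) x) x 0 1 = 0 ∧
    curvB (modelCoef s) (beltramiOf (modelCoef s) x) x 0 2
      = -(1 - divPow 1 s (uBar x) * (starRingEnd ℂ) (divPow 1 s (uBar x))) ∧
    curvB (modelCoef s) (beltramiOf (modelCoef s) x) x 1 2
      = -Complex.I * (1 - divPow 1 s (uBar x) * (starRingEnd ℂ) (divPow 1 s (uBar x))) := by
  obtain ⟨h01, h02, h03, h12, h13, h23⟩ := curv_modelCoef s x
  rw [beltramiOf_modelCoef h]
  simp only [curvB, h01, h02, h12]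
  refine ⟨?_, ?_, ?_⟩ <;> simp <;> ring

lemma one_sub_mul_conj_ne_zero {a : ℂ} (h : ‖a‖ < 1) : 1 - a * (starRingEnd ℂ) a ≠ 0 := by
  rw [Complex.mul_conj, Complex.normSq_eq_norm_sq]
  have h3 : 1 - ‖a‖ ^ 2 ≠ 0 := by nlinarith [norm_nonneg a]
  exact_mod_cast h3

lemma isRegular_modelCoef {s : EuclideanSpace ℝ (Fin n)} {x : E6}
    (h : ‖divPow 1 s (uBar x)‖ < 1) : IsRegular (modelCoef s) x := by
  refine ⟨isElliptic_modelCoef h, ?_⟩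
  rw [(curvB_modelCoef h).2.2]
  exact mul_ne_zero (neg_ne_zero.2 Complex.I_ne_zero) (one_sub_mul_conj_ne_zero h)

lemma eventually_norm_divPow_lt (s : EuclideanSpace ℝ (Fin n)) :
    ∀ᶠ x in 𝓝 (0 : E6), ‖divPow 1 s (uBar x)‖ < 1 := by
  have h1 : ContinuousAt (fun x => ‖divPow 1 s (uBar x)‖) 0 :=
    (ContinuousAt.comp (g := divPow 1 s) (hasDerivAt_divPow 0 s _).continuousAt
      uBar.continuous.continuousAt).norm
  refine h1.eventually_lt_const ?_
  simp [divPow]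

/-- The Beltrami coefficient is a function of ū alone, and the kernel vector is proportional to ∂_ū
in the u-plane. The division by `-4 * curvB` in the torsion cancels the common factor 1 − |a|² and
the constants, leaving the second derivative of the deformation. -/
lemma torsion_modelCoef {s : EuclideanSpace ℝ (Fin n)} {x : E6}
    (h : ∀ᶠ y in 𝓝 x, ‖divPow 1 s (uBar y)‖ < 1) :
    torsion (modelCoef s) x = divPow 0 s (uBar x) := by
  obtain ⟨c01, c02, c12⟩ := curvB_modelCoef h.self_of_nhds
  have hμ : beltramiOf (modelCoef s) =ᶠ[𝓝 x] fun y => -divPow 1 s (uBar y) :=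
    h.mono fun y hy => beltramiOf_modelCoef hy
  have hd : HasFDerivAt (fun y => -divPow 1 s (uBar y)) (-(divPow 0 s (uBar x) • uBar)) x :=
    ((hasDerivAt_divPow 0 s (uBar x)).comp_hasFDerivAt x uBar.hasFDerivAt).neg
  have h4 (k : Fin 6) (hk : k = 4 ∨ k = 5) : fderiv ℝ (modelCoef s) x (e6 k) = 0 := by
    rw [fderiv_modelCoef]
    ext i
    rcases hk with rfl | rfl <;> fin_cases i <;> simp [cc_apply, uBar_apply]
  have hne := one_sub_mul_conj_ne_zero h.self_of_nhds
  rw [torsion, obstruction, h4 4 (.inl rfl), h4 5 (.inr rfl), hμ.fderiv_eq, hd.fderiv]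
  simp only [Fin.sum_univ_four, kerVec, c01, c02, c12]
  simp [uBar_apply (frame _ _), frame_apply_zero, frame_apply_one]
  field_simp
  ring

/-- The model deformation of the standard complex contact structure. -/
noncomputable def model (s : EuclideanSpace ℝ (Fin n)) (x : E6) : Submodule ℝ E6 :=
  (graphForm (modelCoef s x) : E6 →ₗ[ℝ] ℂ).ker

lemma mem_model {s : EuclideanSpace ℝ (Fin n)} {x v : E6} :
    v ∈ model s x ↔ graphForm (modelCoef s x) v = 0 := Iff.rfl

lemma model_zero_iff {x v : E6} :
    v ∈ model (0 : EuclideanSpace ℝ (Fin n)) x ↔ stdForm x v = 0 := by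
  rw [mem_model, graphForm_apply]
  simp [modelCoef, divPow_zero_left, Fin.sum_univ_four, base, stdForm, cc_apply]
  ring_nf

lemma graphCoef_model (s : EuclideanSpace ℝ (Fin n)) : graphCoef (model s) = modelCoef s :=
  funext fun _ => graphCoef_eq fun _ => mem_model

lemma isRegularGerm_model (s : EuclideanSpace ℝ (Fin n)) : IsRegularGerm (model s) := by
  refine ⟨⟨_, fun _ => mem_model⟩, ?_⟩
  rw [graphCoef_model]
  exact isRegular_modelCoef (eventually_norm_divPow_lt s).self_of_nhds

lemma iteratedDeriv_divPow (s : EuclideanSpace ℝ (Fin n)) (k : Fin n) :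
    iteratedDeriv k (fun t : ℝ => divPow 0 s (t : ℂ)) 0 = s k := by
  have h1 : (fun t : ℝ => divPow 0 s (t : ℂ))
      = fun t : ℝ => ∑ l : Fin n, (t ^ (l : ℕ)) • ((s l : ℂ) / (l : ℕ).factorial) := by
    ext t
    refine Finset.sum_congr rfl fun l _ => ?_
    simp only [Complex.real_smul, Complex.ofReal_pow, add_zero]
    ring
  rw [h1, iteratedDeriv_fun_sum fun l _ => by fun_prop]
  have h2 (l : Fin n) : iteratedDeriv k (fun t : ℝ => (t ^ (l : ℕ)) •
      ((s l : ℂ) / (l : ℕ).factorial)) 0 = if l = k then (s k : ℂ) else 0 := by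
    rw [iteratedDeriv_smul_const (by fun_prop), iteratedDeriv_fun_pow_zero]
    rcases eq_or_ne l k with rfl | hl
    · have h3 : ((l : ℕ).factorial : ℂ) ≠ 0 := by exact_mod_cast (l : ℕ).factorial_ne_zero
      simp [mul_div_cancel₀ _ h3]
    · have h3 : (k : ℕ) ≠ l := fun h => hl (Fin.ext h.symm)
      simp [hl, h3]
  simp only [h2, Finset.sum_ite_eq', Finset.mem_univ, if_true]

/-- Along the first axis ū = t is real, and the torsion is ∑ s_k t^k / k!. Its derivatives at 0 are
the parameters themselves. -/
lemma germInvariant_model (s : EuclideanSpace ℝ (Fin n)) : germInvariant n (model s) = s := by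
  rw [germInvariant, if_pos (isRegularGerm_model s), graphCoef_model]
  have h : (fun t : ℝ => torsion (modelCoef s) (t • e6 0)) =ᶠ[𝓝 0]
      fun t : ℝ => divPow 0 s (t : ℂ) := by
    filter_upwards [(tendsto_smul_e6 0).eventually (eventually_norm_divPow_lt s).eventually_nhds]
      with t ht
    rw [torsion_modelCoef ht]
    simp [uBar_apply]
  ext k
  simp [torsionJet, h.iteratedDeriv_eq, iteratedDeriv_divPow]

lemma isFat_model (s : EuclideanSpace ℝ (Fin n)) : IsFat (model s) 0 :=
  isFat_of_isElliptic (.of_contDiff (contDiff_modelCoef_right s) 0)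
    (.of_forall fun _ _ => mem_model)
    ((eventually_norm_divPow_lt s).mono fun _ hx => isElliptic_modelCoef hx)

lemma areReebDirections_model (s : EuclideanSpace ℝ (Fin n)) :
    AreReebDirections (model s) dz 0 := by
  refine areReebDirections_dz (.of_contDiff (contDiff_modelCoef_right s) 0)
    (.of_forall fun _ _ => mem_model) (.of_forall fun x => ?_) (.of_forall fun x => ?_) <;>
  · rw [fderiv_modelCoef]
    ext i
    fin_cases i <;> simp [cc_apply, uBar_apply]

end Model

/-! ### Charts of six-manifolds -/

section Charts

variable {M : Type*} [TopologicalSpace M] [ChartedSpace E6 M]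

lemma mfderiv_chart_bijective {e : OpenPartialHomeomorph M E6} {p x : M} (he : IsChartAt e p)
    (hx : x ∈ e.source) : Function.Bijective (mfderiv 𝓘(ℝ, E6) 𝓘(ℝ, E6) e x) :=
  OpenPartialHomeomorph.MDifferentiable.mfderiv_bijective
    ⟨(contMDiffOn_of_mem_maximalAtlas he.1).mdifferentiableOn (by simp),
      (contMDiffOn_symm_of_mem_maximalAtlas he.1).mdifferentiableOn (by simp)⟩ hx

/-- The coordinate change between two charts. -/
noncomputable def transition (e e' : OpenPartialHomeomorph M E6) : E6 → E6 := e' ∘ e.symm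

lemma transition_apply {e e' : OpenPartialHomeomorph M E6} {p : M} (he : IsChartAt e p) :
    transition e e' (e p) = e' p := by
  simp [transition, e.left_inv he.2]

lemma eventually_mem_source {e e' : OpenPartialHomeomorph M E6} {p : M} (he : IsChartAt e p)
    (he' : IsChartAt e' p) : ∀ᶠ y in 𝓝 (e p), y ∈ e.target ∧ e.symm y ∈ e'.source := by
  refine Filter.Eventually.and (e.open_target.mem_nhds (e.map_source he.2)) ?_
  have h := e.continuousAt_symm (e.map_source he.2)
  rw [ContinuousAt, e.left_inv he.2] at h
  exact h.eventually_mem (e'.open_source.mem_nhds he'.2)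

lemma contDiffAt_transition {e e' : OpenPartialHomeomorph M E6} {p : M} (he : IsChartAt e p)
    (he' : IsChartAt e' p) {y : E6} (hy : y ∈ e.target) (hy' : e.symm y ∈ e'.source) :
    ContDiffAt ℝ ∞ (transition e e') y :=
  contMDiffAt_iff_contDiffAt.1
    ((contMDiffAt_of_mem_maximalAtlas he'.1 hy').comp y (contMDiffAt_symm_of_mem_maximalAtlas he.1 hy))

lemma mfderiv_eq_transition {e e' : OpenPartialHomeomorph M E6} {p : M} (he : IsChartAt e p)
    (he' : IsChartAt e' p) {y : E6} (hy : y ∈ e.target) (hy' : e.symm y ∈ e'.source)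
    (v : TangentSpace 𝓘(ℝ, E6) (e.symm y)) :
    mfderiv 𝓘(ℝ, E6) 𝓘(ℝ, E6) e' (e.symm y) v
      = fderiv ℝ (transition e e') y (mfderiv 𝓘(ℝ, E6) 𝓘(ℝ, E6) e (e.symm y) v) := by
  have hx := e.map_target hy
  have h1 : e' =ᶠ[𝓝 (e.symm y)] transition e e' ∘ e := by
    filter_upwards [e.open_source.mem_nhds hx] with x hx
    simp [transition, e.left_inv hx]
  have h2 : MDifferentiableAt 𝓘(ℝ, E6) 𝓘(ℝ, E6) e (e.symm y) :=
    (contMDiffAt_of_mem_maximalAtlas he.1 hx).mdifferentiableAt (by simp)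
  have h3 : MDifferentiableAt 𝓘(ℝ, E6) 𝓘(ℝ, E6) (transition e e') (e (e.symm y)) := by
    rw [e.right_inv hy]
    exact ((contDiffAt_transition he he' hy hy').differentiableAt (by simp)).mdifferentiableAt
  rw [h1.mfderiv_eq, mfderiv_comp _ h3 h2, mfderiv_eq_fderiv, e.right_inv hy]
  rfl

lemma isLocalDiffeoNear_transition {e e' : OpenPartialHomeomorph M E6} {p : M}
    (he : IsChartAt e p) (he' : IsChartAt e' p) :
    IsLocalDiffeoNear (transition e e') (e p) := by
  have h := eventually_mem_source he he'
  refine ⟨h.mono fun y hy => contDiffAt_transition he he' hy.1 hy.2, ?_⟩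
  obtain ⟨h1, h2⟩ := h.self_of_nhds
  have h3 := mfderiv_chart_bijective he' h2
  have h4 := mfderiv_chart_bijective he (e.map_target h1)
  have h5 : (mfderiv 𝓘(ℝ, E6) 𝓘(ℝ, E6) e' (e.symm (e p)) : E6 → E6)
      = fderiv ℝ (transition e e') (e p) ∘ mfderiv 𝓘(ℝ, E6) 𝓘(ℝ, E6) e (e.symm (e p)) :=
    funext fun v => mfderiv_eq_transition he he' h1 h2 v
  rw [h5] at h3
  exact (Function.Bijective.of_comp_iff _ h4).1 h3

lemma mem_inChart {e : OpenPartialHomeomorph M E6} {D : Distribution M} {y v : E6} :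
    v ∈ inChart e D y ↔ ∃ u ∈ D (e.symm y), mfderiv 𝓘(ℝ, E6) 𝓘(ℝ, E6) e (e.symm y) u = v :=
  Iff.rfl

/-- Distributions in coordinates, under a coordinate change. -/
lemma eventually_mem_inChart_iff {e e' : OpenPartialHomeomorph M E6} {p : M}
    (he : IsChartAt e p) (he' : IsChartAt e' p) :
    ∀ᶠ y in 𝓝 (e p), ∀ (D : Distribution M) (v : E6), v ∈ inChart e D y ↔
      fderiv ℝ (transition e e') y v ∈ inChart e' D (transition e e' y) := by
  filter_upwards [eventually_mem_source he he'] with y hy D v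
  obtain ⟨h1, h2⟩ := hy
  have h3 : e'.symm (transition e e' y) = e.symm y := e'.left_inv h2
  rw [mem_inChart, mem_inChart, h3]
  have h4 := mfderiv_chart_bijective he (e.map_target h1)
  have h5 := mfderiv_chart_bijective he' h2
  constructor
  · rintro ⟨w, hw, rfl⟩
    exact ⟨w, hw, mfderiv_eq_transition he he' h1 h2 w⟩
  · rintro ⟨w, hw, hwv⟩
    obtain ⟨w', hw'⟩ := h4.2 v
    have h6 : mfderiv 𝓘(ℝ, E6) 𝓘(ℝ, E6) e' (e.symm y) w'
        = mfderiv 𝓘(ℝ, E6) 𝓘(ℝ, E6) e' (e.symm y) w := by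
      rw [mfderiv_eq_transition he he' h1 h2 w', hw']
      exact hwv.symm
    have h7 := h5.1 h6
    subst h7
    exact ⟨w', hw, hw'⟩

/-- A complex-contact germ is one in every chart. -/
lemma supportsComplexContact_inChart {p : M} {D : Distribution M}
    (hD : D ∈ complexContactGerms p) {e : OpenPartialHomeomorph M E6} (he : IsChartAt e p) :
    SupportsComplexContact (inChart e D) (e p) := by
  obtain ⟨e', he', hD⟩ := hD
  rw [← transition_apply he (e' := e')] at hD
  exact hD.pullback (isLocalDiffeoNear_transition he he')
    ((eventually_mem_inChart_iff he he').mono fun y hy => hy D)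

lemma inChart_congr {e : OpenPartialHomeomorph M E6} {p : M} (he : IsChartAt e p)
    {D D' : Distribution M} (h : ∀ᶠ x in 𝓝 p, D x = D' x) :
    ∀ᶠ y in 𝓝 (e p), inChart e D y = inChart e D' y := by
  have h1 := e.continuousAt_symm (e.map_source he.2)
  rw [ContinuousAt, e.left_inv he.2] at h1
  filter_upwards [h1.eventually h] with y hy
  rw [inChart, inChart, hy]

/-- The distribution on `M` that corresponds to `K` under the chart `e`. -/
noncomputable def ofChart (e : OpenPartialHomeomorph M E6) (K : E6 → Submodule ℝ E6) :
    Distribution M := fun x =>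
  (K (e x)).comap (mfderiv 𝓘(ℝ, E6) 𝓘(ℝ, E6) e x).toLinearMap

lemma mem_ofChart {e : OpenPartialHomeomorph M E6} {K : E6 → Submodule ℝ E6} {x : M}
    {u : TangentSpace 𝓘(ℝ, E6) x} :
    u ∈ ofChart e K x ↔ (mfderiv 𝓘(ℝ, E6) 𝓘(ℝ, E6) e x u : E6) ∈ K (e x) :=
  Iff.rfl

lemma inChart_ofChart {e : OpenPartialHomeomorph M E6} {p : M} (he : IsChartAt e p)
    (K : E6 → Submodule ℝ E6) {y : E6} (hy : y ∈ e.target) : inChart e (ofChart e K) y = K y := by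
  ext v
  rw [mem_inChart]
  constructor
  · rintro ⟨u, hu, rfl⟩
    rw [mem_ofChart, e.right_inv hy] at hu
    exact hu
  · intro hv
    obtain ⟨u, rfl⟩ := (mfderiv_chart_bijective he (e.map_target hy)).2 v
    refine ⟨u, ?_, rfl⟩
    rw [mem_ofChart, e.right_inv hy]
    exact hv

lemma ofChart_inChart {e : OpenPartialHomeomorph M E6} {p : M} (he : IsChartAt e p)
    {D : Distribution M} {K : E6 → Submodule ℝ E6}
    (h : ∀ᶠ y in 𝓝 (e p), inChart e D y = K y) : ∀ᶠ x in 𝓝 p, ofChart e K x = D x := by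
  filter_upwards [(e.continuousAt he.2).eventually h, e.open_source.mem_nhds he.2] with x h1 h2
  ext u
  have h3 (v : E6) : v ∈ K (e x) ↔ ∃ u ∈ D x, mfderiv 𝓘(ℝ, E6) 𝓘(ℝ, E6) e x u = v := by
    rw [← h1, mem_inChart, e.left_inv h2]
  refine (mem_ofChart.trans (h3 _)).trans ⟨?_, ?_⟩
  · rintro ⟨u', hu', h4⟩
    rwa [← (mfderiv_chart_bijective he h2).1 h4]
  · exact fun hu => ⟨u, hu, rfl⟩

/-- A chart followed by a local diffeomorphism. -/
lemma IsChartAt.exists_comp [IsManifold 𝓘(ℝ, E6) ∞ M] {e : OpenPartialHomeomorph M E6} {p : M}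
    (he : IsChartAt e p) {Ψ : E6 → E6} (hΨ : IsLocalDiffeoNear Ψ (e p)) :
    ∃ e' : OpenPartialHomeomorph M E6, IsChartAt e' p ∧ ∀ x, e' x = Ψ (e x) := by
  obtain ⟨g, hg, hpg, -⟩ := exists_local_inverse (by simp) hΨ.1.contDiffAt hΨ.2
  -- The inverse function theorem as stated gives a smooth inverse only at one point. Restricting to
  -- an open set where the derivative stays bijective makes the inverse smooth on the whole target,
  -- as a chart requires.
  obtain ⟨S, hS, hSo, hpS⟩ := eventually_nhds_iff.1 (hΨ.1.and hΨ.eventually_bijective)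
  have hsymm {z : E6} (hz : z ∈ g.target) (hzS : g.symm z ∈ S) : ContDiffAt ℝ ∞ g.symm z := by
    obtain ⟨h1, h2⟩ := hS _ hzS
    let f' : E6 ≃L[ℝ] E6 := ContinuousLinearEquiv.ofBijective (fderiv ℝ Ψ (g.symm z))
      (LinearMap.ker_eq_bot.2 h2.1) (LinearMap.range_eq_top.2 h2.2)
    have h3 : HasFDerivAt g (f' : E6 →L[ℝ] E6) (g.symm z) := by
      have h : (f' : E6 →L[ℝ] E6) = fderiv ℝ Ψ (g.symm z) := by ext; rfl
      rw [h, hg]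
      exact (h1.differentiableAt (by simp)).hasFDerivAt
    exact g.contDiffAt_symm hz h3 (by rw [hg]; exact h1)
  refine ⟨e.trans (g.restrOpen S hSo), ⟨?_, ?_⟩, fun x => ?_⟩
  · refine OpenPartialHomeomorph.mem_maximalAtlas_of_contMDiffOn _ ?_ ?_
    · intro x hx
      have hx1 : x ∈ e.source ∧ e x ∈ g.source ∧ e x ∈ S := by simpa using hx
      have h2 : ContMDiffAt 𝓘(ℝ, E6) 𝓘(ℝ, E6) ∞ Ψ (e x) :=
        contMDiffAt_iff_contDiffAt.2 (hS _ hx1.2.2).1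
      have h3 := h2.comp x (contMDiffAt_of_mem_maximalAtlas he.1 hx1.1)
      rw [← hg] at h3
      exact h3.contMDiffWithinAt
    · intro z hz
      have hz1 : (z ∈ g.target ∧ g.symm z ∈ S) ∧ g.symm z ∈ e.target := by
        simpa [OpenPartialHomeomorph.trans_target] using hz
      have h2 : ContMDiffAt 𝓘(ℝ, E6) 𝓘(ℝ, E6) ∞ g.symm z :=
        contMDiffAt_iff_contDiffAt.2 (hsymm hz1.1.1 hz1.1.2)
      have h3 := (contMDiffAt_symm_of_mem_maximalAtlas he.1 hz1.2).comp z h2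
      exact h3.contMDiffWithinAt
  · simpa using ⟨he.2, hpg, hpS⟩
  · simp [hg]

lemma eventually_chart_iff {e e' : OpenPartialHomeomorph M E6} {p : M} (he : IsChartAt e p)
    (he' : IsChartAt e' p) {P : E6 → Prop} (h : ∀ᶠ y in 𝓝 (e p), P (transition e e' y)) :
    ∀ᶠ z in 𝓝 (e' p), P z := by
  have h1 : Tendsto (transition e' e) (𝓝 (e' p)) (𝓝 (e p)) := by
    have := (isLocalDiffeoNear_transition he' he).1.contDiffAt.continuousAt
    rwa [ContinuousAt, transition_apply he'] at this
  filter_upwards [h1.eventually h, eventually_mem_source he' he] with z h2 h3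
  have h4 : transition e e' (transition e' e z) = z := by
    simp [transition, e.left_inv h3.2, e'.right_inv h3.1]
  rwa [h4] at h2

/-- Darboux charts for complex-contact germs. -/
lemma exists_darboux_chart [IsManifold 𝓘(ℝ, E6) ∞ M] {p : M} {D : Distribution M}
    (hD : D ∈ complexContactGerms p) (n : ℕ) : ∃ e : OpenPartialHomeomorph M E6,
      IsChartAt e p ∧ e p = 0 ∧
      ∀ᶠ y in 𝓝 (0 : E6), inChart e D y = model (0 : EuclideanSpace ℝ (Fin n)) y := by
  obtain ⟨e, he, hD⟩ := hD
  obtain ⟨Ψ, hΨ, hΨ0, hΨD⟩ := hD.exists_darboux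
  -- The Darboux coordinates are absorbed into the chart.
  obtain ⟨e', he', heΨ⟩ := he.exists_comp hΨ
  have h0 : e' p = 0 := by rw [heΨ, hΨ0]
  refine ⟨e', he', h0, ?_⟩
  rw [← h0]
  refine eventually_chart_iff he he' ?_
  have htr : transition e e' =ᶠ[𝓝 (e p)] Ψ := by
    filter_upwards [eventually_mem_source he he'] with y hy
    simp [transition, heΨ, e.right_inv hy.1]
  filter_upwards [eventually_mem_inChart_iff he he', hΨD, htr.eventually_nhds,
    hΨ.eventually_bijective] with y h1 h2 h3 h4
  have h3' : transition e e' =ᶠ[𝓝 y] Ψ := h3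
  ext w
  obtain ⟨v, rfl⟩ := h4.2 w
  rw [model_zero_iff, h3'.self_of_nhds, ← h2, h1, h3'.fderiv_eq, h3'.self_of_nhds]

end Charts

/-! ### Dependence on the germ -/

lemma IsDefinedBy.congr {D D' : E6 → Submodule ℝ E6} {θ : Fin 2 → E6 → E6 →L[ℝ] ℝ} {p : E6}
    (h : IsDefinedBy D θ p) (hD : ∀ᶠ x in 𝓝 p, D' x = D x) : IsDefinedBy D' θ p := by
  refine ⟨h.1, h.2.1, ?_⟩
  filter_upwards [h.2.2, hD] with x h1 h2 v
  rw [h2, h1]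

lemma IsFat.congr {D D' : E6 → Submodule ℝ E6} {p : E6} (h : IsFat D p)
    (hD : ∀ᶠ x in 𝓝 p, D' x = D x) : IsFat D' p := by
  obtain ⟨θ, hθ, hv⟩ := h
  refine ⟨θ, hθ.congr hD, ?_⟩
  filter_upwards [hv, hD] with x h1 h2
  rwa [h2]

lemma AreReebDirections.congr {D D' : E6 → Submodule ℝ E6} {Z : Fin 2 → E6 → E6} {p : E6}
    (h : AreReebDirections D Z p) (hD : ∀ᶠ x in 𝓝 p, D' x = D x) : AreReebDirections D' Z p := by
  obtain ⟨hZ, θ, hθ, hv⟩ := h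
  refine ⟨hZ, θ, hθ.congr hD, ?_⟩
  filter_upwards [hv, hD] with x h1 h2
  rwa [h2]

/-! ### Complex-contact germs among fat germs with Reeb directions -/

section Codimension

variable {M : Type*} [TopologicalSpace M] [ChartedSpace E6 M]

lemma mem_fatReebGerms_of_model {p : M} {D : Distribution M} {e : OpenPartialHomeomorph M E6}
    (he : IsChartAt e p) (h0 : e p = 0) {n : ℕ} {s : EuclideanSpace ℝ (Fin n)}
    (h : ∀ᶠ y in 𝓝 (0 : E6), inChart e D y = model s y) : D ∈ fatReebGerms p := by
  refine ⟨e, he, ?_, dz, ?_⟩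
  · rw [h0]; exact (isFat_model s).congr h
  · rw [h0]; exact (areReebDirections_model s).congr h

lemma eventually_inChart_ofChart {p : M} {e : OpenPartialHomeomorph M E6} (he : IsChartAt e p)
    (K : E6 → Submodule ℝ E6) : ∀ᶠ y in 𝓝 (e p), inChart e (ofChart e K) y = K y := by
  filter_upwards [e.open_target.mem_nhds (e.map_source he.2)] with y hy
  exact inChart_ofChart he K hy

/-! ### Existence of complex-contact germs and their inclusion in the fat germs -/

/-- The complex coordinates `(u, v, w)` on `ℝ⁶`. -/
noncomputable def toC3 : E6 →L[ℝ] C3 :=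
  ((EuclideanSpace.equiv (Fin 3) ℂ).symm.toContinuousLinearMap.restrictScalars ℝ).comp
    (ContinuousLinearMap.pi ![cc 0 1, cc 2 3, cc 4 5])

lemma toC3_apply (v : E6) : toC3 v = !₂[cc 0 1 v, cc 2 3 v, cc 4 5 v] := by
  ext i
  fin_cases i <;> rfl

lemma toC3_bijective : Function.Bijective toC3 := by
  refine ⟨fun v w h => toTriple.injective ?_, fun ζ => ?_⟩
  · rw [toC3_apply, toC3_apply] at h
    have h0 := congrArg (fun ζ : C3 => ζ 0) h
    have h1 := congrArg (fun ζ : C3 => ζ 1) h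
    have h2 := congrArg (fun ζ : C3 => ζ 2) h
    simp only [toTriple_apply, Prod.mk.injEq]
    exact ⟨h0, h1, h2⟩
  · have h := toTriple.apply_symm_apply (ζ 0, ζ 1, ζ 2)
    simp only [toTriple_apply, Prod.mk.injEq] at h
    refine ⟨toTriple.symm (ζ 0, ζ 1, ζ 2), ?_⟩
    rw [toC3_apply, h.1, h.2.1, h.2.2]
    ext i
    fin_cases i <;> rfl

/-- The kernel of the standard contact form supports a complex contact structure. -/
lemma supportsComplexContact_of_eventually_mem_iff_stdForm {K : E6 → Submodule ℝ E6} {p : E6}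
    (hK : ∀ᶠ x in 𝓝 p, ∀ v, v ∈ K x ↔ stdForm x v = 0) : SupportsComplexContact K p := by
  have hd (x : E6) : fderiv ℝ toC3 x = toC3 := toC3.hasFDerivAt.fderiv
  let π (i : Fin 3) : C3 →L[ℂ] ℂ := EuclideanSpace.proj i
  let α : C3 → C3 →L[ℂ] ℂ := fun z => π 2 - π 1 z • π 0
  have hα (z : C3) : HasFDerivAt α (-(π 1).smulRight (π 0)) z :=
    ((π 1).hasFDerivAt.smul_const (π 0)).const_sub (π 2)
  refine ⟨toC3, ⟨.of_contDiff toC3.contDiff p, by rw [hd]; exact toC3_bijective⟩, α, ⟨?_, ?_⟩, ?_⟩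
  · exact analyticAt_const.sub (((π 1).analyticAt _).smul analyticAt_const)
  · refine ⟨e3 0, e3 1, e3 2, ?_⟩
    simp only [extD, (hα _).fderiv]
    simp [α, π, e3]
  · filter_upwards [hK] with x hx v
    rw [hx, hd, toC3_apply, toC3_apply]
    simp [α, π, stdForm]

lemma complexContactGerms_nonempty [IsManifold 𝓘(ℝ, E6) ∞ M] (p : M) :
    (complexContactGerms p).Nonempty := by
  have he : IsChartAt (chartAt E6 p) p :=
    ⟨IsManifold.chart_mem_maximalAtlas p, mem_chart_source E6 p⟩
  refine ⟨ofChart (chartAt E6 p) (model (0 : EuclideanSpace ℝ (Fin 0))), _, he,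
    supportsComplexContact_of_eventually_mem_iff_stdForm ?_⟩
  filter_upwards [eventually_inChart_ofChart he (model (0 : EuclideanSpace ℝ (Fin 0)))] with y hy v
  rw [hy, model_zero_iff]

/-- By Darboux there is only one germ to check, the undeformed model; a zero-dimensional parameter
space suffices. -/
lemma complexContactGerms_subset [IsManifold 𝓘(ℝ, E6) ∞ M] (p : M) :
    complexContactGerms p ⊆ fatReebGerms p := fun D hD => by
  obtain ⟨e, he, h0, h⟩ := exists_darboux_chart hD 0
  exact mem_fatReebGerms_of_model he h0 h

/-- Smooth families in another chart, as kernels of a complex-valued form. -/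
lemma IsSmoothFamily.exists_form {m : ℕ} {D : EuclideanSpace ℝ (Fin m) → Distribution M} {p : M}
    (hD : IsSmoothFamily D p) {e : OpenPartialHomeomorph M E6} (he : IsChartAt e p) :
    ∃ θ : EuclideanSpace ℝ (Fin m) × E6 → E6 →L[ℝ] ℂ, SmoothNear θ (0, e p) ∧
      ∀ᶠ z in 𝓝 ((0 : EuclideanSpace ℝ (Fin m)), e p),
        ∀ v, v ∈ inChart e (D z.1) z.2 ↔ θ z v = 0 := by
  obtain ⟨e', he', θ, hθ, -, hD⟩ := hD
  have hφ := (isLocalDiffeoNear_transition he he').1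
  have hsnd : SmoothNear (fun z : EuclideanSpace ℝ (Fin m) × E6 => z.2) (0, e p) :=
    .of_contDiff contDiff_snd _
  have hφ2 : SmoothNear (fun z : EuclideanSpace ℝ (Fin m) × E6 =>
      (z.1, transition e e' z.2)) (0, e p) := by
    filter_upwards [SmoothNear.comp (f := Prod.snd) (p := ((0 : EuclideanSpace ℝ (Fin m)), e p))
      hφ hsnd] with z hz
    exact contDiffAt_fst.prodMk hz
  have hφ0 : ((0 : EuclideanSpace ℝ (Fin m)), transition e e' (e p)) = (0, e' p) := by
    rw [transition_apply he]
  have hdφ : SmoothNear (fun z : EuclideanSpace ℝ (Fin m) × E6 =>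
      fderiv ℝ (transition e e') z.2) (0, e p) :=
    SmoothNear.comp (f := Prod.snd) (p := ((0 : EuclideanSpace ℝ (Fin m)), e p)) hφ.fderiv hsnd
  have hθφ (i : Fin 2) : SmoothNear (fun z : EuclideanSpace ℝ (Fin m) × E6 =>
      θ i (z.1, transition e e' z.2)) (0, e p) := by
    refine SmoothNear.comp (g := θ i) (f := fun z : EuclideanSpace ℝ (Fin m) × E6 =>
      (z.1, transition e e' z.2)) ?_ hφ2
    beta_reduce
    rw [hφ0]
    exact hθ i
  -- The two real forms are combined into θ₀ + i θ₁ and pulled back by the coordinate change.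
  refine ⟨fun z => (Complex.ofRealCLM.comp (θ 0 (z.1, transition e e' z.2))
    + Complex.I • Complex.ofRealCLM.comp (θ 1 (z.1, transition e e' z.2))).comp
      (fderiv ℝ (transition e e') z.2), ?_, ?_⟩
  · filter_upwards [hθφ 0, hθφ 1, hdφ] with z h0 h1 h2
    have hc : ContDiff ℝ ∞ (ContinuousLinearMap.compL ℝ E6 ℝ ℂ Complex.ofRealCLM) :=
      ContinuousLinearMap.contDiff _
    exact ((hc.contDiffAt.comp z h0).add ((hc.contDiffAt.comp z h1).const_smul _)).clm_comp h2
  · have h1 : ∀ᶠ z in 𝓝 ((0 : EuclideanSpace ℝ (Fin m)), e p), ∀ v,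
        v ∈ inChart e' (D z.1) (transition e e' z.2) ↔
          ∀ i, θ i (z.1, transition e e' z.2) v = 0 := by
      have h2 := hφ2.contDiffAt.continuousAt.tendsto
      beta_reduce at h2
      rw [hφ0] at h2
      exact h2.eventually hD
    have h2 : ∀ᶠ z in 𝓝 ((0 : EuclideanSpace ℝ (Fin m)), e p), ∀ (D : Distribution M) (v : E6),
        v ∈ inChart e D z.2 ↔
          fderiv ℝ (transition e e') z.2 v ∈ inChart e' D (transition e e' z.2) :=
      (continuousAt_snd (p := ((0 : EuclideanSpace ℝ (Fin m)), e p))).eventually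
        (eventually_mem_inChart_iff he he')
    filter_upwards [h1, h2] with z h3 h4 v
    rw [h4, h3, Fin.forall_fin_two, Complex.ext_iff]
    simp

lemma isSmoothFamily_ofChart_model {p : M} {e : OpenPartialHomeomorph M E6} (he : IsChartAt e p)
    (n : ℕ) :
    IsSmoothFamily (fun s : EuclideanSpace ℝ (Fin n) => ofChart e (model s)) p := by
  have hF : ContDiff ℝ ∞ fun z : EuclideanSpace ℝ (Fin n) × E6 =>
      graphForm (modelCoef z.1 z.2) := contDiff_graphForm.comp contDiff_modelCoef
  refine ⟨e, he, ![fun z => Complex.reCLM.comp (graphForm (modelCoef z.1 z.2)),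
    fun z => Complex.imCLM.comp (graphForm (modelCoef z.1 z.2))], ?_, ?_, ?_⟩
  · have h (g : ℂ →L[ℝ] ℝ) : ContDiff ℝ ∞ fun z : EuclideanSpace ℝ (Fin n) × E6 =>
        g.comp (graphForm (modelCoef z.1 z.2)) :=
      (ContinuousLinearMap.compL ℝ E6 ℂ ℝ g).contDiff.comp hF
    intro i
    fin_cases i
    · exact .of_contDiff (h _) _
    · exact .of_contDiff (h _) _
  · have h := (isDefinedBy_graphForms (p := e p)
      (.of_contDiff (contDiff_modelCoef_right (0 : EuclideanSpace ℝ (Fin n))) _)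
      (.of_forall fun _ _ => mem_model)).2.1
    convert! h using 2 with i
    fin_cases i <;> rfl
  · have h1 : ∀ᶠ z in 𝓝 ((0 : EuclideanSpace ℝ (Fin n)), e p), z.2 ∈ e.target :=
      continuousAt_snd.eventually (e.open_target.mem_nhds (e.map_source he.2))
    filter_upwards [h1] with z hz v
    rw [inChart_ofChart he _ hz, mem_model, Fin.forall_fin_two, Complex.ext_iff]
    rfl

/-- Complex-contact germs have infinite codimension among fat germs with Reeb directions. -/
theorem hasInfiniteCodim_complexContactGerms [IsManifold 𝓘(ℝ, E6) ∞ M] (p : M) :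
    HasInfiniteCodim (complexContactGerms p) (fatReebGerms p) p := by
  rintro n a ⟨ha, -⟩
  -- The invariant depends on this chart, which is adapted to the given germ: in it the germ is the
  -- undeformed model, which is regular.
  obtain ⟨e, he, h0, hea⟩ := exists_darboux_chart ha n
  have hchart {D D' : Distribution M} (h : ∀ᶠ x in 𝓝 p, D x = D' x) :
      inChart e D =ᶠ[𝓝 0] inChart e D' := by
    rw [← h0]
    exact inChart_congr he h
  refine ⟨fun D => germInvariant n (inChart e D), fun D D' h => germInvariant_congr (hchart h),
    fun D hD => ?_, fun m D hD => ?_, fun s => ofChart e (model s), ⟨?_, ?_, ?_⟩, ?_⟩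
  · have h := supportsComplexContact_inChart hD.1 he
    rw [h0] at h
    exact h.germInvariant_eq_zero n
  · obtain ⟨θ, hθ, hθD⟩ := hD.1.exists_form he
    rw [h0] at hθ hθD
    refine smoothNear_germInvariant (D := fun s => inChart e (D s)) hθ hθD ?_ n
    exact (isRegularGerm_congr ((hchart hD.2.1).trans hea)).2 (isRegularGerm_model _)
  · exact isSmoothFamily_ofChart_model he n
  · rw [← h0] at hea
    exact ofChart_inChart he hea
  · refine .of_forall fun s => mem_fatReebGerms_of_model he h0 ?_ (s := s)
    rw [← h0]
    exact eventually_inChart_ofChart he _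
  -- Along the model family the invariant is the identity of the parameter space, so its
  -- differential is onto.
  · have h : (fun s : EuclideanSpace ℝ (Fin n) =>
        germInvariant n (inChart e (ofChart e (model s)))) = id := by
      ext1 s
      have h1 := eventually_inChart_ofChart he (model s)
      rw [h0] at h1
      exact (germInvariant_congr h1).trans (germInvariant_model s)
    rw [h, fderiv_id]
    exact Function.surjective_id

end Codimension

end FatReeb

/-! ### The main theorem -/

theorem mainTheorem2 :
    -- the germ at `0` of `H_κ`
    (∀ κ : ℝ → ℝ, ContDiff ℝ ∞ κ →
      FatReeb.IsFat (FatReeb.H κ) 0 ∧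
      FatReeb.AreReebDirections (FatReeb.H κ) FatReeb.dz 0 ∧
      ∀ (D' : FatReeb.E6 → Submodule ℝ FatReeb.E6) (q : FatReeb.E6),
        FatReeb.DiffeomorphicGerms (FatReeb.H κ) 0 D' q →
          ¬ FatReeb.SupportsComplexContact D' q) ∧
    -- the family of germs is as large as the space of germs of smooth functions
    (∀ κ κ' : ℝ → ℝ, ContDiff ℝ ∞ κ → ContDiff ℝ ∞ κ' →
      (∀ᶠ x in 𝓝 (0 : FatReeb.E6), FatReeb.H κ x = FatReeb.H κ' x) →
        ∀ᶠ t in 𝓝 (0 : ℝ), κ t = κ' t) ∧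
    -- every point of a six-manifold
    (∀ (M : Type*) [TopologicalSpace M] [ChartedSpace FatReeb.E6 M]
      [IsManifold 𝓘(ℝ, FatReeb.E6) ∞ M] (p : M),
      -- the family transported by a chart
      (∀ e : OpenPartialHomeomorph M FatReeb.E6, FatReeb.IsChartAt e p → e p = 0 →
        ∀ κ : ℝ → ℝ, ContDiff ℝ ∞ κ → ∀ D : FatReeb.Distribution M,
          (∀ᶠ y in 𝓝 (0 : FatReeb.E6), FatReeb.inChart e D y = FatReeb.H κ y) →
            D ∈ FatReeb.fatReebGerms p \ FatReeb.complexContactGerms p) ∧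
      -- complex-contact germs among fat germs with Reeb directions
      (FatReeb.complexContactGerms p).Nonempty ∧
      FatReeb.complexContactGerms p ⊆ FatReeb.fatReebGerms p ∧
      FatReeb.HasInfiniteCodim (FatReeb.complexContactGerms p) (FatReeb.fatReebGerms p) p) := by
  refine ⟨fun κ hκ => ⟨FatReeb.isFat_H hκ, FatReeb.areReebDirections_H hκ, ?_⟩,
    fun κ κ' _ _ h => FatReeb.eventually_eq_of_H_eq h, ?_⟩
  · rintro D' _ ⟨Φ, hΦ, rfl, hD⟩ hD'
    exact FatReeb.not_supportsComplexContact_H hκ (hD'.pullback hΦ (.of_map hΦ hD))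
  · intro M _ _ _ p
    refine ⟨fun e he h0 κ hκ D hD => ⟨⟨e, he, ?_, FatReeb.dz, ?_⟩, fun hc => ?_⟩,
      FatReeb.complexContactGerms_nonempty p, FatReeb.complexContactGerms_subset p,
      FatReeb.hasInfiniteCodim_complexContactGerms p⟩
    · rw [h0]; exact (FatReeb.isFat_H hκ).congr hD
    · rw [h0]; exact (FatReeb.areReebDirections_H hκ).congr hD
    · have h := FatReeb.supportsComplexContact_inChart hc he
      rw [h0] at h
      exact FatReeb.not_supportsComplexContact_H hκ
        (h.congr (hD.mono fun _ hx => hx.symm))
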